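/- **Setting.** Let $\Sigma$ be a finite alphabet and $\Xi$ a countably infinite set of variables, disjoint from $\Sigma$. *Regexes.* A regex is a regular expression over $\Sigma$ (built from $\emptyset$, $\varepsilon$, letters, concatenation, $\vee$, $^+$, with $\alpha^*=\alpha^+\vee\varepsilon$) that may also contain recalls $x$ and bindings $\langle x:\alpha\rangle$, where $x\in\Xi$ does not occur in $\alpha$. A binding saves the word matched by $\alpha$ in the memory $x$, and a recall matches the current content of $x$; all memories are initially $\varepsilon$. Formally, $\gamma$ generates a set of ref-words, in which every binding contributes brackets $[_x\;]_x$ around the word generated by its body, and $\mathcal L(\gamma)$ consists of the words obtained from the ref-words by replacing, from left to right, every recall of $x$ with the value that was last saved in $x$ ($\varepsilon$ if there is none). The memory automaton $M_\gamma$ of $\gamma$ (Glushkov construction) has an initial state and one state for each occurrence of a terminal or recall in $\gamma$. It has a transition from $p$ to $q$ for every bracket word $g$ that can stand between the occurrences $p$ and $q$ as consecutive non-bracket symbols of a ref-word of $\gamma$ (before the first one $q$, if $p$ is initial); this transition first executes the memory instructions that $g$ amounts to (for each memory: keep, open, close, or reset) and then reads the label of $q$. The regex $\gamma$ is *deterministic*,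 $\gamma\in\mathsf{DRX}$, if any two distinct transitions of $M_\gamma$ with the same source read distinct terminals (so a transition that recalls a memory is the only one leaving its source). *FC-Datalog.* A program $P=(\mathfrak u,\mathcal R,\Phi)$ has a universe variable $\mathfrak u\in\Xi$, a finite set $\mathcal R\ni\mathrm{Ans}$ of relation symbols with arities, and a finite set $\Phi$ of rules $R(x_1,\dots,x_m)\leftarrow\varphi_1,\dots,\varphi_l$ with $l\ge 1$. Each $\varphi_i$ is a relation atom $R'(y_1,\dots,y_r)$ or a pattern equation $x\doteq\alpha$ with $\alpha\in(\Sigma\cup\Xi)^*$, $x$ not in $\alpha$; every head variable occurs in the body. On input $w\in\Sigma^*$, a substitution $\theta$ for a rule maps $\mathfrak u$ to $w$ and the variables of the rule to factors of $w$; the relations are the least fixed point of the rules. We write $(w,\theta)\models\rho$ if $\theta$ satisfies every body atom of $\rho$ in this fixed point. If $\mathrm{Ans}$ has arity $0$, then $P$ is Boolean and $\mathcal L(P)$ is the set of all $w$ for which $\mathrm{Ans}()$ is derived. Write $R\leftarrow R'$ if some rule has head symbol $R$ and $R'$ in its body; $R,R'$ are mutually recursive if each reaches the other under the transitive closure of $\leftarrow$.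 $P$ is *linear* if the body of each rule has at most one atom whose symbol is mutually recursive with the head symbol. For such a rule $\rho$, $\mathsf{top}(\rho)$ is the tuple of head variables followed by $\mathfrak u$, and $\mathsf{bottom}(\rho)$ is the tuple of variables of that body atom (empty if there is none). Let $W_\rho(w)$ be the set of all pairs $(\theta(\mathsf{top}(\rho)),\theta(\mathsf{bottom}(\rho)))$ for substitutions $\theta$ that satisfy the pattern equations of $\rho$. $P$ is *locally deterministic* if each $W_\rho(w)$ is a partial function, and *globally deterministic* if for distinct rules $\rho,\chi$ with the same head symbol, $W_\rho(w)$ and $W_\chi(w)$ never share a top tuple. A linear $P$ is $\mathsf{OLLA}$ if every pattern equation of every rule $\rho$ has one of the following forms, with $x,x'\in\mathsf{top}(\rho)$, $y\in\mathsf{bottom}(\rho)$, $a\in\Sigma\cup\{\varepsilon\}$ and $z$ a variable that is neither top nor bottom and occurs nowhere else in $\rho$: $x\doteq\varepsilon$; $x\doteq x'$; $x\doteq ya$, $y\doteq xa$, $\mathfrak u\doteq xaz$ (*right* forms if $a\neq\varepsilon$); $x\doteq ay$, $y\doteq ax$, $\mathfrak u\doteq zax$ (*left* forms if $a\ne\varepsilon$);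 and no top or bottom variable of $\rho$ is used in both a left and a right form in $\rho$. $P$ is $\mathsf{DOLLA}$ if it is $\mathsf{OLLA}$, locally and globally deterministic. Let $\Phi'\subseteq\Phi$ be the set of rules that have both a body atom mutually recursive with the head and at least one pattern equation. Say that $\rho$ *decreases from $x$ to $y$* if $x\in\mathsf{top}(\rho)$ and $y\in\mathsf{bottom}(\rho)$ occur together in a pattern equation of $\rho$ and $|\theta(y)|<|\theta(x)|$ whenever $(w,\theta)\models\rho$. A $\mathsf{DOLLA}$ program is *strictly decreasing* ($\mathsf{SD}$-$\mathsf{DOLLA}$) if every $\rho\in\Phi'$ decreases from some $x$ to some $y$ such that, where $R'(\vec y)$ is the mutually recursive body atom of $\rho$, every $\chi\in\Phi'$ with a head $R'(\vec x)$ decreases from some $x'$ to some $y'$ with $\theta(y)=\theta'(x')$ for all $w,\theta,\theta'$ with $(w,\theta)\models\rho$, $(w,\theta')\models\chi$ and $\theta'(\vec x)=\theta(\vec y)$ (that is, whenever $\chi$ is applied to the tuple that $\rho$ passes on). **Theorem.** Let $\gamma\in\mathsf{DRX}$ have $k$ memories (distinct variables), and let $n$ be the total number of occurrences of terminal symbols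 and memory recalls in $\gamma$. Then there is a Boolean $\mathsf{SD}$-$\mathsf{DOLLA}$ FC-Datalog program $P$ with $\mathcal L(P)=\mathcal L(\gamma)$ that has at most $k+n+2$ relation symbols and at most $k(|\Sigma|+1)+n(n+3)+1$ rules. -/

import Mathlib

/-- The countably infinite set of variables. They serve both as the string variables of
FC-Datalog programs and as the memories of regexes. -/
abbrev Var : Type := ℕ

/-! ## Regexes (regular expressions with back-references) -/

/-- Regexes over the terminal alphabet `A`: `ref x` recalls the memory `x`, and `bind x α` matches
`α` and saves the matched string in the memory `x`. -/
inductive Regex (A : Type*) where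
  | empty : Regex A
  | eps : Regex A
  | char (a : A) : Regex A
  | ref (x : Var) : Regex A
  | cat (α β : Regex A) : Regex A
  | alt (α β : Regex A) : Regex A
  | plus (α : Regex A) : Regex A
  | bind (x : Var) (α : Regex A) : Regex A

/-- Letters of marked ref-words. Each occurrence of a terminal or of a recall carries its position;
`opn x` and `cls x` are the brackets that delimit a value saved in the memory `x`. -/
inductive RefSym (A : Type*) where
  | char (i : ℕ) (a : A) : RefSym A
  | ref (i : ℕ) (x : Var) : RefSym A
  | opn (x : Var) : RefSym A
  | cls (x : Var) : RefSym A

/-- The instructions of a memory automaton for one memory: leave it unchanged, open it (discarding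
the old content), close it, or reset it to the empty word. -/
inductive MemInstr where
  | keep
  | opn
  | cls
  | reset

namespace RefSym

variable {A : Type*}

/-- The letter is one of the brackets `opn x`, `cls x`. -/
def IsBracket : RefSym A → Prop
  | char _ _ => False
  | ref _ _ => False
  | opn _ => True
  | cls _ => True

/-- The effect of one more bracket on the accumulated instruction for the memory `x`. -/
def accInstr (x : Var) (i : MemInstr) : RefSym A → MemInstr
  | char _ _ => i
  | ref _ _ => i
  | opn y => if y = x then MemInstr.opn else i
  | cls y =>
    if y = x then
      match i with
      | MemInstr.opn => MemInstr.reset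
      | MemInstr.reset => MemInstr.reset
      | _ => MemInstr.cls
    else i

/-- The memory instructions that a sequence of brackets amounts to. -/
def instr (g : List (RefSym A)) (x : Var) : MemInstr :=
  g.foldl (accInstr x) MemInstr.keep

/-- A memory configuration: the content of each memory, and whether it is open. -/
abbrev Mem (A : Type*) : Type _ := Var → List A × Bool

/-- Append the word `u` to all open memories. -/
def record (u : List A) (m : Mem A) : Mem A :=
  fun x => if (m x).2 then ((m x).1 ++ u, true) else m x

/-- The word that a ref-word stands for when it is read with memory configuration `m`: every recall
is replaced with the current content of its memory. -/
def deref : List (RefSym A) → Mem A → List A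
  | [], _ => []
  | char _ a :: r, m => a :: deref r (record [a] m)
  | ref _ x :: r, m => (m x).1 ++ deref r (record (m x).1 m)
  | opn x :: r, m => deref r (Function.update m x ([], true))
  | cls x :: r, m => deref r (Function.update m x ((m x).1, false))

end RefSym

namespace Regex

variable {A : Type*}

/-- Kleene star. -/
def star (α : Regex A) : Regex A := alt (plus α) eps

/-- The memories of a regex. -/
def vars : Regex A → Finset Var
  | empty => ∅
  | eps => ∅
  | char _ => ∅
  | ref x => {x}
  | cat α β => α.vars ∪ β.vars
  | alt α β => α.vars ∪ β.vars
  | plus α => α.vars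
  | bind x α => insert x α.vars

/-- The number of memories. -/
def numMem (γ : Regex A) : ℕ := γ.vars.card

/-- The total number of occurrences of terminal symbols and memory recalls. -/
def numOcc : Regex A → ℕ
  | empty => 0
  | eps => 0
  | char _ => 1
  | ref _ => 1
  | cat α β => α.numOcc + β.numOcc
  | alt α β => α.numOcc + β.numOcc
  | plus α => α.numOcc
  | bind _ α => α.numOcc

/-- A memory does not occur in an expression whose value is being saved in it. -/
def WF : Regex A → Prop
  | empty => True
  | eps => True
  | char _ => True
  | ref _ => True
  | cat α β => α.WF ∧ β.WF
  | alt α β => α.WF ∧ β.WF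
  | plus α => α.WF
  | bind x α => x ∉ α.vars ∧ α.WF

/-- The marked ref-words of a regex whose positions are numbered from `i` on, left to right. -/
def refWords : Regex A → ℕ → Language (RefSym A)
  | empty, _ => 0
  | eps, _ => 1
  | char a, i => {[RefSym.char i a]}
  | ref x, i => {[RefSym.ref i x]}
  | cat α β, i => α.refWords i * β.refWords (i + α.numOcc)
  | alt α β, i => α.refWords i + β.refWords (i + α.numOcc)
  | plus α, i => α.refWords i * KStar.kstar (α.refWords i)
  | bind x α, i => {[RefSym.opn x]} * α.refWords i * {[RefSym.cls x]}

/-- The language of a regex, under the semantics where every memory is initially empty. -/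
def language (γ : Regex A) : Language A :=
  {w | ∃ r ∈ γ.refWords 0, RefSym.deref r (fun _ => ([], false)) = w}

/-- The transitions of the memory automaton that the Glushkov construction assigns to a regex. Its
states are the initial state `none` and one state for each occurrence of a terminal or a recall.
The transition to the state `q` reads the label of `q` (a terminal or a recall) after it has
executed the memory instructions `I`. -/
def Trans (γ : Regex A) (p : Option (RefSym A)) (I : Var → MemInstr) (q : RefSym A) : Prop :=
  ¬ q.IsBracket ∧
  ∃ g : List (RefSym A), (∀ s ∈ g, s.IsBracket) ∧ I = RefSym.instr g ∧
    match p with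
    | none => ∃ r₂, g ++ q :: r₂ ∈ γ.refWords 0
    | some s => ¬ s.IsBracket ∧ ∃ r₁ r₂, r₁ ++ s :: (g ++ q :: r₂) ∈ γ.refWords 0

/-- The memory automaton of the regex is deterministic: distinct transitions with the same source
read distinct terminals. In particular, a transition that recalls a memory is the only one that
leaves its source. -/
def IsDeterministic (γ : Regex A) : Prop :=
  ∀ p I₁ q₁ I₂ q₂, γ.Trans p I₁ q₁ → γ.Trans p I₂ q₂ →
    (I₁ = I₂ ∧ q₁ = q₂) ∨
      ∃ i a j b, q₁ = RefSym.char i a ∧ q₂ = RefSym.char j b ∧ a ≠ b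

/-- The class `DRX` of deterministic regexes. -/
def IsDRX (γ : Regex A) : Prop := γ.WF ∧ γ.IsDeterministic

end Regex

/-! ## FC-Datalog -/

/-- Patterns over the terminal alphabet `A`. -/
abbrev Pattern (A : Type*) : Type _ := List (A ⊕ Var)

/-- The image of a pattern under a substitution. -/
def Pattern.subst {A : Type*} (θ : Var → List A) (α : Pattern A) : List A :=
  α.flatMap (Sum.elim (fun a => [a]) θ)

/-- FC-Datalog atoms over a set `S` of relation symbols: pattern equations and relation atoms. -/
inductive Atom (A S : Type*) where
  | eqn (x : Var) (α : Pattern A) : Atom A S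
  | rel (R : S) (ys : List Var) : Atom A S

/-- The variables of an atom, listed with repetitions. -/
def Atom.vars {A S : Type*} : Atom A S → List Var
  | eqn x α => x :: α.filterMap Sum.getRight?
  | rel _ ys => ys

/-- Relation atoms respect arities, and in a pattern equation `x ≐ α` the variable `x` does not
occur in `α`. -/
def Atom.WF {A S : Type*} (ar : S → ℕ) : Atom A S → Prop
  | eqn x α => Sum.inr x ∉ α
  | rel R ys => ys.length = ar R

/-- The rule `headSym (headArgs) ← body`. -/
structure Rule (A S : Type*) where
  headSym : S
  headArgs : List Var
  body : List (Atom A S)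

namespace Rule

variable {A S : Type*}

/-- All occurrences of variables in the rule. -/
def vars (ρ : Rule A S) : List Var := ρ.headArgs ++ ρ.body.flatMap Atom.vars

/-- The rule respects arities, has a non-empty body, and each head variable occurs in the body. -/
def WF (ar : S → ℕ) (ρ : Rule A S) : Prop :=
  ρ.headArgs.length = ar ρ.headSym ∧ ρ.body ≠ [] ∧ (∀ φ ∈ ρ.body, φ.WF ar) ∧
    ∀ x ∈ ρ.headArgs, ∃ φ ∈ ρ.body, x ∈ φ.vars

/-- The substitution solves all pattern equations of the rule. -/
def SatEqns (ρ : Rule A S) (θ : Var → List A) : Prop :=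
  ∀ x α, Atom.eqn x α ∈ ρ.body → θ x = Pattern.subst θ α

end Rule

/-- An FC-Datalog program with the finite set `S` of relation symbols: the universe variable, the
output relation symbol, the arities, and a finite set of rules. -/
structure Program (A S : Type*) where
  univ : Var
  ans : S
  ar : S → ℕ
  rules : Finset (Rule A S)
  wf : ∀ ρ ∈ rules, ρ.WF ar

namespace Program

variable {A S : Type*} (P : Program A S)

/-- `θ` is a `w`-substitution for the rule `ρ`: the universe variable is mapped to `w`, and every
variable of `ρ` is mapped to a factor of `w`. -/
def IsSubst (w : List A) (ρ : Rule A S) (θ : Var → List A) : Prop :=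
  θ P.univ = w ∧ ∀ x ∈ ρ.vars, θ x <:+: w

/-- `P.Derives w R t`: the tuple `t` belongs to the relation `R` in the least fixed point of the
program `P` on the input word `w`. -/
inductive Derives (w : List A) : S → List (List A) → Prop where
  | step (ρ : Rule A S) (hρ : ρ ∈ P.rules) (θ : Var → List A) (hθ : P.IsSubst w ρ θ)
      (heq : ρ.SatEqns θ)
      (hrel : ∀ R ys, Atom.rel R ys ∈ ρ.body → Derives w R (ys.map θ)) :
      Derives w ρ.headSym (ρ.headArgs.map θ)

/-- `(w, θ) ⊨ ρ`: the `w`-substitution `θ` satisfies all atoms in the body of `ρ`. -/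
def Models (w : List A) (θ : Var → List A) (ρ : Rule A S) : Prop :=
  P.IsSubst w ρ θ ∧ ρ.SatEqns θ ∧
    ∀ R ys, Atom.rel R ys ∈ ρ.body → P.Derives w R (ys.map θ)

/-- The program is Boolean. -/
def IsBoolean : Prop := P.ar P.ans = 0

/-- The language of a Boolean program. -/
def language : Language A := {w | P.Derives w P.ans []}

/-! ### Linearity -/

/-- There is a rule with head relation symbol `R` and with `R'` in its body. -/
def DependsOn (R R' : S) : Prop :=
  ∃ ρ ∈ P.rules, ρ.headSym = R ∧ ∃ ys, Atom.rel R' ys ∈ ρ.body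

/-- Two relation symbols are mutually recursive. -/
def MutRec (R R' : S) : Prop :=
  Relation.TransGen P.DependsOn R R' ∧ Relation.TransGen P.DependsOn R' R

open Classical in
/-- The relation atoms in the body of `ρ` (relation symbol and arguments) whose relation symbol is
mutually recursive with the head relation symbol of `ρ`. -/
noncomputable def recAtoms (ρ : Rule A S) : List (S × List Var) :=
  ρ.body.filterMap fun φ =>
    match φ with
    | Atom.eqn _ _ => none
    | Atom.rel R ys => if P.MutRec ρ.headSym R then some (R, ys) else none

/-- Every rule has at most one atom that is mutually recursive with its head. -/
def IsLinear : Prop := ∀ ρ ∈ P.rules, (P.recAtoms ρ).length ≤ 1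

/-- The top variables of a rule: the head variables and the universe variable. -/
def top (ρ : Rule A S) : List Var := ρ.headArgs ++ [P.univ]

/-- The bottom variables of a linear rule: the variables of the atom that is mutually recursive with
the head (none, if there is no such atom). -/
noncomputable def bottom (ρ : Rule A S) : List Var := (P.recAtoms ρ).flatMap Prod.snd

/-! ### Determinism -/

/-- The pairs of a top tuple and a bottom tuple of the rule `ρ` on the input word `w`. -/
def TopBottom (w : List A) (ρ : Rule A S) (t b : List (List A)) : Prop :=
  ∃ θ, P.IsSubst w ρ θ ∧ ρ.SatEqns θ ∧ t = (P.top ρ).map θ ∧ b = (P.bottom ρ).map θ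

/-- For each rule, the bottom tuple is a partial function of the top tuple. -/
def IsLocallyDeterministic : Prop :=
  ∀ ρ ∈ P.rules, ∀ w t b b', P.TopBottom w ρ t b → P.TopBottom w ρ t b' → b = b'

/-- Distinct rules with the same head relation symbol have no common top tuple. -/
def IsGloballyDeterministic : Prop :=
  ∀ ρ ∈ P.rules, ∀ χ ∈ P.rules, ρ.headSym = χ.headSym → ρ ≠ χ →
    ∀ w t b b', P.TopBottom w ρ t b → ¬ P.TopBottom w χ t b'

/-! ### One letter lookahead -/

/-- A pattern that is a single letter, or empty. -/
def letter (a : Option A) : Pattern A := (a.map Sum.inl).toList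

/-- The pattern that consists of one variable. -/
def pvar (x : Var) : Pattern A := [Sum.inr x]

/-- `z` is neither a top variable nor a bottom variable, and it occurs only once in `ρ`. -/
def IsFresh (ρ : Rule A S) (z : Var) : Prop :=
  z ∉ P.top ρ ∧ z ∉ P.bottom ρ ∧ ρ.vars.count z = 1

/-- Pattern equations `x ≐ ε` and `x ≐ x'` between top variables. -/
def IsTopEqn (ρ : Rule A S) (v : Var) (α : Pattern A) : Prop :=
  v ∈ P.top ρ ∧ (α = [] ∨ ∃ x' ∈ P.top ρ, α = pvar x')

/-- For top variables `x` and bottom variables `y`, the pattern equations `x ≐ ya`, `y ≐ xa` and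
`𝔲 ≐ xaz` with a fresh variable `z`. -/
def IsRightForm (ρ : Rule A S) (a : Option A) (v : Var) (α : Pattern A) : Prop :=
  (∃ y ∈ P.bottom ρ, v ∈ P.top ρ ∧ α = pvar y ++ letter a) ∨
  (∃ x ∈ P.top ρ, v ∈ P.bottom ρ ∧ α = pvar x ++ letter a) ∨
  (∃ x ∈ P.top ρ, ∃ z, v = P.univ ∧ P.IsFresh ρ z ∧ α = pvar x ++ letter a ++ pvar z)

/-- For top variables `x` and bottom variables `y`, the pattern equations `x ≐ ay`, `y ≐ ax` and
`𝔲 ≐ zax` with a fresh variable `z`. -/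
def IsLeftForm (ρ : Rule A S) (a : Option A) (v : Var) (α : Pattern A) : Prop :=
  (∃ y ∈ P.bottom ρ, v ∈ P.top ρ ∧ α = letter a ++ pvar y) ∨
  (∃ x ∈ P.top ρ, v ∈ P.bottom ρ ∧ α = letter a ++ pvar x) ∨
  (∃ x ∈ P.top ρ, ∃ z, v = P.univ ∧ P.IsFresh ρ z ∧ α = pvar z ++ letter a ++ pvar x)

/-- All pattern equations of the rule have one of the permitted forms. -/
def IsOLLARule (ρ : Rule A S) : Prop :=
  ∀ v α, Atom.eqn v α ∈ ρ.body →
    P.IsTopEqn ρ v α ∨ ∃ a : Option A, P.IsRightForm ρ a v α ∨ P.IsLeftForm ρ a v α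

/-- The variable `x` is used in a right OLLA pattern equation of `ρ`. -/
def UsedRight (ρ : Rule A S) (x : Var) : Prop :=
  ∃ v α, Atom.eqn v α ∈ ρ.body ∧ (∃ a : A, P.IsRightForm ρ (some a) v α) ∧
    x ∈ (Atom.eqn v α : Atom A S).vars

/-- The variable `x` is used in a left OLLA pattern equation of `ρ`. -/
def UsedLeft (ρ : Rule A S) (x : Var) : Prop :=
  ∃ v α, Atom.eqn v α ∈ ρ.body ∧ (∃ a : A, P.IsLeftForm ρ (some a) v α) ∧
    x ∈ (Atom.eqn v α : Atom A S).vars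

/-- One letter lookahead programs. -/
def IsOLLA : Prop :=
  P.IsLinear ∧ ∀ ρ ∈ P.rules, P.IsOLLARule ρ ∧
    ∀ x, (x ∈ P.top ρ ∨ x ∈ P.bottom ρ) → ¬ (P.UsedLeft ρ x ∧ P.UsedRight ρ x)

/-- Deterministic one letter lookahead programs. -/
def IsDOLLA : Prop :=
  P.IsOLLA ∧ P.IsLocallyDeterministic ∧ P.IsGloballyDeterministic

/-! ### Strictly decreasing programs -/

/-- The rule has a body atom that is mutually recursive with its head, and a pattern equation. -/
def IsCritical (ρ : Rule A S) : Prop :=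
  P.recAtoms ρ ≠ [] ∧ ∃ x α, Atom.eqn x α ∈ ρ.body

/-- The bottom variable `y` occurs in a pattern equation with the top variable `x`, and is always
mapped to a shorter word than `x`. -/
def Decreases (ρ : Rule A S) (x y : Var) : Prop :=
  x ∈ P.top ρ ∧ y ∈ P.bottom ρ ∧
    (∃ v α, Atom.eqn v α ∈ ρ.body ∧
      x ∈ (Atom.eqn v α : Atom A S).vars ∧ y ∈ (Atom.eqn v α : Atom A S).vars) ∧
    ∀ w θ, P.Models w θ ρ → (θ y).length < (θ x).length

/-- Each critical rule decreases a variable; and if a critical rule `χ` can be applied directly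
after `ρ`, that is, to the tuple that `ρ` passes on, then `χ` continues with the value of the
decreased variable of `ρ` and decreases it further. -/
def IsStrictlyDecreasing : Prop :=
  ∀ ρ ∈ P.rules, P.IsCritical ρ → ∃ x y, P.Decreases ρ x y ∧
    ∀ R' ys, (R', ys) ∈ P.recAtoms ρ → ∀ χ ∈ P.rules, P.IsCritical χ → χ.headSym = R' →
      ∃ x' y', P.Decreases χ x' y' ∧
        ∀ w θ θ', P.Models w θ ρ → P.Models w θ' χ → χ.headArgs.map θ' = ys.map θ → θ y = θ' x'

/-- Strictly decreasing deterministic one letter lookahead programs. -/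
def IsSDDOLLA : Prop := P.IsDOLLA ∧ P.IsStrictlyDecreasing

end Program

-- The program simulates the Glushkov automaton with one relation per state. A tuple holds the
-- unread input `s`, the memory contents and some bookkeeping, and a rule per transition leads to
-- the tuple of the next state. The input is stripped on the left while open memories grow on the
-- right, so no variable is used in forms of both directions. A recall takes many steps: the
-- recalled word is put into an argument `t` and matched against the input letter by letter. A
-- variable `e` for the empty word fills the arguments that have to be empty.
--
-- Replacing the regex by an automaton rests on two properties of ref-words: what may follow an
-- occurrence does not depend on what precedes it (`Regex.splice`), and neither does the set of
-- memories open there (`Regex.flag_unique`). With determinism, each transition has well-defined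
-- instructions (`Regex.trIns_eq`), and `Regex.language_memAut` follows.
--
-- Three obstacles shape the program. Bottom variables exist only for mutually recursive atoms, so
-- all state relations must lie on one cycle; rules with contradictory equations supply the missing
-- edges (`transGen_symR`).
--
-- Next, a final state may be left by a recall, which may match the empty word; a halting rule and a
-- recall rule would then share a top tuple. So halting is deferred: the recall raises a flag, by
-- passing on the whole input `𝔲`, and a flagged tuple without unread input is accepted at a later
-- recall state. On the empty input the flag is invisible, so that input gets additional halting
-- rules (`der_nil`).
--
-- Finally, the rules must be few. Deferring everywhere could run around a cycle of recalls forever,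
-- and deciding everywhere takes too many rules. The decision is forced only at the states in
-- `Star`, which can be entered from a state at least as far from the initial state. Elsewhere the
-- distance grows with each recall, so the flag comes to rest (`der_coast`); and a recall state in
-- `Star` has at least two incoming transitions, which pays for its rules (`card_targetSet_add_le`,
-- `count_aux`).
--
-- Every critical rule strips a letter from `s` or `t`, and a rule that strips one of them is never
-- directly followed by a critical rule that strips something else (`eq_of_applied`). Correctness is
-- `sound` together with `der_of_run` and `der_nil`. Languages without a nonempty word get a program
-- without recursion.

/-! ## Deterministic memory automata -/

namespace MemInstr

/-- What an instruction leaves in a memory that holds `x`, where `e` is the empty content. -/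
def eff {α : Type*} (e x : α) : MemInstr → α
  | keep => x
  | opn => e
  | cls => x
  | reset => e

/-- The status (open or not) of a memory after an instruction. -/
def status (b : Bool) : MemInstr → Bool
  | keep => b
  | opn => true
  | cls => false
  | reset => false

theorem map_eff {α β : Type*} (f : α → β) (e x : α) (i : MemInstr) :
    f (i.eff e x) = i.eff (f e) (f x) := by
  cases i <;> rfl

end MemInstr

/-- `MemPath tr l p`: the state `p` is reached from the initial state `0` in `l` transitions. -/
inductive MemPath {n : ℕ} (tr : Fin (n + 1) → Fin n → Prop) : ℕ → Fin (n + 1) → Prop where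
  | zero : MemPath tr 0 0
  | succ {l p q} : MemPath tr l p → tr p q → MemPath tr (l + 1) q.succ

/-- Deterministic memory automata with `k` memories whose states are the initial state `0` and one
state `q.succ` for each occurrence `q` of a terminal or a recall. The transition from `p` to
`q.succ` executes the instructions `ins p q` and then reads the label of `q`; `op p` is the set of
memories that are open in the state `p`. -/
structure MemAut (A : Type*) (n k : ℕ) where
  lab : Fin n → A ⊕ Fin k
  tr : Fin (n + 1) → Fin n → Prop
  ins : Fin (n + 1) → Fin n → Fin k → MemInstr
  op : Fin (n + 1) → Fin k → Bool
  fin : Fin (n + 1) → Prop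
  det : ∀ {p q₁ q₂}, tr p q₁ → tr p q₂ →
    q₁ = q₂ ∨ ∃ a b, lab q₁ = Sum.inl a ∧ lab q₂ = Sum.inl b ∧ a ≠ b
  op_succ : ∀ {p q}, tr p q → ∀ i, op q.succ i = (ins p q i).status (op p i)
  reach : ∀ {p q}, tr p q → ∃ l, MemPath tr l p

namespace MemAut

variable {A : Type*} {n k : ℕ} (M : MemAut A n k)

/-- Append `v` to all memories that are open in the state `p`. -/
def app (p : Fin (n + 1)) (v : List A) (μ : Fin k → List A) : Fin k → List A :=
  fun i => if M.op p i then μ i ++ v else μ i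

/-- The contents of the memories after the instructions of the transition from `p` to `q`. -/
def exec (p : Fin (n + 1)) (q : Fin n) (μ : Fin k → List A) : Fin k → List A :=
  fun i => (M.ins p q i).eff [] (μ i)

/-- `M.Run p μ s`: from the state `p` with memory contents `μ`, the automaton accepts `s`. -/
inductive Run : Fin (n + 1) → (Fin k → List A) → List A → Prop where
  | halt {p μ} (h : M.fin p) : Run p μ []
  | char {p μ q a s} (h : M.tr p q) (hq : M.lab q = Sum.inl a)
      (hr : Run q.succ (M.app q.succ [a] (M.exec p q μ)) s) : Run p μ (a :: s)
  | ref {p μ q x s} (h : M.tr p q) (hq : M.lab q = Sum.inr x)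
      (hr : Run q.succ (M.app q.succ (M.exec p q μ x) (M.exec p q μ)) s) :
      Run p μ (M.exec p q μ x ++ s)

/-- The language of a memory automaton: all memories are empty in the beginning. -/
def language : Language A := {w | M.Run 0 (fun _ => []) w}

end MemAut

/-! ## The memory automaton of a regex -/

-- Brackets and their effect on the memories

namespace RefSym

variable {A : Type*}

/-- The position of an occurrence. -/
def idx : RefSym A → ℕ
  | char i _ => i
  | ref i _ => i
  | _ => 0

/-- The occurrence with position `i` and label `l`. -/
def mk (i : ℕ) (l : A ⊕ Var) : RefSym A := Sum.elim (RefSym.char i) (RefSym.ref i) l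

theorem idx_mk (i : ℕ) (l : A ⊕ Var) : (mk i l).idx = i := by cases l <;> rfl

theorem not_isBracket_mk (i : ℕ) (l : A ⊕ Var) : ¬ (mk i l).IsBracket := by cases l <;> exact id

/-- The status of the memory `x` after a letter. -/
def flagStep (x : Var) (b : Bool) : RefSym A → Bool
  | char _ _ => b
  | ref _ _ => b
  | opn y => if y = x then true else b
  | cls y => if y = x then false else b

/-- The status of the memory `x` after a ref-word. -/
def flag (x : Var) (b : Bool) (r : List (RefSym A)) : Bool := r.foldl (flagStep x) b

theorem flag_append (x : Var) (b : Bool) (r s : List (RefSym A)) :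
    flag x b (r ++ s) = flag x (flag x b r) s := by simp [flag]

theorem flag_cons (x : Var) (b : Bool) (c : RefSym A) (s : List (RefSym A)) :
    flag x b (c :: s) = flag x (flagStep x b c) s := rfl

theorem flagStep_of_not_isBracket {x : Var} {b : Bool} {c : RefSym A} (h : ¬ c.IsBracket) :
    flagStep x b c = b := by
  cases c <;> simp_all [flagStep, IsBracket]

/-- The effect of a bracket on the memories. -/
def memStep (m : Mem A) : RefSym A → Mem A
  | opn x => Function.update m x ([], true)
  | cls x => Function.update m x ((m x).1, false)
  | _ => m

theorem deref_brackets (g r : List (RefSym A)) (hg : ∀ s ∈ g, s.IsBracket) (m : Mem A) :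
    deref (g ++ r) m = deref r (g.foldl memStep m) := by
  induction g generalizing m with
  | nil => rfl
  | cons c g ih =>
    have hc := hg c (by simp)
    have := ih (fun s hs => hg s (by simp [hs]))
    cases c <;> simp_all [IsBracket, deref, memStep]

/-- The content of `x` depends only on whether `x` was opened, its status only on the last bracket
of `x`; the accumulated instruction records exactly these two facts. Induction from the right
exposes the newest bracket to `accInstr`. -/
theorem foldl_memStep (g : List (RefSym A)) (hg : ∀ s ∈ g, s.IsBracket) (m : Mem A) (x : Var) :
    g.foldl memStep m x = ((instr g x).eff [] (m x).1, (instr g x).status (m x).2) := by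
  induction g using List.reverseRecOn with
  | nil => rfl
  | append_singleton g c ih =>
    have ih := ih (fun s hs => hg s (by simp [hs]))
    have hc := hg c (by simp)
    have hi : instr (g ++ [c]) x = accInstr x (instr g x) c := by simp [instr]
    rw [hi, List.foldl_append]
    cases c with
    | char => exact hc.elim
    | ref => exact hc.elim
    | opn y =>
      by_cases h : y = x
      · subst h; simp [memStep, accInstr, MemInstr.eff, MemInstr.status]
      · simp [memStep, accInstr, h, ih, Function.update_of_ne (Ne.symm h)]
    | cls y =>
      by_cases h : y = x
      · subst h
        simp only [List.foldl_cons, List.foldl_nil, memStep, accInstr, if_true,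
          Function.update_self, ih]
        cases instr g y <;> rfl
      · simp [memStep, accInstr, h, ih, Function.update_of_ne (Ne.symm h)]

theorem flag_brackets (g : List (RefSym A)) (hg : ∀ s ∈ g, s.IsBracket) (x : Var) (b : Bool) :
    flag x b g = (instr g x).status b := by
  have h := foldl_memStep g hg (fun _ => (([] : List A), b)) x
  have key : ∀ (g : List (RefSym A)) (m : Mem A), (g.foldl memStep m x).2 = flag x (m x).2 g := by
    intro g
    induction g with
    | nil => intro m; rfl
    | cons c g ih =>
      intro m
      rw [List.foldl_cons, ih, flag_cons]
      congr 1
      cases c <;> simp only [memStep, flagStep, Function.update_apply, @eq_comm _ x] <;>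
        split_ifs <;> rfl
  rw [← key g (fun _ => ([], b)), h]

theorem exists_brackets_append (r : List (RefSym A)) :
    (∀ s ∈ r, s.IsBracket) ∨
      ∃ g q r', (∀ s ∈ g, s.IsBracket) ∧ ¬ q.IsBracket ∧ r = g ++ q :: r' := by
  induction r with
  | nil => simp
  | cons c r ih =>
    by_cases hc : c.IsBracket
    · rcases ih with h | ⟨g, q, r', hg, hq, rfl⟩
      · exact Or.inl (by simpa [hc] using h)
      · exact Or.inr ⟨c :: g, q, r', by simpa [hc] using hg, hq, rfl⟩
    · exact Or.inr ⟨[], c, r, by simp, hc, rfl⟩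

theorem exists_append_brackets (r : List (RefSym A)) :
    (∀ s ∈ r, s.IsBracket) ∨
      ∃ r' q g, (∀ s ∈ g, s.IsBracket) ∧ ¬ q.IsBracket ∧ r = r' ++ q :: g := by
  induction r using List.reverseRecOn with
  | nil => simp
  | append_singleton r c ih =>
    by_cases hc : c.IsBracket
    · rcases ih with h | ⟨r', q, g, hg, hq, rfl⟩
      · refine Or.inl fun s hs => ?_
        rcases List.mem_append.1 hs with hs | hs
        · exact h s hs
        · simp_all
      · refine Or.inr ⟨r', q, g ++ [c], fun s hs => ?_, hq, by simp⟩
        rcases List.mem_append.1 hs with hs | hs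
        · exact hg s hs
        · simp_all
    · exact Or.inr ⟨r, c, [], by simp, hc, rfl⟩

end RefSym

theorem List.append_cons_eq_append {α : Type*} {r₁ r₂ u v : List α} {s : α}
    (h : r₁ ++ s :: r₂ = u ++ v) :
    (∃ r, u = r₁ ++ s :: r ∧ r₂ = r ++ v) ∨ ∃ r, r₁ = u ++ r ∧ v = r ++ s :: r₂ := by
  rcases List.append_eq_append_iff.1 h with ⟨a, rfl, h2⟩ | ⟨a, rfl, h2⟩
  · cases a with
    | nil => exact Or.inr ⟨[], by simp, by simpa using h2.symm⟩
    | cons b a =>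
      simp only [List.cons_append, List.cons.injEq] at h2
      exact Or.inl ⟨a, by simp [h2.1], h2.2⟩
  · exact Or.inr ⟨a, rfl, h2⟩

theorem List.append_cons_eq_flatten {α : Type*} {r₁ r₂ : List α} {s : α} {L : List (List α)}
    (h : r₁ ++ s :: r₂ = L.flatten) :
    ∃ L₁ a b L₂, L = L₁ ++ (a ++ s :: b) :: L₂ ∧ r₁ = L₁.flatten ++ a ∧ r₂ = b ++ L₂.flatten := by
  induction L generalizing r₁ with
  | nil => simp at h
  | cons u L ih =>
    rw [List.flatten_cons] at h
    rcases List.append_cons_eq_append h with ⟨r, rfl, rfl⟩ | ⟨r, rfl, hr⟩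
    · exact ⟨[], r₁, r, L, by simp⟩
    · obtain ⟨L₁, a, b, L₂, rfl, rfl, rfl⟩ := ih hr.symm
      exact ⟨u :: L₁, a, b, L₂, by simp⟩

-- Occurrences and brackets inside ref-words

namespace Regex

variable {A : Type*}

open RefSym

/-- The labels of the occurrences, from left to right. -/
def labels : Regex A → List (A ⊕ Var)
  | empty => []
  | eps => []
  | char a => [Sum.inl a]
  | ref x => [Sum.inr x]
  | cat α β => α.labels ++ β.labels
  | alt α β => α.labels ++ β.labels
  | plus α => α.labels
  | bind _ α => α.labels

theorem length_labels (γ : Regex A) : γ.labels.length = γ.numOcc := by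
  induction γ <;> simp_all [labels, numOcc]

theorem mem_vars_of_mem_labels {γ : Regex A} {x : Var} (h : Sum.inr x ∈ γ.labels) :
    x ∈ γ.vars := by
  induction γ <;> simp_all [labels, vars] <;> tauto

theorem mem_refWords_cat {α β : Regex A} {i : ℕ} {r : List (RefSym A)} :
    r ∈ (cat α β).refWords i ↔
      ∃ u ∈ α.refWords i, ∃ v ∈ β.refWords (i + α.numOcc), u ++ v = r := by
  simp [refWords, Language.mem_mul]

theorem mem_refWords_alt {α β : Regex A} {i : ℕ} {r : List (RefSym A)} :
    r ∈ (alt α β).refWords i ↔ r ∈ α.refWords i ∨ r ∈ β.refWords (i + α.numOcc) := by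
  simp [refWords, Language.mem_add]

theorem mem_refWords_plus {α : Regex A} {i : ℕ} {r : List (RefSym A)} :
    r ∈ (plus α).refWords i ↔
      ∃ L : List (List (RefSym A)), L ≠ [] ∧ r = L.flatten ∧ ∀ u ∈ L, u ∈ α.refWords i := by
  simp only [refWords, Language.mem_mul, Language.mem_kstar]
  constructor
  · rintro ⟨u, hu, v, ⟨L, rfl, hL⟩, rfl⟩
    exact ⟨u :: L, by simp, by simp, by simpa using ⟨hu, hL⟩⟩
  · rintro ⟨L, hL, rfl, h⟩
    cases L with
    | nil => exact (hL rfl).elim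
    | cons u L =>
      exact ⟨u, h u (by simp), L.flatten, ⟨L, rfl, fun v hv => h v (by simp [hv])⟩, by simp⟩

theorem mem_refWords_bind {α : Regex A} {x : Var} {i : ℕ} {r : List (RefSym A)} :
    r ∈ (bind x α).refWords i ↔ ∃ u ∈ α.refWords i, r = RefSym.opn x :: (u ++ [RefSym.cls x]) := by
  simp only [refWords, Language.mem_mul]
  constructor
  · rintro ⟨_, ⟨_, rfl, u, hu, rfl⟩, _, rfl, rfl⟩
    exact ⟨u, hu, by simp⟩
  · rintro ⟨u, hu, rfl⟩
    exact ⟨_, ⟨_, rfl, u, hu, rfl⟩, _, rfl, by simp⟩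

theorem exists_label_of_mem {γ : Regex A} {i : ℕ} {r : List (RefSym A)} (hr : r ∈ γ.refWords i)
    {s : RefSym A} (hs : s ∈ r) (hb : ¬ s.IsBracket) :
    ∃ j l, γ.labels[j]? = some l ∧ s = RefSym.mk (i + j) l := by
  induction γ generalizing i r with
  | empty => exact hr.elim
  | eps =>
    simp only [refWords, Language.mem_one] at hr
    simp [hr] at hs
  | char a =>
    have hr : r = [RefSym.char i a] := hr
    subst hr
    exact ⟨0, Sum.inl a, rfl, by simpa [mk] using hs⟩
  | ref x =>
    have hr : r = [RefSym.ref i x] := hr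
    subst hr
    exact ⟨0, Sum.inr x, rfl, by simpa [mk] using hs⟩
  | cat α β ihα ihβ =>
    obtain ⟨u, hu, v, hv, rfl⟩ := mem_refWords_cat.1 hr
    rcases List.mem_append.1 hs with hs | hs
    · obtain ⟨j, l, hj, rfl⟩ := ihα hu hs
      exact ⟨j, l, by simp [labels, List.getElem?_append_left (List.getElem?_eq_some_iff.1 hj).1, hj],
        rfl⟩
    · obtain ⟨j, l, hj, rfl⟩ := ihβ hv hs
      refine ⟨α.numOcc + j, l, ?_, by rw [Nat.add_assoc]⟩
      rw [labels, List.getElem?_append_right (by simp [length_labels]), length_labels]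
      simpa using hj
  | alt α β ihα ihβ =>
    rcases mem_refWords_alt.1 hr with hu | hv
    · obtain ⟨j, l, hj, rfl⟩ := ihα hu hs
      exact ⟨j, l, by simp [labels, List.getElem?_append_left (List.getElem?_eq_some_iff.1 hj).1, hj],
        rfl⟩
    · obtain ⟨j, l, hj, rfl⟩ := ihβ hv hs
      refine ⟨α.numOcc + j, l, ?_, by rw [Nat.add_assoc]⟩
      rw [labels, List.getElem?_append_right (by simp [length_labels]), length_labels]
      simpa using hj
  | plus α ih =>
    obtain ⟨L, -, rfl, hL⟩ := mem_refWords_plus.1 hr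
    obtain ⟨u, hu, hs⟩ := List.mem_flatten.1 hs
    exact ih (hL u hu) hs
  | bind x α ih =>
    obtain ⟨u, hu, rfl⟩ := mem_refWords_bind.1 hr
    have : s ∈ u := by
      rcases List.mem_cons.1 hs with rfl | hs
      · exact (hb trivial).elim
      · rcases List.mem_append.1 hs with hs | hs
        · exact hs
        · exact (hb (by simp at hs; subst hs; trivial)).elim
    exact ih hu this

/-- The two parts of a concatenation or alternation use disjoint ranges of positions. This rules out
the mixed cases in `splice` and `flag_unique`, where one occurrence would lie in both parts. -/
theorem idx_range {γ : Regex A} {i : ℕ} {r : List (RefSym A)} (hr : r ∈ γ.refWords i)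
    {s : RefSym A} (hs : s ∈ r) (hb : ¬ s.IsBracket) : i ≤ s.idx ∧ s.idx < i + γ.numOcc := by
  obtain ⟨j, l, hj, rfl⟩ := exists_label_of_mem hr hs hb
  have := (List.getElem?_eq_some_iff.1 hj).1
  rw [length_labels] at this
  rw [idx_mk]
  omega

theorem bind_split {α : Regex A} {x : Var} {i : ℕ} {r₁ r₂ : List (RefSym A)} {s : RefSym A}
    (h : r₁ ++ s :: r₂ ∈ (bind x α).refWords i) (hb : ¬ s.IsBracket) :
    ∃ a b, a ++ s :: b ∈ α.refWords i ∧ r₁ = RefSym.opn x :: a ∧ r₂ = b ++ [RefSym.cls x] := by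
  obtain ⟨u, hu, e⟩ := mem_refWords_bind.1 h
  clear h
  cases r₁ with
  | nil =>
    simp only [List.nil_append, List.cons.injEq] at e
    exact (hb (by rw [e.1]; trivial)).elim
  | cons c r₁ =>
    simp only [List.cons_append, List.cons.injEq] at e
    obtain ⟨rfl, e⟩ := e
    rcases List.append_cons_eq_append e with ⟨r, rfl, rfl⟩ | ⟨r, rfl, hr⟩
    · exact ⟨r₁, r, hu, rfl, rfl⟩
    · cases r with
      | nil =>
        simp only [List.nil_append, List.cons.injEq] at hr
        exact (hb (by rw [← hr.1]; trivial)).elim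
      | cons => simp at hr

/-- An occurrence has the same continuations in all ref-words in which it appears. -/
theorem splice {γ : Regex A} {i : ℕ} {r₁ r₂ r₁' r₂' : List (RefSym A)} {s : RefSym A}
    (hb : ¬ s.IsBracket) (h : r₁ ++ s :: r₂ ∈ γ.refWords i) (h' : r₁' ++ s :: r₂' ∈ γ.refWords i) :
    r₁ ++ s :: r₂' ∈ γ.refWords i := by
  induction γ generalizing i r₁ r₂ r₁' r₂' with
  | empty => exact h.elim
  | eps => simp [refWords, Language.mem_one] at h
  | char a =>
    have h : r₁ ++ s :: r₂ = [RefSym.char i a] := h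
    have h' : r₁' ++ s :: r₂' = [RefSym.char i a] := h'
    cases r₁ <;> cases r₁' <;> simp_all
  | ref x =>
    have h : r₁ ++ s :: r₂ = [RefSym.ref i x] := h
    have h' : r₁' ++ s :: r₂' = [RefSym.ref i x] := h'
    cases r₁ <;> cases r₁' <;> simp_all
  | cat α β ihα ihβ =>
    obtain ⟨u, hu, v, hv, e⟩ := mem_refWords_cat.1 h
    obtain ⟨u', hu', v', hv', e'⟩ := mem_refWords_cat.1 h'
    rcases List.append_cons_eq_append e.symm with ⟨a, rfl, rfl⟩ | ⟨a, rfl, rfl⟩ <;>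
      rcases List.append_cons_eq_append e'.symm with ⟨a', rfl, rfl⟩ | ⟨a', rfl, rfl⟩
    · exact mem_refWords_cat.2 ⟨_, ihα hu hu', _, hv', by simp⟩
    · have h1 := idx_range hu (s := s) (by simp) hb
      have h2 := idx_range hv' (s := s) (by simp) hb
      omega
    · have h1 := idx_range hu' (s := s) (by simp) hb
      have h2 := idx_range hv (s := s) (by simp) hb
      omega
    · exact mem_refWords_cat.2 ⟨_, hu, _, ihβ hv hv', by simp⟩
  | alt α β ihα ihβ =>
    rw [mem_refWords_alt] at h h' ⊢
    rcases h with h | h <;> rcases h' with h' | h'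
    · exact Or.inl (ihα h h')
    · have h1 := idx_range h (s := s) (by simp) hb
      have h2 := idx_range h' (s := s) (by simp) hb
      omega
    · have h1 := idx_range h (s := s) (by simp) hb
      have h2 := idx_range h' (s := s) (by simp) hb
      omega
    · exact Or.inr (ihβ h h')
  | plus α ih =>
    obtain ⟨L, -, e, hL⟩ := mem_refWords_plus.1 h
    obtain ⟨L', -, e', hL'⟩ := mem_refWords_plus.1 h'
    obtain ⟨L₁, a, b, L₂, rfl, rfl, rfl⟩ := List.append_cons_eq_flatten e
    obtain ⟨L₁', a', b', L₂', rfl, rfl, rfl⟩ := List.append_cons_eq_flatten e'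
    refine mem_refWords_plus.2 ⟨L₁ ++ (a ++ s :: b') :: L₂', by simp, by simp, ?_⟩
    intro u hu
    simp only [List.mem_append, List.mem_cons] at hu
    rcases hu with hu | rfl | hu
    · exact hL u (by simp [hu])
    · exact ih (hL (a ++ s :: b) (by simp)) (hL' (a' ++ s :: b') (by simp))
    · exact hL' u (by simp [hu])
  | bind x α ih =>
    obtain ⟨a, b, hab, rfl, rfl⟩ := bind_split h hb
    obtain ⟨a', b', hab', rfl, rfl⟩ := bind_split h' hb
    exact mem_refWords_bind.2 ⟨_, ih hab hab', by simp⟩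

theorem flag_flatten {α : Regex A} {i : ℕ} {x : Var} {b : Bool}
    (h : ∀ r ∈ α.refWords i, flag x b r = b) (L : List (List (RefSym A)))
    (hL : ∀ u ∈ L, u ∈ α.refWords i) : flag x b L.flatten = b := by
  induction L with
  | nil => rfl
  | cons u L ih =>
    rw [List.flatten_cons, flag_append, h u (hL u (by simp)), ih fun v hv => hL v (by simp [hv])]

theorem flag_of_notMem {γ : Regex A} {i : ℕ} {x : Var} (hx : x ∉ γ.vars) (b : Bool)
    {r : List (RefSym A)} (hr : r ∈ γ.refWords i) {r₁ r₂ : List (RefSym A)} (h : r = r₁ ++ r₂) :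
    flag x b r₁ = b := by
  suffices H : ∀ s ∈ r, ∀ b, flagStep x b s = b by
    have H' : ∀ s ∈ r₁, ∀ b, flagStep x b s = b := fun s hs => H s (by simp [h, hs])
    clear h H hr
    induction r₁ with
    | nil => rfl
    | cons c r₁ ih =>
      rw [flag_cons, H' c (by simp), ih fun s hs => H' s (by simp [hs])]
  clear h r₁ r₂ b
  induction γ generalizing i r with
  | empty => exact hr.elim
  | eps =>
    simp only [refWords, Language.mem_one] at hr
    simp [hr]
  | char a =>
    have hr : r = [RefSym.char i a] := hr
    simp [hr, flagStep]
  | ref y =>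
    have hr : r = [RefSym.ref i y] := hr
    simp [hr, flagStep]
  | cat α β ihα ihβ =>
    simp only [vars, Finset.mem_union, not_or] at hx
    obtain ⟨u, hu, v, hv, rfl⟩ := mem_refWords_cat.1 hr
    intro s hs
    rcases List.mem_append.1 hs with hs | hs
    · exact ihα hx.1 hu s hs
    · exact ihβ hx.2 hv s hs
  | alt α β ihα ihβ =>
    simp only [vars, Finset.mem_union, not_or] at hx
    rcases mem_refWords_alt.1 hr with hu | hv
    · exact ihα hx.1 hu
    · exact ihβ hx.2 hv
  | plus α ih =>
    obtain ⟨L, -, rfl, hL⟩ := mem_refWords_plus.1 hr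
    intro s hs
    obtain ⟨u, hu, hs⟩ := List.mem_flatten.1 hs
    exact ih hx (hL u hu) s hs
  | bind y α ih =>
    simp only [vars, Finset.mem_insert, not_or] at hx
    obtain ⟨u, hu, rfl⟩ := mem_refWords_bind.1 hr
    intro s hs
    simp only [List.mem_cons, List.mem_append, List.not_mem_nil, or_false] at hs
    rcases hs with rfl | hs | rfl
    · simp [flagStep, Ne.symm hx.1]
    · exact ih hx.2 hu s hs
    · simp [flagStep, Ne.symm hx.1]

/-- Brackets are balanced: a binding of `x` ends by closing `x`. Hence complete factors in front of
an occurrence do not influence which memories are open there. -/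
theorem flag_refWord {γ : Regex A} {i : ℕ} (x : Var) {r : List (RefSym A)}
    (hr : r ∈ γ.refWords i) : flag x false r = false := by
  induction γ generalizing i r with
  | empty => exact hr.elim
  | eps =>
    simp only [refWords, Language.mem_one] at hr
    simp [hr, flag]
  | char a =>
    have hr : r = [RefSym.char i a] := hr
    simp [hr, flag, flagStep]
  | ref y =>
    have hr : r = [RefSym.ref i y] := hr
    simp [hr, flag, flagStep]
  | cat α β ihα ihβ =>
    obtain ⟨u, hu, v, hv, rfl⟩ := mem_refWords_cat.1 hr
    rw [flag_append, ihα hu, ihβ hv]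
  | alt α β ihα ihβ =>
    rcases mem_refWords_alt.1 hr with hu | hv
    · exact ihα hu
    · exact ihβ hv
  | plus α ih =>
    obtain ⟨L, -, rfl, hL⟩ := mem_refWords_plus.1 hr
    exact flag_flatten (fun r hr => ih hr) L hL
  | bind y α ih =>
    obtain ⟨u, hu, rfl⟩ := mem_refWords_bind.1 hr
    rw [flag_cons, flag_append]
    by_cases h : y = x
    · simp [flag, flagStep, h]
    · simp [flag_cons, flagStep, h, ih hu]
      simp [flag]

/-- Whether a memory is open at an occurrence depends only on the occurrence. -/
theorem flag_unique {γ : Regex A} (hγ : γ.WF) {i : ℕ} (x : Var)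
    {r₁ r₂ r₁' r₂' : List (RefSym A)} {s : RefSym A} (hb : ¬ s.IsBracket)
    (h : r₁ ++ s :: r₂ ∈ γ.refWords i) (h' : r₁' ++ s :: r₂' ∈ γ.refWords i) :
    flag x false r₁ = flag x false r₁' := by
  induction γ generalizing i r₁ r₂ r₁' r₂' with
  | empty => exact h.elim
  | eps => simp [refWords, Language.mem_one] at h
  | char a =>
    have h : r₁ ++ s :: r₂ = [RefSym.char i a] := h
    have h' : r₁' ++ s :: r₂' = [RefSym.char i a] := h'
    cases r₁ <;> cases r₁' <;> simp_all
  | ref x =>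
    have h : r₁ ++ s :: r₂ = [RefSym.ref i x] := h
    have h' : r₁' ++ s :: r₂' = [RefSym.ref i x] := h'
    cases r₁ <;> cases r₁' <;> simp_all
  | cat α β ihα ihβ =>
    obtain ⟨u, hu, v, hv, e⟩ := mem_refWords_cat.1 h
    obtain ⟨u', hu', v', hv', e'⟩ := mem_refWords_cat.1 h'
    rcases List.append_cons_eq_append e.symm with ⟨a, rfl, rfl⟩ | ⟨a, rfl, rfl⟩ <;>
      rcases List.append_cons_eq_append e'.symm with ⟨a', rfl, rfl⟩ | ⟨a', rfl, rfl⟩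
    · exact ihα hγ.1 hu hu'
    · have h1 := idx_range hu (s := s) (by simp) hb
      have h2 := idx_range hv' (s := s) (by simp) hb
      omega
    · have h1 := idx_range hu' (s := s) (by simp) hb
      have h2 := idx_range hv (s := s) (by simp) hb
      omega
    · rw [flag_append, flag_append, flag_refWord x hu, flag_refWord x hu']
      exact ihβ hγ.2 hv hv'
  | alt α β ihα ihβ =>
    rw [mem_refWords_alt] at h h'
    rcases h with h | h <;> rcases h' with h' | h'
    · exact ihα hγ.1 h h'
    · have h1 := idx_range h (s := s) (by simp) hb
      have h2 := idx_range h' (s := s) (by simp) hb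
      omega
    · have h1 := idx_range h (s := s) (by simp) hb
      have h2 := idx_range h' (s := s) (by simp) hb
      omega
    · exact ihβ hγ.2 h h'
  | plus α ih =>
    obtain ⟨L, -, e, hL⟩ := mem_refWords_plus.1 h
    obtain ⟨L', -, e', hL'⟩ := mem_refWords_plus.1 h'
    obtain ⟨L₁, a, b, L₂, rfl, rfl, rfl⟩ := List.append_cons_eq_flatten e
    obtain ⟨L₁', a', b', L₂', rfl, rfl, rfl⟩ := List.append_cons_eq_flatten e'
    have hfl : ∀ r ∈ α.refWords i, flag x false r = false := fun r hr => flag_refWord x hr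
    rw [flag_append, flag_append, flag_flatten hfl L₁ fun u hu => hL u (by simp [hu]),
      flag_flatten hfl L₁' fun u hu => hL' u (by simp [hu])]
    exact ih hγ (hL (a ++ s :: b) (by simp)) (hL' (a' ++ s :: b') (by simp))
  | bind y α ih =>
    obtain ⟨a, b, hab, rfl, rfl⟩ := bind_split h hb
    obtain ⟨a', b', hab', rfl, rfl⟩ := bind_split h' hb
    rw [flag_cons, flag_cons]
    by_cases hy : y = x
    · subst hy
      -- Well-formedness enters here: the body has no bracket of the memory that is being saved,
      -- which therefore stays open throughout.
      rw [flag_of_notMem hγ.1 _ hab rfl, flag_of_notMem hγ.1 _ hab' rfl]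
    · simpa [flagStep, hy] using ih hγ.2 hab hab'

end Regex

-- The Glushkov automaton of a deterministic regex and its runs

namespace Regex

variable {A : Type*} (γ : Regex A)

open RefSym

/-- The memory with number `i`. -/
noncomputable def mem (i : Fin γ.numMem) : Var := (γ.vars.equivFin.symm i).1

theorem exists_lab (q : Fin γ.numOcc) :
    ∃ l : A ⊕ Fin γ.numMem, γ.labels[q.1]? = some (Sum.map id γ.mem l) := by
  have hq : q.1 < γ.labels.length := by rw [length_labels]; exact q.2
  rw [List.getElem?_eq_getElem hq]
  rcases h : γ.labels[q.1] with a | x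
  · exact ⟨Sum.inl a, rfl⟩
  · have hx : x ∈ γ.vars := mem_vars_of_mem_labels (h ▸ List.getElem_mem hq)
    obtain ⟨i, rfl⟩ : ∃ i : Fin γ.numMem, γ.mem i = x :=
      ⟨γ.vars.equivFin ⟨x, hx⟩, congrArg Subtype.val (γ.vars.equivFin.symm_apply_apply ⟨x, hx⟩)⟩
    exact ⟨Sum.inr i, rfl⟩

/-- The label of an occurrence. -/
noncomputable def lab (q : Fin γ.numOcc) : A ⊕ Fin γ.numMem := (γ.exists_lab q).choose

/-- The occurrence with number `q`. -/
noncomputable def occ (q : Fin γ.numOcc) : RefSym A := RefSym.mk q (Sum.map id γ.mem (γ.lab q))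

theorem not_isBracket_occ (q : Fin γ.numOcc) : ¬ (γ.occ q).IsBracket := not_isBracket_mk _ _

theorem occ_injective : Function.Injective γ.occ := fun p q h => by
  have := congrArg RefSym.idx h
  simp only [occ, idx_mk] at this
  exact Fin.ext this

variable {γ} in
theorem exists_occ {r : List (RefSym A)} (hr : r ∈ γ.refWords 0) {s : RefSym A} (hs : s ∈ r)
    (hb : ¬ s.IsBracket) : ∃ q, s = γ.occ q := by
  obtain ⟨j, l, hj, rfl⟩ := exists_label_of_mem hr hs hb
  have hj' := (List.getElem?_eq_some_iff.1 hj).1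
  rw [length_labels] at hj'
  refine ⟨⟨j, hj'⟩, ?_⟩
  have h := hj.symm.trans (γ.exists_lab ⟨j, hj'⟩).choose_spec
  rw [Option.some.injEq] at h
  rw [occ, lab, ← h, zero_add]

/-- The states of the memory automaton. -/
noncomputable def state (p : Fin (γ.numOcc + 1)) : Option (RefSym A) :=
  Fin.cases none (fun q => some (γ.occ q)) p

/-- The ref-words that can be read after the state `p`. -/
def Cont (p : Fin (γ.numOcc + 1)) (r : List (RefSym A)) : Prop :=
  Fin.cases (r ∈ γ.refWords 0) (fun q => ∃ r₁, r₁ ++ γ.occ q :: r ∈ γ.refWords 0) p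

theorem cont_zero {r : List (RefSym A)} : γ.Cont 0 r ↔ r ∈ γ.refWords 0 := Iff.rfl

theorem cont_succ {q : Fin γ.numOcc} {r : List (RefSym A)} :
    γ.Cont q.succ r ↔ ∃ r₁, r₁ ++ γ.occ q :: r ∈ γ.refWords 0 := Iff.rfl

theorem trans_iff {p : Fin (γ.numOcc + 1)} {I : Var → MemInstr} {q : Fin γ.numOcc} :
    γ.Trans (γ.state p) I (γ.occ q) ↔
      ∃ g r, (∀ s ∈ g, s.IsBracket) ∧ I = instr g ∧ γ.Cont p (g ++ γ.occ q :: r) := by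
  unfold Trans
  refine Fin.cases ?_ (fun p => ?_) p
  · simp only [not_isBracket_occ, not_false_eq_true, true_and, cont_zero]
    exact ⟨fun ⟨g, h1, h2, r, h⟩ => ⟨g, r, h1, h2, h⟩, fun ⟨g, r, h1, h2, h⟩ => ⟨g, h1, h2, r, h⟩⟩
  · simp only [not_isBracket_occ, not_false_eq_true, true_and, cont_succ, state, Fin.cases_succ]
    exact ⟨fun ⟨g, h1, h2, r₁, r, h⟩ => ⟨g, r, h1, h2, r₁, h⟩,
      fun ⟨g, r, h1, h2, r₁, h⟩ => ⟨g, h1, h2, r₁, r, h⟩⟩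

variable {γ}

theorem Cont.tail {p : Fin (γ.numOcc + 1)} {g r : List (RefSym A)} {q : Fin γ.numOcc}
    (h : γ.Cont p (g ++ γ.occ q :: r)) : γ.Cont q.succ r := by
  revert h
  refine Fin.cases (fun h => ⟨g, h⟩) (fun p h => ?_) p
  obtain ⟨r₁, h⟩ := h
  exact ⟨r₁ ++ γ.occ p :: g, by simpa using h⟩

theorem Cont.splice {p : Fin (γ.numOcc + 1)} {g r r' : List (RefSym A)} {q : Fin γ.numOcc}
    (h : γ.Cont p (g ++ γ.occ q :: r)) (h' : γ.Cont q.succ r') : γ.Cont p (g ++ γ.occ q :: r') := by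
  obtain ⟨r₂, h'⟩ := h'
  revert h
  refine Fin.cases (fun h => ?_) (fun p h => ?_) p
  · exact Regex.splice (γ.not_isBracket_occ q) h h'
  · obtain ⟨r₁, h⟩ := h
    refine ⟨r₁, ?_⟩
    have := Regex.splice (r₁ := r₁ ++ γ.occ p :: g) (γ.not_isBracket_occ q) (by simpa using h) h'
    simpa using this

theorem Cont.exists_occ {p : Fin (γ.numOcc + 1)} {r : List (RefSym A)} (h : γ.Cont p r)
    {s : RefSym A} (hs : s ∈ r) (hb : ¬ s.IsBracket) : ∃ q, s = γ.occ q := by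
  revert h
  refine Fin.cases (fun h => Regex.exists_occ h hs hb) (fun p h => ?_) p
  obtain ⟨r₁, h⟩ := h
  exact Regex.exists_occ h (by simp [hs]) hb

variable (γ)

/-- The transition relation of the memory automaton. -/
def Tr (p : Fin (γ.numOcc + 1)) (q : Fin γ.numOcc) : Prop :=
  ∃ I, γ.Trans (γ.state p) I (γ.occ q)

open Classical in
/-- The memory instructions of the transition from `p` to `q`. -/
noncomputable def trIns (p : Fin (γ.numOcc + 1)) (q : Fin γ.numOcc) (i : Fin γ.numMem) :
    MemInstr :=
  if h : γ.Tr p q then h.choose (γ.mem i) else MemInstr.keep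

open Classical in
/-- Whether a memory is open in the state `p`. -/
noncomputable def isOpen (p : Fin (γ.numOcc + 1)) (x : Var) : Bool :=
  Fin.cases false
    (fun q => decide (∃ r₁ r₂, r₁ ++ γ.occ q :: r₂ ∈ γ.refWords 0 ∧ flag x false r₁ = true)) p

variable {γ}

theorem isOpen_succ (hγ : γ.WF) {q : Fin γ.numOcc} {r₁ r₂ : List (RefSym A)}
    (h : r₁ ++ γ.occ q :: r₂ ∈ γ.refWords 0) (x : Var) :
    γ.isOpen q.succ x = flag x false r₁ := by
  classical
  rw [isOpen, Fin.cases_succ, Bool.eq_iff_iff, decide_eq_true_iff]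
  constructor
  · rintro ⟨r₁', r₂', h', hf⟩
    rw [← hf]
    exact flag_unique hγ x (γ.not_isBracket_occ q) h h'
  · exact fun hf => ⟨r₁, r₂, h, hf⟩

/-- Different bracket words may stand between the same two occurrences. They amount to the same
instructions, since determinism would otherwise require the single occurrence `q` to read two
different letters. -/
theorem trIns_eq (hγ : γ.IsDRX) {p : Fin (γ.numOcc + 1)} {q : Fin γ.numOcc}
    {g r : List (RefSym A)} (hg : ∀ s ∈ g, s.IsBracket) (h : γ.Cont p (g ++ γ.occ q :: r))
    (i : Fin γ.numMem) : γ.trIns p q i = instr g (γ.mem i) := by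
  have ht : γ.Trans (γ.state p) (instr g) (γ.occ q) := γ.trans_iff.2 ⟨g, r, hg, rfl, h⟩
  have hT : γ.Tr p q := ⟨_, ht⟩
  rw [trIns, dif_pos hT]
  rcases hγ.2 _ _ _ _ _ hT.choose_spec ht with h | ⟨j, a, j', b, h1, h2, hab⟩
  · rw [h.1]
  · rw [h1] at h2
    simp only [RefSym.char.injEq] at h2
    exact (hab h2.2).elim

theorem Tr.exists_cont {p : Fin (γ.numOcc + 1)} {q : Fin γ.numOcc} (h : γ.Tr p q) :
    ∃ g r, (∀ s ∈ g, s.IsBracket) ∧ γ.Cont p (g ++ γ.occ q :: r) := by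
  obtain ⟨I, h⟩ := h
  obtain ⟨g, r, hg, -, h⟩ := γ.trans_iff.1 h
  exact ⟨g, r, hg, h⟩

theorem Cont.tr {p : Fin (γ.numOcc + 1)} {q : Fin γ.numOcc} {g r : List (RefSym A)}
    (hg : ∀ s ∈ g, s.IsBracket) (h : γ.Cont p (g ++ γ.occ q :: r)) : γ.Tr p q :=
  ⟨_, γ.trans_iff.2 ⟨g, r, hg, rfl, h⟩⟩

theorem isOpen_trans (hγ : γ.IsDRX) {p : Fin (γ.numOcc + 1)} {q : Fin γ.numOcc}
    {g r : List (RefSym A)} (hg : ∀ s ∈ g, s.IsBracket) (h : γ.Cont p (g ++ γ.occ q :: r))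
    (x : Var) : γ.isOpen q.succ x = (instr g x).status (γ.isOpen p x) := by
  rw [← flag_brackets g hg]
  revert h
  refine Fin.cases (fun h => ?_) (fun p h => ?_) p
  · exact isOpen_succ hγ.1 h x
  · obtain ⟨r₁, h⟩ := h
    have h' : (r₁ ++ γ.occ p :: g) ++ γ.occ q :: r ∈ γ.refWords 0 := by simpa using h
    rw [isOpen_succ hγ.1 h' x, isOpen_succ hγ.1 h x, flag_append, flag_cons,
      flagStep_of_not_isBracket (γ.not_isBracket_occ p)]

/-- Each prefix of a ref-word that ends in an occurrence traces a path. Reachability gives meaning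
to the distance from the initial state, on which the rule count relies. -/
theorem exists_memPath (r₁ r₂ : List (RefSym A)) (q : Fin γ.numOcc)
    (h : r₁ ++ γ.occ q :: r₂ ∈ γ.refWords 0) : ∃ l, MemPath γ.Tr l q.succ := by
  induction hl : r₁.length using Nat.strong_induction_on generalizing r₁ r₂ q with
  | _ l ih =>
    rcases exists_append_brackets r₁ with hb | ⟨r', s, g, hg, hs, rfl⟩
    · exact ⟨1, MemPath.succ MemPath.zero (Cont.tr (p := 0) hb h)⟩
    · obtain ⟨p, rfl⟩ := Regex.exists_occ h (s := s) (by simp) hs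
      have h' : r' ++ γ.occ p :: (g ++ γ.occ q :: r₂) ∈ γ.refWords 0 := by simpa using h
      obtain ⟨l', hp⟩ := ih r'.length (by rw [← hl]; simp) r' _ p h' rfl
      exact ⟨_, MemPath.succ hp (Cont.tr hg ⟨r', h'⟩)⟩

/-- The memory automaton of a deterministic regex. -/
noncomputable def memAut (γ : Regex A) (hγ : γ.IsDRX) : MemAut A γ.numOcc γ.numMem where
  lab := γ.lab
  tr := γ.Tr
  ins := γ.trIns
  op p i := γ.isOpen p (γ.mem i)
  fin p := ∃ g, (∀ s ∈ g, s.IsBracket) ∧ γ.Cont p g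
  det := by
    rintro p q₁ q₂ ⟨I₁, h₁⟩ ⟨I₂, h₂⟩
    rcases hγ.2 _ _ _ _ _ h₁ h₂ with h | ⟨j, a, j', b, h₁, h₂, hab⟩
    · exact Or.inl (γ.occ_injective h.2)
    · refine Or.inr ⟨a, b, ?_, ?_, hab⟩
      · revert h₁
        rw [occ]
        cases γ.lab q₁ <;> simp [mk]
      · revert h₂
        rw [occ]
        cases γ.lab q₂ <;> simp [mk]
  op_succ := by
    intro p q h i
    obtain ⟨g, r, hg, hc⟩ := h.exists_cont
    rw [isOpen_trans hγ hg hc, trIns_eq hγ hg hc]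
  reach := by
    intro p q h
    obtain ⟨g, r, hg, hc⟩ := h.exists_cont
    revert hc
    refine Fin.cases (fun _ => ⟨0, MemPath.zero⟩) (fun p hc => ?_) p
    obtain ⟨r₁, hc⟩ := hc
    exact exists_memPath _ _ p hc

theorem mem_after_brackets (hγ : γ.IsDRX) {p : Fin (γ.numOcc + 1)} {q : Fin γ.numOcc}
    {g r : List (RefSym A)} (hg : ∀ s ∈ g, s.IsBracket) (hc : γ.Cont p (g ++ γ.occ q :: r))
    {m : Mem A} {μ : Fin γ.numMem → List A}
    (hm : ∀ i, m (γ.mem i) = (μ i, (γ.memAut hγ).op p i)) (i : Fin γ.numMem) :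
    g.foldl memStep m (γ.mem i) =
      ((γ.memAut hγ).exec p q μ i, (γ.memAut hγ).op q.succ i) := by
  rw [foldl_memStep g hg, hm, MemAut.exec, (γ.memAut hγ).op_succ (Cont.tr hg hc)]
  simp only [memAut, trIns_eq hγ hg hc]

theorem record_mem (hγ : γ.IsDRX) {p : Fin (γ.numOcc + 1)} {m : Mem A}
    {μ : Fin γ.numMem → List A} (hm : ∀ i, m (γ.mem i) = (μ i, (γ.memAut hγ).op p i))
    (v : List A) (i : Fin γ.numMem) :
    record v m (γ.mem i) = ((γ.memAut hγ).app p v μ i, (γ.memAut hγ).op p i) := by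
  simp only [record, hm, MemAut.app]
  split_ifs with h <;> simp [h]

/-- The ref-word is assembled from the end of the run: by `Cont.splice`, the brackets of a
transition can be put in front of any continuation of its target. The configuration `m` is fixed
only on the memories of the regex. -/
theorem exists_cont_of_run (hγ : γ.IsDRX) {p : Fin (γ.numOcc + 1)} {μ : Fin γ.numMem → List A}
    {s : List A} (h : (γ.memAut hγ).Run p μ s) (m : Mem A)
    (hm : ∀ i, m (γ.mem i) = (μ i, (γ.memAut hγ).op p i)) : ∃ r, γ.Cont p r ∧ deref r m = s := by
  induction h generalizing m with
  | @halt p μ h =>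
    obtain ⟨g, hg, hc⟩ := h
    refine ⟨g, hc, ?_⟩
    have := deref_brackets g [] hg m
    simpa [deref] using this
  | @char p μ q a s h hq hr ih =>
    obtain ⟨g, r', hg, hc⟩ := Tr.exists_cont h
    obtain ⟨r, hr, hd⟩ := ih _ (record_mem hγ (mem_after_brackets hγ hg hc hm) [a])
    refine ⟨_, hc.splice hr, ?_⟩
    have hl : γ.lab q = Sum.inl a := hq
    rw [deref_brackets _ _ hg, occ, hl]
    simp only [Sum.map_inl, id_eq, mk, Sum.elim_inl, deref, hd]
  | @ref p μ q x s h hq hr ih =>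
    obtain ⟨g, r', hg, hc⟩ := Tr.exists_cont h
    have hm' := mem_after_brackets hγ hg hc hm
    obtain ⟨r, hr, hd⟩ := ih _ (record_mem hγ hm' _)
    refine ⟨_, hc.splice hr, ?_⟩
    have hl : γ.lab q = Sum.inr x := hq
    rw [deref_brackets _ _ hg, occ, hl]
    simp only [Sum.map_inr, mk, Sum.elim_inr, deref, hm', hd]

/-- Each block of brackets together with the occurrence after it is one transition; brackets at the
end mean that the state is final. -/
theorem run_of_cont (hγ : γ.IsDRX) {p : Fin (γ.numOcc + 1)} {μ : Fin γ.numMem → List A}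
    {r : List (RefSym A)} (hc : γ.Cont p r) (m : Mem A)
    (hm : ∀ i, m (γ.mem i) = (μ i, (γ.memAut hγ).op p i)) :
    (γ.memAut hγ).Run p μ (deref r m) := by
  induction hl : r.length using Nat.strong_induction_on generalizing r p μ m with
  | _ l ih =>
    rcases exists_brackets_append r with hg | ⟨g, s, r', hg, hs, rfl⟩
    · have h := deref_brackets r [] hg m
      rw [List.append_nil] at h
      rw [h]
      exact MemAut.Run.halt ⟨r, hg, hc⟩
    · obtain ⟨q, rfl⟩ := hc.exists_occ (s := s) (by simp) hs
      have hm' := mem_after_brackets hγ hg hc hm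
      have hlt : r'.length < l := by rw [← hl]; simp; omega
      rw [deref_brackets _ _ hg, occ]
      rcases hq : γ.lab q with a | x
      · simp only [Sum.map_inl, id_eq, mk, Sum.elim_inl, deref]
        exact MemAut.Run.char (Cont.tr hg hc) hq
          (ih _ hlt hc.tail _ (record_mem hγ hm' [a]) rfl)
      · simp only [Sum.map_inr, mk, Sum.elim_inr, deref, hm']
        exact MemAut.Run.ref (Cont.tr hg hc) hq
          (ih _ hlt hc.tail _ (record_mem hγ hm' _) rfl)

theorem language_memAut (hγ : γ.IsDRX) : (γ.memAut hγ).language = γ.language := by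
  ext w
  constructor
  · intro h
    exact exists_cont_of_run hγ h _ fun i => rfl
  · rintro ⟨r, hr, rfl⟩
    exact run_of_cont hγ (p := 0) hr _ fun i => rfl

end Regex

/-! ## Rules over named variables -/

/-- Names for the variables of the programs that simulate memory automata. -/
inductive PVar (k : ℕ) where
  | u | s | e | t | m | j | s' | t' | z
  | x (i : Fin k)
  | y (i : Fin k)

namespace PVar

variable {k : ℕ}

/-- A numbering of the names. -/
def code : PVar k → ℕ
  | u => 0
  | s => 1
  | e => 2
  | t => 3
  | m => 4
  | j => 5
  | s' => 6
  | t' => 7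
  | z => 8
  | x i => 9 + 2 * i
  | y i => 10 + 2 * i

theorem code_injective : Function.Injective (code (k := k)) := by
  intro v v' h
  cases v <;> cases v' <;> simp only [code] at h <;> first | rfl | omega | skip
  · exact congrArg x (Fin.ext (by omega))
  · exact congrArg y (Fin.ext (by omega))

/-- The variable with a given name. -/
def vr (v : PVar k) : ℕ := 2 * v.code

/-- The companion of the variable with a given name. -/
def gv (v : PVar k) : ℕ := 2 * v.code + 1

theorem vr_injective : Function.Injective (vr (k := k)) := fun v v' h =>
  code_injective (by simp only [vr] at h; omega)

theorem gv_injective : Function.Injective (gv (k := k)) := fun v v' h =>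
  code_injective (by simp only [gv] at h; omega)

@[simp] theorem vr_inj {v v' : PVar k} : v.vr = v'.vr ↔ v = v' := vr_injective.eq_iff

@[simp] theorem gv_ne_vr (v v' : PVar k) : v.gv ≠ v'.vr := by
  simp only [vr, gv]; omega

@[simp] theorem vr_ne_gv (v v' : PVar k) : v.vr ≠ v'.gv := (gv_ne_vr _ _).symm

open Classical in
/-- The substitution that is given on the named variables by `f`, and on their companions by applying
`g` to the value of the variable. -/
noncomputable def asg {A : Type*} (f : PVar k → List A) (g : List A → List A) (n : Var) : List A :=
  if h : ∃ v : PVar k, v.vr = n then f h.choose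
  else if h : ∃ v : PVar k, v.gv = n then g (f h.choose) else []

variable {A : Type*} (f : PVar k → List A) (g : List A → List A)

@[simp] theorem asg_vr (v : PVar k) : asg f g v.vr = f v := by
  have h : ∃ v' : PVar k, v'.vr = v.vr := ⟨v, rfl⟩
  rw [asg, dif_pos h, vr_injective h.choose_spec]

@[simp] theorem asg_gv (v : PVar k) : asg f g v.gv = g (f v) := by
  have h : ∃ v' : PVar k, v'.gv = v.gv := ⟨v, rfl⟩
  rw [asg, dif_neg (by simp), dif_pos h, gv_injective h.choose_spec]

theorem asg_infix {w : List A} (hf : ∀ v, f v <:+: w) (hg : ∀ v, v <:+: w → g v <:+: w) (n : Var) :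
    asg f g n <:+: w := by
  rw [asg]
  split_ifs
  · exact hf _
  · exact hg _ (hf _)
  · exact List.nil_infix

end PVar

/-- A rule over named variables: its head `sym (hd)`, its pattern equations `eqs`, the atoms `aux`
that are not mutually recursive with the head, and the atom `tgt` that is. -/
structure PRule (A S : Type*) (k : ℕ) where
  sym : S
  hd : List (PVar k)
  eqs : List (PVar k × List (A ⊕ PVar k))
  aux : List (S × List Var)
  tgt : Option (S × List (PVar k))

namespace PRule

variable {A S : Type*} {k : ℕ}

open PVar

/-- The pattern equation over named variables as an atom. -/
def eqAtom (E : PVar k × List (A ⊕ PVar k)) : Atom A S :=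
  Atom.eqn E.1.vr (E.2.map (Sum.map id vr))

/-- The rule as a rule of FC-Datalog. -/
def rule (D : PRule A S k) : Rule A S where
  headSym := D.sym
  headArgs := D.hd.map vr
  body := D.eqs.map eqAtom ++ (D.aux.map fun c => Atom.rel c.1 c.2) ++
    (D.tgt.toList.map fun c => Atom.rel c.1 (c.2.map vr))

/-- The variables of the recursive atom. -/
def bot (D : PRule A S k) : List (PVar k) := D.tgt.elim [] Prod.snd

/-- The pattern equation `v ≐ ε`. -/
def emptyEq (v : PVar k) : PVar k × List (A ⊕ PVar k) := (v, [])

/-- The pattern equation `v ≐ a v'`. -/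
def popEq (v : PVar k) (a : A) (v' : PVar k) : PVar k × List (A ⊕ PVar k) :=
  (v, [Sum.inl a, Sum.inr v'])

/-- The pattern equation `v' ≐ v a`. -/
def pushEq (v' : PVar k) (v : PVar k) (a : A) : PVar k × List (A ⊕ PVar k) :=
  (v', [Sum.inr v, Sum.inl a])

/-- The pattern equation `𝔲 ≐ z a v`, where `a` is a letter or empty. -/
def peekEq (a : Option A) (v : PVar k) : PVar k × List (A ⊕ PVar k) :=
  (u, [Sum.inr z] ++ (a.map Sum.inl).toList ++ [Sum.inr v])

variable (D : PRule A S k)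

theorem eqn_mem_rule {v : Var} {α : Pattern A} :
    Atom.eqn v α ∈ D.rule.body ↔ ∃ E ∈ D.eqs, E.1.vr = v ∧ E.2.map (Sum.map id vr) = α := by
  simp [rule, eqAtom]

theorem rel_mem_rule {R : S} {ys : List Var} :
    Atom.rel R ys ∈ D.rule.body ↔
      (R, ys) ∈ D.aux ∨ ∃ c ∈ D.tgt, c.1 = R ∧ c.2.map vr = ys := by
  simp [rule, eqAtom]

theorem mem_bot {v : PVar k} : v ∈ D.bot ↔ ∃ c ∈ D.tgt, v ∈ c.2 := by
  rcases h : D.tgt with _ | c <;> simp [bot, h]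

/-- The condition that a substitution has to fulfil for an equation. -/
def Holds (f : PVar k → List A) (E : PVar k × List (A ⊕ PVar k)) : Prop :=
  f E.1 = E.2.flatMap (Sum.elim (fun a => [a]) f)

@[simp] theorem holds_emptyEq (f : PVar k → List A) (v : PVar k) :
    Holds f (emptyEq v) ↔ f v = [] := by
  simp [Holds, emptyEq]

@[simp] theorem holds_popEq (f : PVar k → List A) (v v' : PVar k) (a : A) :
    Holds f (popEq v a v') ↔ f v = a :: f v' := by
  simp [Holds, popEq]

@[simp] theorem holds_pushEq (f : PVar k → List A) (v v' : PVar k) (a : A) :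
    Holds f (pushEq v' v a) ↔ f v' = f v ++ [a] := by
  simp [Holds, pushEq]

@[simp] theorem holds_peekEq_none (f : PVar k → List A) (v : PVar k) :
    Holds f (peekEq none v) ↔ f u = f z ++ f v := by
  simp [Holds, peekEq]

@[simp] theorem holds_peekEq_some (f : PVar k → List A) (v : PVar k) (a : A) :
    Holds f (peekEq (some a) v) ↔ f u = f z ++ a :: f v := by
  simp [Holds, peekEq]

theorem satEqns_rule {θ : Var → List A} :
    D.rule.SatEqns θ ↔ ∀ E ∈ D.eqs, Holds (fun v => θ v.vr) E := by
  have key : ∀ α : List (A ⊕ PVar k), Pattern.subst θ (α.map (Sum.map id vr)) =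
      α.flatMap (Sum.elim (fun a => [a]) fun v => θ v.vr) := by
    intro α
    rw [Pattern.subst, List.flatMap_map]
    congr 1
    funext c
    cases c <;> rfl
  constructor
  · intro h E hE
    have := h _ _ (D.eqn_mem_rule.2 ⟨E, hE, rfl, rfl⟩)
    rwa [key] at this
  · rintro h v α hv
    obtain ⟨E, hE, rfl, rfl⟩ := D.eqn_mem_rule.1 hv
    rw [key]
    exact h E hE

/-- The equations of a rule that moves along the input: `v ≐ ε` for top variables, `v ≐ a v'` and
`v' ≐ v a`. -/
def IsMoveEq (E : PVar k × List (A ⊕ PVar k)) : Prop :=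
  (∃ v, (v = u ∨ v ∈ D.hd) ∧ E = emptyEq v) ∨
  (∃ v v' a, (v = s ∨ v = t) ∧ (v' = s' ∨ v' = t') ∧ v ∈ D.hd ∧ v' ∈ D.bot ∧ E = popEq v a v') ∨
  (∃ i v a, (v = e ∨ ∃ i, v = x i) ∧ v ∈ D.hd ∧ y i ∈ D.bot ∧ E = pushEq (y i) v a)

/-- The equations of a rule that checks the end of the input. -/
def IsPeekEq (E : PVar k × List (A ⊕ PVar k)) : Prop :=
  (∃ v, (v = u ∨ v ∈ D.hd) ∧ E = emptyEq v) ∨ ∃ a v, v ∈ D.hd ∧ E = peekEq a v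

/-- The syntactic condition on the pattern equations. -/
def IsGood : Prop :=
  (∀ E ∈ D.eqs, D.IsMoveEq E) ∨
    ((∀ E ∈ D.eqs, D.IsPeekEq E) ∧ D.tgt = none ∧ z ∉ D.hd ∧ D.rule.vars.count (vr (z : PVar k)) = 1)

section Program

variable (P : Program A S) (hu : P.univ = vr (u : PVar k))
  (haux : ∀ c ∈ D.aux, ¬ P.MutRec D.sym c.1) (htgt : ∀ c ∈ D.tgt, P.MutRec D.sym c.1)

include haux htgt

theorem recAtoms_rule : P.recAtoms D.rule = D.tgt.toList.map fun c => (c.1, c.2.map vr) := by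
  -- The filter in `recAtoms` is abstracted to `F`, so that only its values on the three sorts of
  -- atoms matter.
  have key : ∀ F : Atom A S → Option (S × List Var), (∀ v α, F (Atom.eqn v α) = none) →
      (∀ R ys, ¬ P.MutRec D.sym R → F (Atom.rel R ys) = none) →
      (∀ R ys, P.MutRec D.sym R → F (Atom.rel R ys) = some (R, ys)) →
      D.rule.body.filterMap F = D.tgt.toList.map fun c => (c.1, c.2.map vr) := by
    intro F h1 h2 h3
    have e1 : (D.eqs.map eqAtom).filterMap F = [] := by
      simp [List.filterMap_eq_nil_iff, eqAtom, h1]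
    have e2 : (D.aux.map fun c => Atom.rel c.1 c.2).filterMap F = [] := by
      simp only [List.filterMap_eq_nil_iff, List.mem_map]
      rintro _ ⟨c, hc, rfl⟩
      exact h2 _ _ (haux c hc)
    rw [rule, List.filterMap_append, List.filterMap_append, e1, e2]
    rcases h : D.tgt with _ | c
    · rfl
    · simp [h3 _ _ (htgt c h)]
  exact key _ (fun _ _ => rfl) (fun R ys h => if_neg h) (fun R ys h => if_pos h)

theorem bottom_rule : P.bottom D.rule = D.bot.map vr := by
  rw [Program.bottom, D.recAtoms_rule P haux htgt, bot]
  rcases D.tgt with _ | c <;> simp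

omit haux htgt in
include hu in
theorem top_rule : P.top D.rule = (D.hd ++ [u]).map vr := by
  rw [Program.top, hu]; simp [rule]

include hu

omit haux htgt in
theorem vr_mem_top {v : PVar k} : vr v ∈ P.top D.rule ↔ v = u ∨ v ∈ D.hd := by
  rw [D.top_rule P hu]; simp [or_comm]

omit hu in
theorem vr_mem_bottom {v : PVar k} : vr v ∈ P.bottom D.rule ↔ v ∈ D.bot := by
  rw [D.bottom_rule P haux htgt]; simp

theorem isOLLARule (hD : D.IsGood) : P.IsOLLARule D.rule := by
  intro v α h
  obtain ⟨E, hE, rfl, rfl⟩ := D.eqn_mem_rule.1 h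
  have htop := fun v => D.vr_mem_top P hu (v := v)
  have hbot := fun v => D.vr_mem_bottom P haux htgt (v := v)
  rcases hD with hD | ⟨hD, hn, hz, hc⟩
  · rcases hD E hE with ⟨v, hv, rfl⟩ | ⟨v, v', a, -, -, hv, hv', rfl⟩ | ⟨i, v, a, -, hv, hv', rfl⟩
    · exact Or.inl ⟨(htop _).2 hv, Or.inl rfl⟩
    · exact Or.inr ⟨some a, Or.inr (Or.inl ⟨v'.vr, (hbot _).2 hv', (htop _).2 (Or.inr hv), rfl⟩)⟩
    · exact Or.inr ⟨some a, Or.inl (Or.inr (Or.inl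
        ⟨v.vr, (htop _).2 (Or.inr hv), (hbot _).2 hv', rfl⟩))⟩
  · rcases hD E hE with ⟨v, hv, rfl⟩ | ⟨a, v, hv, rfl⟩
    · exact Or.inl ⟨(htop _).2 hv, Or.inl rfl⟩
    · refine Or.inr ⟨a, Or.inr (Or.inr (Or.inr ⟨v.vr, (htop _).2 (Or.inr hv), vr (z : PVar k),
        hu.symm, ⟨?_, ?_, hc⟩, ?_⟩))⟩
      · rw [htop]; simp [hz]
      · rw [hbot, mem_bot]; simp [hn]
      · cases a <;> simp [peekEq, Program.pvar, Program.letter]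

-- In a moving rule, left forms involve only `s`, `t`, `s'`, `t'`, and right forms only `e`, `x i`,
-- `y i`. A peeking rule has no right form with a letter: this would need `z` to be a top variable.
omit haux htgt in
theorem not_usedLeft_and_usedRight (hD : D.IsGood) (v : Var) :
    ¬ (P.UsedLeft D.rule v ∧ P.UsedRight D.rule v) := by
  have htop := fun v => D.vr_mem_top P hu (v := v)
  rintro ⟨⟨v₁, α₁, h₁, ⟨a₁, hl⟩, hv₁⟩, ⟨v₂, α₂, h₂, ⟨a₂, hr⟩, hv₂⟩⟩
  obtain ⟨E₁, hE₁, rfl, rfl⟩ := D.eqn_mem_rule.1 h₁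
  obtain ⟨E₂, hE₂, rfl, rfl⟩ := D.eqn_mem_rule.1 h₂
  rcases hD with hD | ⟨hD, hn, hz, hc⟩
  · have key : (∃ v' v'' a, (v' = s ∨ v' = t) ∧ (v'' = s' ∨ v'' = t') ∧ E₁ = popEq v' a v'') := by
      rcases hD E₁ hE₁ with ⟨v', -, rfl⟩ | ⟨v', v'', a, h1, h2, -, -, rfl⟩ | ⟨i, v', a, -, -, -, rfl⟩
      · simp [Program.IsLeftForm, emptyEq, Program.letter, Program.pvar] at hl
      · exact ⟨v', v'', a, h1, h2, rfl⟩
      · simp [Program.IsLeftForm, pushEq, Program.letter, Program.pvar] at hl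
    have key' : (∃ i v' a, (v' = e ∨ ∃ i, v' = x i) ∧ E₂ = pushEq (y i) v' a) := by
      rcases hD E₂ hE₂ with ⟨v', -, rfl⟩ | ⟨v', v'', a, -, -, -, -, rfl⟩ | ⟨i, v', a, h1, -, -, rfl⟩
      · simp [Program.IsRightForm, emptyEq, Program.letter, Program.pvar] at hr
      · simp [Program.IsRightForm, popEq, Program.letter, Program.pvar] at hr
      · exact ⟨i, v', a, h1, rfl⟩
    obtain ⟨b, b', a, hb, hb', rfl⟩ := key
    obtain ⟨i, c, a', hc, rfl⟩ := key'
    simp only [popEq, pushEq, Atom.vars, List.map_cons, List.map_nil, Sum.map_inl, Sum.map_inr,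
      List.mem_cons, List.filterMap_cons, Sum.getRight?_inl, Sum.getRight?_inr,
      List.filterMap_nil, List.not_mem_nil, or_false] at hv₁ hv₂
    rcases hb with rfl | rfl <;> rcases hb' with rfl | rfl <;> rcases hc with rfl | ⟨i', rfl⟩ <;>
      rcases hv₁ with rfl | rfl <;> simp at hv₂
  · rcases hD E₂ hE₂ with ⟨v', -, rfl⟩ | ⟨a, v', -, rfl⟩
    · simp [Program.IsRightForm, emptyEq, Program.letter, Program.pvar] at hr
    · cases a with
      | none => simp [Program.IsRightForm, peekEq, Program.letter, Program.pvar] at hr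
      | some a =>
        simp only [Program.IsRightForm, peekEq, Program.letter, Program.pvar] at hr
        simp at hr
        have h := hr.1
        rw [htop] at h
        simp [hz] at h

theorem topBottom_rule {w : List A} {tt b : List (List A)} (h : P.TopBottom w D.rule tt b) :
    ∃ θ : Var → List A, P.IsSubst w D.rule θ ∧ (∀ E ∈ D.eqs, Holds (fun v => θ v.vr) E) ∧
      tt = (D.hd.map fun v => θ v.vr) ++ [w] ∧ b = D.bot.map fun v => θ v.vr := by
  obtain ⟨θ, hθ, heq, rfl, rfl⟩ := h
  refine ⟨θ, hθ, D.satEqns_rule.1 heq, ?_, ?_⟩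
  · rw [D.top_rule P hu]
    have := hθ.1
    rw [hu] at this
    simp [this]
  · rw [D.bottom_rule P haux htgt]
    simp

/-- The bottom tuple is determined by the top tuple. -/
theorem bot_unique (hdet : ∀ v ∈ D.bot, v = u ∨ v ∈ D.hd ∨ (∃ v' ∈ D.hd, ∃ a, popEq v' a v ∈ D.eqs) ∨
      ∃ v' ∈ D.hd, ∃ a, pushEq v v' a ∈ D.eqs)
    {w : List A} {tt b b' : List (List A)} (h : P.TopBottom w D.rule tt b)
    (h' : P.TopBottom w D.rule tt b') : b = b' := by
  obtain ⟨θ, hθ, heq, rfl, rfl⟩ := D.topBottom_rule P hu haux htgt h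
  obtain ⟨θ', hθ', heq', ht, rfl⟩ := D.topBottom_rule P hu haux htgt h'
  have ht := List.map_inj_left.1 (List.append_cancel_right ht)
  refine List.map_congr_left fun v hv => ?_
  rcases hdet v hv with rfl | hv | ⟨v', hv', a, hE⟩ | ⟨v', hv', a, hE⟩
  · rw [← hu, hθ.1, hθ'.1]
  · exact ht v hv
  · have h1 := (holds_popEq _ _ _ _).1 (heq _ hE)
    have h2 := (holds_popEq _ _ _ _).1 (heq' _ hE)
    rw [ht v' hv', h2] at h1
    exact (List.cons.inj h1).2.symm
  · have h1 := (holds_pushEq _ _ _ _).1 (heq _ hE)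
    have h2 := (holds_pushEq _ _ _ _).1 (heq' _ hE)
    rw [h1, h2, ht v' hv']

theorem decreases {v v' : PVar k} {a : A} (hv : v ∈ D.hd) (hv' : v' ∈ D.bot)
    (hE : popEq v a v' ∈ D.eqs) : P.Decreases D.rule v.vr v'.vr := by
  refine ⟨(D.vr_mem_top P hu).2 (Or.inr hv), (D.vr_mem_bottom P haux htgt).2 hv',
    ⟨_, _, D.eqn_mem_rule.2 ⟨_, hE, rfl, rfl⟩, ?_, ?_⟩, ?_⟩
  · simp [popEq, Atom.vars]
  · simp [popEq, Atom.vars]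
  · intro w θ hm
    have := (holds_popEq _ _ _ _).1 (D.satEqns_rule.1 hm.2.1 _ hE)
    simp [this]

omit hu in
theorem isCritical_iff : P.IsCritical D.rule ↔ D.tgt ≠ none ∧ D.eqs ≠ [] := by
  rw [Program.IsCritical, D.recAtoms_rule P haux htgt]
  refine and_congr ?_ ?_
  · rcases D.tgt with _ | c <;> simp
  · constructor
    · rintro ⟨v, α, h⟩ h0
      obtain ⟨E, hE, -⟩ := D.eqn_mem_rule.1 h
      simp [h0] at hE
    · intro h
      obtain ⟨E, hE⟩ := List.exists_mem_of_ne_nil _ h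
      exact ⟨_, _, D.eqn_mem_rule.2 ⟨E, hE, rfl, rfl⟩⟩

end Program

end PRule

/-! ## The program of a memory automaton -/

/-- Indices of the rules of the program of a memory automaton. -/
inductive MemAut.Idx (A : Type*) (n k : ℕ) where
  | ans
  | wbase (i : Fin k)
  | wstep (i : Fin k) (a : A)
  | read (p : Fin (n + 1)) (q : Fin n) (a : A)
  | dead (p p' : Fin (n + 1))
  | loop (q : Fin n) (a : A)
  | accept (q : Fin n) (a : A)
  | drain (q : Fin n) (a : A)
  | check (q : Fin n) (a : A)
  | halt (p : Fin (n + 1))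
  | call (p : Fin (n + 1)) (q : Fin n)

namespace MemAut

variable {A : Type*} {n k : ℕ} (M : MemAut A n k)

open PVar PRule

/-- The relation symbols: `none` is the output symbol, there is one symbol for each state, and one
for each memory. -/
abbrev Sym (n k : ℕ) : Type := Option (Fin (n + 1) ⊕ Fin k)

/-- The relation symbol of a state. Its arguments are the rest `s` of the input, the empty word `e`,
the rest `t` of the current recall, a flag `m`, an auxiliary word `j`, and the memories. If the flag
is the whole input, then the automaton has been in a final state since it read the last letter. -/
abbrev symR (p : Fin (n + 1)) : Sym n k := some (Sum.inl p)

/-- A relation symbol that contains each factor of the input together with a suffix of the input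
that starts with this factor. -/
abbrev symW (i : Fin k) : Sym n k := some (Sum.inr i)

/-- The arguments of an atom for a state. -/
def args (s₀ t₀ m₀ j₀ : PVar k) (c : Fin k → PVar k) : List (PVar k) :=
  [s₀, e, t₀, m₀, j₀] ++ (List.finRange k).map c

/-- Atoms that hold for all factors of the input. -/
def guards (l : List (PVar k)) : List (Sym n k × List Var) :=
  l.flatMap fun v => (List.finRange k).map fun i => (symW i, [v.vr, v.gv])

/-- The state is an occurrence of a recall. -/
def IsRec (p : Fin (n + 1)) : Prop := ∃ q i, p = q.succ ∧ M.lab q = Sum.inr i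

/-- The transition that leaves the state is a recall. -/
def Calls (p : Fin (n + 1)) : Prop := ∃ q i, M.tr p q ∧ M.lab q = Sum.inr i

/-- The distance of a state from the initial state. -/
noncomputable def depth (p : Fin (n + 1)) : ℕ := sInf {l | MemPath M.tr l p}

/-- The state can be entered from a state that is at least as far from the initial state. -/
def Star (p : Fin (n + 1)) : Prop := ∃ q p', p = q.succ ∧ M.tr p' q ∧ M.depth p ≤ M.depth p'

/-- The letter occurs as a label. -/
def IsLetter (a : A) : Prop := ∃ q, M.lab q = Sum.inl a

/-- The occurrence is a recall that is the target of a transition. -/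
def Target (q : Fin n) : Prop := (∃ i, M.lab q = Sum.inr i) ∧ ∃ p, M.tr p q

/-- There are no recalls, and both the initial state and the last state are final. -/
def Hub : Prop := (∀ q, ∃ a, M.lab q = Sum.inl a) ∧ M.fin 0 ∧ M.fin (Fin.last n)

open Classical in
/-- The flag argument in the head of a rule. -/
noncomputable def mvar (p : Fin (n + 1)) : PVar k := if M.IsRec p then m else e

open Classical in
/-- The auxiliary argument in the head of a rule. -/
noncomputable def jvar (p : Fin (n + 1)) : PVar k := if M.IsRec p then j else e

open Classical in
/-- The flag argument in the head of a rule for a transition that recalls a memory. -/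
noncomputable def cvar (p : Fin (n + 1)) : PVar k := if M.IsRec p ∧ ¬ M.Star p then m else e

/-- The memories after the instructions of a transition. -/
def base (p : Fin (n + 1)) (q : Fin n) (i : Fin k) : PVar k := (M.ins p q i).eff e (x i)

/-- The memories after reading a letter. -/
def out (p : Fin (n + 1)) (b : Fin k → PVar k) (i : Fin k) : PVar k := if M.op p i then y i else b i

/-- The equations that append the letter `a` to the open memories. -/
def appEqs (p : Fin (n + 1)) (b : Fin k → PVar k) (a : A) : List (PVar k × List (A ⊕ PVar k)) :=
  ((List.finRange k).filter fun i => M.op p i).map fun i => pushEq (y i) (b i) a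

/-- The word that is recalled by a transition. -/
def recalled (p : Fin (n + 1)) (q : Fin n) : PVar k := Sum.elim (fun _ => e) (M.base p q) (M.lab q)

open Classical in
/-- The rules of the program. -/
noncomputable def data (a₀ : A) : Idx A n k → PRule A (Sym n k) k
  | .ans => ⟨none, [], [], [(symR 0, (args (k := k) u e e e fun _ => e).map vr)], none⟩
  -- For each factor of the input, some second argument makes the atom true. Hence `guards`
  -- restricts nothing; it only makes all head variables occur in the body.
  | .wbase i => ⟨symW i, [s, t], [emptyEq s, peekEq none t], [], none⟩
  | .wstep i a => ⟨symW i, [s, t], [popEq s a s', popEq t a t'], [], some (symW i, [s', t'])⟩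
  -- The third argument is `e`, so a pending recall must have been matched completely. Reading a
  -- letter clears the flag.
  | .read p q a =>
    ⟨symR p, args s e (M.mvar p) (M.jvar p) x,
      emptyEq e :: popEq s a s' :: M.appEqs q.succ (M.base p q) a,
      guards (args s e (M.mvar p) (M.jvar p) x),
      some (symR q.succ, args s' e e e (M.out q.succ (M.base p q)))⟩
  -- The equations make `s` empty and nonempty at once. The rule never fires and only creates the
  -- dependency of one state relation on another.
  | .dead p p' =>
    ⟨symR p, args s e (M.mvar p) (M.jvar p) x, [emptyEq e, emptyEq s, popEq s a₀ s'],
      guards (args s e (M.mvar p) (M.jvar p) x), some (symR p', args s' e e e x)⟩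
  | .loop q a =>
    ⟨symR q.succ, args s t m j x, emptyEq e :: popEq s a s' :: popEq t a t' :: M.appEqs q.succ x a,
      guards (args s t m j x), some (symR q.succ, args s' t' e e (M.out q.succ x))⟩
  -- The flag is raised and no input is left. The equation `𝔲 ≐ z a e` excludes the empty input,
  -- where a raised flag `𝔲` equals `e`.
  | .accept q a =>
    ⟨symR q.succ, args e t u j x, [emptyEq e, peekEq (some a) e], guards (args e t u j x), none⟩
  -- Emptying `t` makes the outgoing recall applicable, which then hands the flag on.
  | .drain q a =>
    ⟨symR q.succ, args e t u j x, [emptyEq e, popEq t a t'], guards (args e t u j x),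
      some (symR q.succ, args e t' u j x)⟩
  -- Unread input makes the flag void. As `s` has to be passed on intact, its shortened copy `s'`
  -- goes into the auxiliary argument, only to make the rule decrease something.
  | .check q a =>
    ⟨symR q.succ, args s e u j x, [emptyEq e, popEq s a s'], guards (args s e u j x),
      some (symR q.succ, args s e e s' x)⟩
  -- For a hub, the last state defers to the final state `0`, which closes the cycle of relations
  -- without a `dead` rule. The equation `𝔲 ≐ ε` is for non-final states at which the empty input
  -- ends up after a chain of recalls.
  | .halt p =>
    if M.Hub ∧ p = Fin.last n then
      ⟨symR p, args e e e (M.jvar p) x, [], guards (args e e e (M.jvar p) x),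
        some (symR 0, args e e e e x)⟩
    else
      ⟨symR p, args e e e (M.jvar p) x, emptyEq e :: if M.fin p then [] else [emptyEq u],
        guards (args e e e (M.jvar p) x), none⟩
  -- Without pattern equations the rule is not critical. It raises the flag if `p` is final and
  -- otherwise hands on its own; at a recall state in `Star`, the head demands a lowered flag.
  | .call p q =>
    ⟨symR p, args s e (M.cvar p) (M.jvar p) x, [], guards (args s e (M.cvar p) (M.jvar p) x),
      some (symR q.succ,
        args s (M.recalled p q) (if M.fin p then u else M.cvar p) e (M.base p q))⟩

/-- The conditions under which a rule belongs to the program. -/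
def Valid : Idx A n k → Prop
  | .ans => True
  | .wbase _ => True
  | .wstep _ _ => True
  | .read p q a => M.tr p q ∧ M.lab q = Sum.inl a
  | .dead p p' => (∃ q : Fin n, p = q.castSucc ∧ p' = q.succ ∧ ¬ M.tr p q) ∨
      (p = Fin.last n ∧ p' = 0 ∧ ¬ M.Hub)
  | .loop q a => M.Target q ∧ M.IsLetter a
  | .accept q a => M.Target q ∧ M.IsLetter a ∧ (M.Star q.succ ∨ ¬ M.Calls q.succ)
  | .drain q a => M.Target q ∧ M.IsLetter a ∧ ¬ M.Star q.succ ∧ M.Calls q.succ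
  | .check q a => M.Target q ∧ M.IsLetter a ∧ M.Star q.succ ∧ M.Calls q.succ
  | .halt p => ¬ M.Calls p ∧ (M.fin p ∨ (M.Calls 0 ∧ M.Run 0 (fun _ => []) []))
  | .call p q => M.tr p q ∧ ∃ i, M.lab q = Sum.inr i

-- Argument lists, guards, and uniqueness of transitions

section Basic

variable {M}

theorem mem_args {s₀ t₀ m₀ j₀ : PVar k} {c : Fin k → PVar k} {v : PVar k} :
    v ∈ args s₀ t₀ m₀ j₀ c ↔ v = s₀ ∨ v = e ∨ v = t₀ ∨ v = m₀ ∨ v = j₀ ∨ ∃ i, c i = v := by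
  simp [args]

theorem length_args {s₀ t₀ m₀ j₀ : PVar k} {c : Fin k → PVar k} :
    (args s₀ t₀ m₀ j₀ c).length = 5 + k := by
  simp [args]; omega

theorem mem_guards {l : List (PVar k)} {c : Sym n k × List Var} :
    c ∈ guards l ↔ ∃ v ∈ l, ∃ i, c = (symW i, [v.vr, v.gv]) := by
  simp [guards, eq_comm]

theorem mem_appEqs {p : Fin (n + 1)} {b : Fin k → PVar k} {a : A}
    {E : PVar k × List (A ⊕ PVar k)} :
    E ∈ M.appEqs p b a ↔ ∃ i, M.op p i = true ∧ E = pushEq (y i) (b i) a := by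
  simp [appEqs, @eq_comm _ E]

theorem base_eq (p : Fin (n + 1)) (q : Fin n) (i : Fin k) : M.base p q i = e ∨ M.base p q i = x i := by
  unfold base
  cases M.ins p q i <;> simp [MemInstr.eff]

theorem recalled_eq (p : Fin (n + 1)) (q : Fin n) :
    M.recalled p q = e ∨ ∃ i, M.recalled p q = x i := by
  unfold recalled
  rcases M.lab q with a | i
  · exact Or.inl rfl
  · rcases base_eq (M := M) p q i with h | h
    · exact Or.inl h
    · exact Or.inr ⟨i, h⟩

theorem Target.isRec {q : Fin n} (h : M.Target q) : M.IsRec q.succ := by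
  obtain ⟨⟨i, h⟩, -⟩ := h
  exact ⟨q, i, rfl, h⟩

theorem Target.ne_zero {q : Fin n} (h : M.Target q) : k ≠ 0 := by
  obtain ⟨⟨i, h⟩, -⟩ := h
  rintro rfl
  exact i.elim0

theorem IsRec.ne_zero {p : Fin (n + 1)} (h : M.IsRec p) : k ≠ 0 := by
  obtain ⟨q, i, -⟩ := h
  rintro rfl
  exact i.elim0

theorem Calls.not_read {p : Fin (n + 1)} (h : M.Calls p) {q : Fin n} {a : A} (hq : M.tr p q) :
    M.lab q ≠ Sum.inl a := by
  obtain ⟨q', i, h, h'⟩ := h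
  rcases M.det hq h with rfl | ⟨a, b, -, h2, -⟩
  · simp [h']
  · simp [h'] at h2

theorem Calls.unique {p : Fin (n + 1)} {q q' : Fin n} {i : Fin k} (hq : M.tr p q)
    (hi : M.lab q = Sum.inr i) (hq' : M.tr p q') : q = q' := by
  rcases M.det hq hq' with h | ⟨a, b, h2, -, -⟩
  · exact h
  · simp [hi] at h2

theorem read_unique {p : Fin (n + 1)} {q q' : Fin n} {a : A} (hq : M.tr p q)
    (hi : M.lab q = Sum.inl a) (hq' : M.tr p q') (hi' : M.lab q' = Sum.inl a) : q = q' := by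
  rcases M.det hq hq' with h | ⟨a, b, h1, h2, h3⟩
  · exact h
  · rw [hi] at h1
    rw [hi'] at h2
    exact (h3 ((Sum.inl.inj h1).symm.trans (Sum.inl.inj h2))).elim

theorem mvar_eq (p : Fin (n + 1)) : M.mvar p = e ∨ (M.IsRec p ∧ M.mvar p = m) := by
  unfold mvar; split_ifs with h <;> simp [h]

theorem jvar_eq (p : Fin (n + 1)) : M.jvar p = e ∨ (M.IsRec p ∧ M.jvar p = j) := by
  unfold jvar; split_ifs with h <;> simp [h]

end Basic

/-! ### The syntactic conditions -/

theorem isGood_data (a₀ : A) (i : Idx A n k) : (M.data a₀ i).IsGood := by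
  cases i with
  | ans => exact Or.inl (by simp [data])
  | wbase i =>
    refine Or.inr ⟨?_, rfl, by simp [data], ?_⟩
    · intro E hE
      simp only [data, List.mem_cons, List.not_mem_nil, or_false] at hE
      rcases hE with rfl | rfl
      · exact Or.inl ⟨s, by simp [data], rfl⟩
      · exact Or.inr ⟨none, t, by simp [data], rfl⟩
    · simp [data, Rule.vars, PRule.rule, eqAtom, Atom.vars, emptyEq, peekEq]
  | wstep i a =>
    refine Or.inl fun E hE => ?_
    simp only [data, List.mem_cons, List.not_mem_nil, or_false] at hE
    rcases hE with rfl | rfl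
    · exact Or.inr (Or.inl ⟨s, s', a, by simp [data, bot]⟩)
    · exact Or.inr (Or.inl ⟨t, t', a, by simp [data, bot]⟩)
  | read p q a =>
    refine Or.inl fun E hE => ?_
    simp only [data, List.mem_cons, mem_appEqs] at hE
    rcases hE with rfl | rfl | ⟨i, hi, rfl⟩
    · exact Or.inl ⟨e, by simp [data, mem_args], rfl⟩
    · exact Or.inr (Or.inl ⟨s, s', a, by simp [data, bot, mem_args]⟩)
    · refine Or.inr (Or.inr ⟨i, M.base p q i, a, ?_, ?_, ?_, rfl⟩)
      · rcases base_eq (M := M) p q i with h | h <;> simp [h]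
      · rcases base_eq (M := M) p q i with h | h <;> simp [h, data, mem_args]
      · simp only [data, bot, Option.elim_some, mem_args]
        exact Or.inr (Or.inr (Or.inr (Or.inr (Or.inr ⟨i, by simp [out, hi]⟩))))
  | dead p p' =>
    refine Or.inl fun E hE => ?_
    simp only [data, List.mem_cons, List.not_mem_nil, or_false] at hE
    rcases hE with rfl | rfl | rfl
    · exact Or.inl ⟨e, by simp [data, mem_args], rfl⟩
    · exact Or.inl ⟨s, by simp [data, mem_args], rfl⟩
    · exact Or.inr (Or.inl ⟨s, s', a₀, by simp [data, bot, mem_args]⟩)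
  | loop q a =>
    refine Or.inl fun E hE => ?_
    simp only [data, List.mem_cons, mem_appEqs] at hE
    rcases hE with rfl | rfl | rfl | ⟨i, hi, rfl⟩
    · exact Or.inl ⟨e, by simp [data, mem_args], rfl⟩
    · exact Or.inr (Or.inl ⟨s, s', a, by simp [data, bot, mem_args]⟩)
    · exact Or.inr (Or.inl ⟨t, t', a, by simp [data, bot, mem_args]⟩)
    · refine Or.inr (Or.inr ⟨i, x i, a, by simp, by simp [data, mem_args], ?_, rfl⟩)
      simp only [data, bot, Option.elim_some, mem_args]
      exact Or.inr (Or.inr (Or.inr (Or.inr (Or.inr ⟨i, by simp [out, hi]⟩))))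
  | accept q a =>
    refine Or.inr ⟨?_, rfl, by simp [data, mem_args], ?_⟩
    · intro E hE
      simp only [data, List.mem_cons, List.not_mem_nil, or_false] at hE
      rcases hE with rfl | rfl
      · exact Or.inl ⟨e, by simp [data, mem_args], rfl⟩
      · exact Or.inr ⟨some a, e, by simp [data, mem_args], rfl⟩
    · have h1 : ∀ l : List (PVar k), z ∉ l → List.count (z : PVar k).vr (l.map vr) = 0 := by
        intro l hl
        rw [List.count_eq_zero]
        simpa using hl
      -- Companion variables have odd numbers, so the guards could mention `z` only through `l`.
      have h2 : ∀ l : List (PVar k), z ∉ l → List.count (z : PVar k).vr (((guards (n := n) l).map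
          fun c => (Atom.rel c.1 c.2 : Atom A (Sym n k))).flatMap Atom.vars) = 0 := by
        intro l hl
        rw [List.count_eq_zero]
        simp only [List.mem_flatMap, List.mem_map, not_exists, not_and]
        rintro _ ⟨c, hc, rfl⟩
        obtain ⟨v, hv, i, rfl⟩ := mem_guards.1 hc
        simp only [Atom.vars, List.mem_cons, vr_inj, vr_ne_gv, List.not_mem_nil, or_self, or_false]
        rintro rfl
        exact hl hv
      have hz : (z : PVar k) ∉ args e t u j x := by simp [mem_args]
      simp only [data, Rule.vars, PRule.rule, List.map_cons, List.map_nil, Option.toList_none,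
        List.append_nil, List.flatMap_append, List.count_append, h1 _ hz, h2 _ hz]
      simp [eqAtom, Atom.vars, emptyEq, peekEq, List.filterMap_cons]
  | drain q a =>
    refine Or.inl fun E hE => ?_
    simp only [data, List.mem_cons, List.not_mem_nil, or_false] at hE
    rcases hE with rfl | rfl
    · exact Or.inl ⟨e, by simp [data, mem_args], rfl⟩
    · exact Or.inr (Or.inl ⟨t, t', a, by simp [data, bot, mem_args]⟩)
  | check q a =>
    refine Or.inl fun E hE => ?_
    simp only [data, List.mem_cons, List.not_mem_nil, or_false] at hE
    rcases hE with rfl | rfl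
    · exact Or.inl ⟨e, by simp [data, mem_args], rfl⟩
    · exact Or.inr (Or.inl ⟨s, s', a, by simp [data, bot, mem_args]⟩)
  | halt p =>
    refine Or.inl fun E hE => ?_
    simp only [data] at hE ⊢
    split_ifs at hE ⊢ with h1 h2
    · simp at hE
    · simp only [List.mem_cons, List.not_mem_nil, or_false] at hE
      subst hE
      exact Or.inl ⟨e, by simp [mem_args], rfl⟩
    · simp only [List.mem_cons, List.not_mem_nil, or_false] at hE
      rcases hE with rfl | rfl
      · exact Or.inl ⟨e, by simp [mem_args], rfl⟩
      · exact Or.inl ⟨u, by simp, rfl⟩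
  | call p q => exact Or.inl (by simp [data])

/-- This is the hypothesis of `bot_unique`: each bottom value is copied from the top or computed
from it by stripping or appending one letter. -/
theorem bot_data (a₀ : A) (i : Idx A n k) : ∀ v ∈ (M.data a₀ i).bot, v = u ∨ v ∈ (M.data a₀ i).hd ∨
    (∃ v' ∈ (M.data a₀ i).hd, ∃ a, popEq v' a v ∈ (M.data a₀ i).eqs) ∨
      ∃ v' ∈ (M.data a₀ i).hd, ∃ a, pushEq v v' a ∈ (M.data a₀ i).eqs := by
  intro v hv
  cases i with
  | ans => simp [data, bot] at hv
  | wbase i => simp [data, bot] at hv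
  | wstep i a =>
    simp only [data, bot, Option.elim_some, List.mem_cons, List.not_mem_nil, or_false] at hv ⊢
    rcases hv with rfl | rfl
    · exact Or.inr (Or.inr (Or.inl ⟨s, by simp, a, by simp⟩))
    · exact Or.inr (Or.inr (Or.inl ⟨t, by simp, a, by simp⟩))
  | read p q a =>
    simp only [data, bot, Option.elim_some, mem_args] at hv ⊢
    have he : ∀ {v : PVar k}, v = e → v = u ∨ (v = s ∨ v = e ∨ v = e ∨ v = M.mvar p ∨ v = M.jvar p ∨
      ∃ i, x i = v) ∨ (∃ v', (v' = s ∨ v' = e ∨ v' = e ∨ v' = M.mvar p ∨ v' = M.jvar p ∨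
      ∃ i, x i = v') ∧ ∃ a_1, popEq v' a_1 v ∈ emptyEq e :: popEq s a s' ::
      M.appEqs q.succ (M.base p q) a) ∨ ∃ v', (v' = s ∨ v' = e ∨ v' = e ∨ v' = M.mvar p ∨
      v' = M.jvar p ∨ ∃ i, x i = v') ∧ ∃ a_1, pushEq v v' a_1 ∈ emptyEq e :: popEq s a s' ::
      M.appEqs q.succ (M.base p q) a := by
      rintro v rfl; simp
    rcases hv with rfl | h | h | h | h | ⟨i, rfl⟩
    · exact Or.inr (Or.inr (Or.inl ⟨s, by simp, a, by simp⟩))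
    · exact he h
    · exact he h
    · exact he h
    · exact he h
    · unfold out
      split_ifs with hi
      · refine Or.inr (Or.inr (Or.inr ⟨M.base p q i, ?_, a, ?_⟩))
        · rcases base_eq (M := M) p q i with h | h <;> simp [h]
        · simp only [List.mem_cons, mem_appEqs]
          exact Or.inr (Or.inr ⟨i, hi, rfl⟩)
      · rcases base_eq (M := M) p q i with h | h <;> simp [h]
  | dead p p' =>
    simp only [data, bot, Option.elim_some, mem_args] at hv ⊢
    rcases hv with rfl | rfl | rfl | rfl | rfl | ⟨i, rfl⟩
    · exact Or.inr (Or.inr (Or.inl ⟨s, by simp, a₀, by simp⟩))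
    all_goals simp
  | loop q a =>
    simp only [data, bot, Option.elim_some, mem_args] at hv ⊢
    rcases hv with rfl | rfl | rfl | rfl | rfl | ⟨i, rfl⟩
    · exact Or.inr (Or.inr (Or.inl ⟨s, by simp, a, by simp⟩))
    · simp
    · exact Or.inr (Or.inr (Or.inl ⟨t, by simp, a, by simp⟩))
    · simp
    · simp
    · unfold out
      split_ifs with hi
      · refine Or.inr (Or.inr (Or.inr ⟨x i, by simp, a, ?_⟩))
        simp only [List.mem_cons, mem_appEqs]
        exact Or.inr (Or.inr (Or.inr ⟨i, hi, rfl⟩))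
      · simp
  | accept q a => simp [data, bot] at hv
  | drain q a =>
    simp only [data, bot, Option.elim_some, mem_args] at hv ⊢
    rcases hv with rfl | rfl | rfl | rfl | rfl | ⟨i, rfl⟩
    · simp
    · simp
    · exact Or.inr (Or.inr (Or.inl ⟨t, by simp, a, by simp⟩))
    all_goals simp
  | check q a =>
    simp only [data, bot, Option.elim_some, mem_args] at hv ⊢
    rcases hv with rfl | rfl | rfl | rfl | rfl | ⟨i, rfl⟩
    · simp
    · simp
    · simp
    · simp
    · exact Or.inr (Or.inr (Or.inl ⟨s, by simp, a, by simp⟩))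
    · simp
  | halt p =>
    simp only [data] at hv ⊢
    split_ifs at hv ⊢
    · simp only [bot, Option.elim_some, mem_args] at hv ⊢
      rcases hv with rfl | rfl | rfl | rfl | rfl | ⟨i, rfl⟩ <;> simp
    · simp [bot] at hv
    · simp [bot] at hv
  | call p q =>
    simp only [data, bot, Option.elim_some, mem_args] at hv ⊢
    rcases hv with rfl | rfl | rfl | rfl | rfl | ⟨i, rfl⟩
    · simp
    · simp
    · rcases recalled_eq (M := M) p q with h | ⟨i, h⟩ <;> simp [h]
    · split_ifs <;> simp
    · simp
    · rcases base_eq (M := M) p q i with h | h <;> simp [h]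

/-- The arities of the relation symbols. -/
def arity : Sym n k → ℕ
  | none => 0
  | some (Sum.inl _) => 5 + k
  | some (Sum.inr _) => 2

end MemAut

-- Well-formedness and recursion structure of the program

namespace MemAut

variable {A : Type*} {n k : ℕ} (M : MemAut A n k)

open PVar PRule

theorem exists_guard {l : List (PVar k)} (hk : k ≠ 0) {v : PVar k} (hv : v ∈ l) :
    ∃ c ∈ guards (n := n) l, v.vr ∈ c.2 :=
  ⟨_, mem_guards.2 ⟨v, hv, ⟨0, Nat.pos_of_ne_zero hk⟩, rfl⟩, by simp⟩

theorem mvar_eq_of_zero (hk : k = 0) (p : Fin (n + 1)) : M.mvar p = e :=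
  (mvar_eq p).resolve_right fun h => h.1.ne_zero hk

theorem jvar_eq_of_zero (hk : k = 0) (p : Fin (n + 1)) : M.jvar p = e :=
  (jvar_eq p).resolve_right fun h => h.1.ne_zero hk

-- With at least one memory the guards contain every head variable. Without memories there are no
-- recall states either, so `mvar` and `jvar` are `e`, and the remaining head variables occur in an
-- equation or in the recursive atom.
variable {M} in
theorem occurs_data (a₀ : A) {i : Idx A n k} (hi : M.Valid i) : ∀ v ∈ (M.data a₀ i).hd,
    (∃ E ∈ (M.data a₀ i).eqs, v = E.1 ∨ Sum.inr v ∈ E.2) ∨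
      (∃ c ∈ (M.data a₀ i).aux, v.vr ∈ c.2) ∨ v ∈ (M.data a₀ i).bot := by
  intro v hv
  cases i with
  | ans => simp [data] at hv
  | wbase i =>
    simp only [data, List.mem_cons, List.not_mem_nil, or_false] at hv
    rcases hv with rfl | rfl <;> simp [data, emptyEq, peekEq]
  | wstep i a =>
    simp only [data, List.mem_cons, List.not_mem_nil, or_false] at hv
    rcases hv with rfl | rfl <;> simp [data, popEq]
  | read p q a =>
    by_cases hk : k = 0
    · simp only [data, mem_args, M.mvar_eq_of_zero hk, M.jvar_eq_of_zero hk] at hv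
      rcases hv with rfl | rfl | rfl | rfl | rfl | ⟨i, rfl⟩
      · exact Or.inl ⟨popEq s a s', by simp [data], Or.inl rfl⟩
      iterate 4 exact Or.inl ⟨emptyEq e, by simp [data], Or.inl rfl⟩
      subst hk; exact i.elim0
    · exact Or.inr (Or.inl (exists_guard hk hv))
  | dead p p' =>
    by_cases hk : k = 0
    · simp only [data, mem_args, M.mvar_eq_of_zero hk, M.jvar_eq_of_zero hk] at hv
      rcases hv with rfl | rfl | rfl | rfl | rfl | ⟨i, rfl⟩
      · exact Or.inl ⟨popEq s a₀ s', by simp [data], Or.inl rfl⟩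
      iterate 4 exact Or.inl ⟨emptyEq e, by simp [data], Or.inl rfl⟩
      subst hk; exact i.elim0
    · exact Or.inr (Or.inl (exists_guard hk hv))
  | loop q a => exact Or.inr (Or.inl (exists_guard hi.1.ne_zero hv))
  | accept q a => exact Or.inr (Or.inl (exists_guard hi.1.ne_zero hv))
  | drain q a => exact Or.inr (Or.inl (exists_guard hi.1.ne_zero hv))
  | check q a => exact Or.inr (Or.inl (exists_guard hi.1.ne_zero hv))
  | halt p =>
    by_cases hk : k = 0
    · have hv : v = e := by
        simp only [data] at hv
        split_ifs at hv <;>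
        · simp only [mem_args, M.jvar_eq_of_zero hk] at hv
          rcases hv with rfl | rfl | rfl | rfl | rfl | ⟨i, rfl⟩
          iterate 5 rfl
          subst hk; exact i.elim0
      subst hv
      simp only [data]
      split_ifs
      · exact Or.inr (Or.inr (by simp [bot, mem_args]))
      · exact Or.inl ⟨emptyEq e, by simp, Or.inl rfl⟩
      · exact Or.inl ⟨emptyEq e, by simp, Or.inl rfl⟩
    · refine Or.inr (Or.inl ?_)
      simp only [data] at hv ⊢
      split_ifs at hv ⊢ <;> exact exists_guard hk hv
  | call p q =>
    obtain ⟨-, i, -⟩ := hi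
    refine Or.inr (Or.inl (exists_guard ?_ hv))
    rintro rfl
    exact i.elim0

theorem length_hd (a₀ : A) (i : Idx A n k) :
    (M.data a₀ i).hd.length = arity (M.data a₀ i).sym := by
  cases i with
  | halt p => simp only [data]; split_ifs <;> simp [arity, length_args]
  | _ => simp [data, arity, length_args]

theorem length_aux (a₀ : A) (i : Idx A n k) :
    ∀ c ∈ (M.data a₀ i).aux, c.2.length = arity c.1 := by
  have hg : ∀ l : List (PVar k), ∀ c ∈ guards (n := n) l, c.2.length = arity c.1 := by
    intro l c hc
    obtain ⟨v, -, i, rfl⟩ := mem_guards.1 hc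
    rfl
  cases i with
  | ans => simp [data, arity, length_args]
  | wbase i => simp [data]
  | wstep i a => simp [data]
  | halt p => simp only [data]; split_ifs <;> exact hg _
  | _ => exact hg _

theorem length_tgt (a₀ : A) (i : Idx A n k) :
    ∀ c ∈ (M.data a₀ i).tgt, c.2.length = arity c.1 := by
  cases i with
  | halt p => simp only [data]; split_ifs <;> simp [arity, length_args]
  | _ => simp [data, arity, length_args]

theorem wf_data (a₀ : A) {i : Idx A n k} (hi : M.Valid i) : (M.data a₀ i).rule.WF arity := by
  refine ⟨?_, ?_, ?_, ?_⟩
  · simpa [PRule.rule] using M.length_hd a₀ i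
  · have h : (M.data a₀ i).eqs ≠ [] ∨ (M.data a₀ i).aux ≠ [] ∨ (M.data a₀ i).tgt ≠ none := by
      cases i with
      | halt p => simp only [data]; split_ifs <;> simp
      | _ => simp [data]
    simp only [PRule.rule, ne_eq, List.append_eq_nil_iff, List.map_eq_nil_iff,
      Option.toList_eq_nil_iff]
    tauto
  · intro φ hφ
    cases φ with
    | eqn v α =>
      obtain ⟨E, hE, rfl, rfl⟩ := PRule.eqn_mem_rule _ |>.1 hφ
      simp only [Atom.WF, List.mem_map, not_exists, not_and]
      rintro (a | v) hv h
      · simp at h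
      · have hne : v = E.1 := by simpa using h
        subst hne
        rcases M.isGood_data a₀ i with hg | ⟨hg, -, hz, -⟩
        · rcases hg E hE with ⟨v, -, rfl⟩ | ⟨v, v', a, h1, h2, -, -, rfl⟩ | ⟨i, v, a, h1, -, -, rfl⟩
          · simp [emptyEq] at hv
          · simp only [popEq, List.mem_cons, reduceCtorEq, Sum.inr.injEq, List.not_mem_nil,
              or_false, false_or] at hv
            subst hv
            rcases h1 with rfl | rfl <;> simp at h2
          · simp only [pushEq, List.mem_cons, reduceCtorEq, Sum.inr.injEq, List.not_mem_nil,
              or_false] at hv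
            subst hv
            simp at h1
        · rcases hg E hE with ⟨v, -, rfl⟩ | ⟨a, v, hv', rfl⟩
          · simp [emptyEq] at hv
          -- Only `wbase` and `accept` peek, with `v` equal to `t` or `e`; so `𝔲` does not occur on
          -- both sides of an equation.
          · have hu : u ∉ (M.data a₀ i).hd ∨ v ≠ u := by
              by_cases h : v = u
              · subst h
                left
                clear hg hz hφ hv h hv'
                cases i with
                | wbase i => simp [data]
                | accept q b => rcases a with _ | a <;> simp [data, peekEq, emptyEq] at hE
                | halt p => 
                  simp only [data] at hE
                  split_ifs at hE <;> simp [peekEq, emptyEq] at hE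
                | _ => simp [data, peekEq, emptyEq, popEq, mem_appEqs, pushEq] at hE
              · exact Or.inr h
            have hvu : v ≠ u := by
              rcases hu with hu | hu
              · rintro rfl; exact hu hv'
              · exact hu
            cases a <;> simp [peekEq] at hv <;> exact hvu hv.symm
    | rel R ys =>
      rcases (PRule.rel_mem_rule _).1 hφ with h | ⟨c, hc, rfl, rfl⟩
      · exact M.length_aux a₀ i _ h
      · simpa [Atom.WF] using M.length_tgt a₀ i c hc
  · intro x hx
    obtain ⟨v, hv, rfl⟩ := List.mem_map.1 hx
    rcases occurs_data a₀ hi v hv with ⟨E, hE, h⟩ | ⟨c, hc, h⟩ | h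
    · refine ⟨_, (PRule.eqn_mem_rule _).2 ⟨E, hE, rfl, rfl⟩, ?_⟩
      rcases h with rfl | h
      · simp [Atom.vars]
      · refine List.mem_cons_of_mem _ (List.mem_filterMap.2 ⟨Sum.inr v.vr, ?_, rfl⟩)
        exact List.mem_map.2 ⟨_, h, rfl⟩
    · exact ⟨_, (PRule.rel_mem_rule _).2 (Or.inl hc), h⟩
    · obtain ⟨c, hc, h⟩ := (PRule.mem_bot _).1 h
      exact ⟨_, (PRule.rel_mem_rule _).2 (Or.inr ⟨c, hc, rfl, rfl⟩), List.mem_map.2 ⟨v, h, rfl⟩⟩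

/-- The indices as elements of a finite type. -/
def Idx.toSum : Idx A n k → Option (Fin k × Option A) ⊕ (Fin (n + 1) × Fin n × A) ⊕
    (Fin (n + 1) × Fin (n + 1)) ⊕ (Fin 4 × Fin n × A) ⊕ Fin (n + 1) ⊕ (Fin (n + 1) × Fin n)
  | .ans => .inl none
  | .wbase i => .inl (some (i, none))
  | .wstep i a => .inl (some (i, some a))
  | .read p q a => .inr (.inl (p, q, a))
  | .dead p p' => .inr (.inr (.inl (p, p')))
  | .loop q a => .inr (.inr (.inr (.inl (0, q, a))))
  | .accept q a => .inr (.inr (.inr (.inl (1, q, a))))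
  | .drain q a => .inr (.inr (.inr (.inl (2, q, a))))
  | .check q a => .inr (.inr (.inr (.inl (3, q, a))))
  | .halt p => .inr (.inr (.inr (.inr (.inl p))))
  | .call p q => .inr (.inr (.inr (.inr (.inr (p, q)))))

theorem Idx.toSum_injective : Function.Injective (Idx.toSum (A := A) (n := n) (k := k)) := by
  intro i i' h
  cases i <;> cases i' <;> simp_all [Idx.toSum]

variable [Fintype A]

instance : Finite (Idx A n k) := Finite.of_injective _ Idx.toSum_injective

/-- The indices of the rules of the program. -/
noncomputable def validSet : Finset (Idx A n k) := (Set.toFinite {i | M.Valid i}).toFinset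

open Classical in
/-- The program of a memory automaton. -/
noncomputable def prog (a₀ : A) : Program A (Sym n k) where
  univ := vr (u : PVar k)
  ans := none
  ar := arity
  rules := M.validSet.image fun i => (M.data a₀ i).rule
  wf := by
    intro ρ hρ
    obtain ⟨i, hi, rfl⟩ := Finset.mem_image.1 hρ
    exact M.wf_data a₀ (by simpa [validSet] using hi)

variable {M} {a₀ : A}

theorem mem_rules {ρ : Rule A (Sym n k)} :
    ρ ∈ (M.prog a₀).rules ↔ ∃ i, M.Valid i ∧ (M.data a₀ i).rule = ρ := by
  simp [prog, validSet]

theorem univ_prog : (M.prog a₀).univ = vr (u : PVar k) := rfl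

theorem dependsOn_tgt {i : Idx A n k} (hi : M.Valid i) {c : Sym n k × List (PVar k)}
    (hc : c ∈ (M.data a₀ i).tgt) : (M.prog a₀).DependsOn (M.data a₀ i).sym c.1 :=
  ⟨_, mem_rules.2 ⟨i, hi, rfl⟩, rfl, _, (PRule.rel_mem_rule _).2 (Or.inr ⟨c, hc, rfl, rfl⟩)⟩

theorem dependsOn_iff {R R' : Sym n k} : (M.prog a₀).DependsOn R R' ↔
    ∃ i, M.Valid i ∧ (M.data a₀ i).sym = R ∧
      ((∃ c ∈ (M.data a₀ i).aux, c.1 = R') ∨ ∃ c ∈ (M.data a₀ i).tgt, c.1 = R') := by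
  constructor
  · rintro ⟨ρ, hρ, rfl, ys, h⟩
    obtain ⟨i, hi, rfl⟩ := mem_rules.1 hρ
    refine ⟨i, hi, rfl, ?_⟩
    rcases (PRule.rel_mem_rule _).1 h with h | ⟨c, hc, h, -⟩
    · exact Or.inl ⟨_, h, rfl⟩
    · exact Or.inr ⟨c, hc, h⟩
  · rintro ⟨i, hi, rfl, ⟨c, hc, rfl⟩ | ⟨c, hc, rfl⟩⟩
    · exact ⟨_, mem_rules.2 ⟨i, hi, rfl⟩, rfl, _, (PRule.rel_mem_rule _).2 (Or.inl hc)⟩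
    · exact dependsOn_tgt hi hc

theorem not_dependsOn_none {R : Sym n k} : ¬ (M.prog a₀).DependsOn R none := by
  rw [dependsOn_iff]
  have hg : ∀ l : List (PVar k), ¬ ∃ c ∈ guards (n := n) l, c.1 = none := by
    rintro l ⟨c, hc, h⟩
    obtain ⟨v, -, i, rfl⟩ := mem_guards.1 hc
    simp at h
  rintro ⟨i, -, -, h⟩
  cases i with
  | halt p =>
    simp only [data] at h
    split_ifs at h <;> simp [hg] at h
  | _ => simp [data, hg] at h

theorem eq_of_dependsOn_symW {i : Fin k} {R : Sym n k} (h : (M.prog a₀).DependsOn (symW i) R) :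
    R = symW i := by
  obtain ⟨i', -, h1, h2⟩ := dependsOn_iff.1 h
  clear h
  cases i' with
  | halt p =>
    simp only [data] at h1
    split_ifs at h1 <;> simp at h1
  | wstep i' a =>
    have h1 : i' = i := by simpa [data] using h1
    subst h1
    simpa [data, eq_comm] using h2
  | wbase i' => simp [data] at h2
  | _ => simp [data] at h1

/-- The relation of a memory depends on nothing but itself, so guards never count as recursive
atoms. -/
theorem not_mutRec_symW {R : Sym n k} {i : Fin k} (hR : R ≠ symW i) :
    ¬ (M.prog a₀).MutRec R (symW i) := by
  rintro ⟨-, h⟩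
  have : ∀ R', Relation.TransGen (M.prog a₀).DependsOn (symW i) R' → R' = symW i := by
    intro R' h
    induction h with
    | single h => exact eq_of_dependsOn_symW h
    | tail _ h ih => subst ih; exact eq_of_dependsOn_symW h
  exact hR (this _ h)

theorem not_mutRec_none {R : Sym n k} : ¬ (M.prog a₀).MutRec none R := by
  rintro ⟨-, h⟩
  obtain ⟨R', -, h⟩ := Relation.TransGen.tail'_iff.1 h
  exact not_dependsOn_none h

/-- One edge of the cycle `0 → 1 → ⋯ → n → 0` through all state relations; a `dead` rule replaces a
missing transition. -/
theorem dependsOn_succ (q : Fin n) :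
    (M.prog a₀).DependsOn (symR q.castSucc) (symR q.succ) := by
  by_cases h : M.tr q.castSucc q
  · rcases hq : M.lab q with a | i
    · exact dependsOn_tgt (i := .read _ q a) ⟨h, hq⟩ (by simp [data]; rfl)
    · exact dependsOn_tgt (i := .call _ q) ⟨h, i, hq⟩ (by simp [data]; rfl)
  · exact dependsOn_tgt (i := .dead _ q.succ) (Or.inl ⟨q, rfl, rfl, h⟩) (by simp [data]; rfl)

omit [Fintype A] in
theorem Hub.not_calls (h : M.Hub) (p : Fin (n + 1)) : ¬ M.Calls p := by
  rintro ⟨q, i, -, hi⟩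
  obtain ⟨a, ha⟩ := h.1 q
  simp [ha] at hi

theorem dependsOn_zero : (M.prog a₀).DependsOn (symR (Fin.last n)) (symR 0) := by
  by_cases h : M.Hub
  · have := dependsOn_tgt (M := M) (a₀ := a₀) (i := .halt (Fin.last n))
      (c := (symR 0, args e e e e x)) ⟨h.not_calls _, Or.inl h.2.2⟩ (by simp [data, h])
    simpa [data, h] using this
  · exact dependsOn_tgt (i := .dead _ 0) (Or.inr ⟨rfl, rfl, h⟩) (by simp [data]; rfl)

/-- Going round the cycle makes all state relations mutually recursive, so the target atom of every
state rule provides its bottom variables. -/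
theorem transGen_symR (p p' : Fin (n + 1)) :
    Relation.TransGen (M.prog a₀).DependsOn (symR p) (symR p') := by
  have h1 : Relation.ReflTransGen (M.prog a₀).DependsOn (symR 0) (symR p') := by
    induction p' using Fin.induction with
    | zero => exact .refl
    | succ q ih => exact ih.tail (dependsOn_succ q)
  have h2 : Relation.ReflTransGen (M.prog a₀).DependsOn (symR p) (symR (Fin.last n)) := by
    induction p using Fin.reverseInduction with
    | last => exact .refl
    | cast q ih => exact ih.head (dependsOn_succ q)
  exact (Relation.TransGen.trans_right h2 (.single dependsOn_zero)).trans_left h1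

theorem not_mutRec_aux (i : Idx A n k) :
    ∀ c ∈ (M.data a₀ i).aux, ¬ (M.prog a₀).MutRec (M.data a₀ i).sym c.1 := by
  have hg : ∀ (l : List (PVar k)) (p : Fin (n + 1)), ∀ c ∈ guards (n := n) l,
      ¬ (M.prog a₀).MutRec (symR p) c.1 := by
    intro l p c hc
    obtain ⟨v, -, i, rfl⟩ := mem_guards.1 hc
    exact not_mutRec_symW (by simp)
  cases i with
  | ans => exact fun _ _ => not_mutRec_none
  | wbase i => simp [data]
  | wstep i a => simp [data]
  | halt p => simp only [data]; split_ifs <;> exact hg _ _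
  | _ => exact hg _ _

theorem mutRec_tgt {i : Idx A n k} (hi : M.Valid i) :
    ∀ c ∈ (M.data a₀ i).tgt, (M.prog a₀).MutRec (M.data a₀ i).sym c.1 := by
  have h : ∀ p p', (M.prog a₀).MutRec (symR p) (symR p') := fun p p' =>
    ⟨transGen_symR _ _, transGen_symR _ _⟩
  intro c hc
  cases i with
  | wstep i a =>
    have hd := dependsOn_tgt hi hc
    simp only [data, Option.mem_def, Option.some.injEq] at hc hd ⊢
    subst hc
    exact ⟨.single hd, .single hd⟩
  | halt p =>
    simp only [data] at hc ⊢
    split_ifs at hc ⊢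
    · simp only [Option.mem_def, Option.some.injEq] at hc
      subst hc; exact h _ _
    · simp at hc
    · simp at hc
  | ans => simp [data] at hc
  | wbase => simp [data] at hc
  | accept => simp [data] at hc
  | _ =>
    simp only [data, Option.mem_def, Option.some.injEq] at hc ⊢
    subst hc
    exact h _ _

theorem isOLLA_prog : (M.prog a₀).IsOLLA := by
  refine ⟨fun ρ hρ => ?_, fun ρ hρ => ?_⟩ <;> obtain ⟨i, hi, rfl⟩ := mem_rules.1 hρ
  · rw [PRule.recAtoms_rule _ _ (not_mutRec_aux i) (mutRec_tgt hi)]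
    rcases (M.data a₀ i).tgt with _ | c <;> simp
  · exact ⟨PRule.isOLLARule _ _ univ_prog (not_mutRec_aux i) (mutRec_tgt hi) (M.isGood_data a₀ i),
      fun v _ => PRule.not_usedLeft_and_usedRight _ _ univ_prog (M.isGood_data a₀ i) v⟩

theorem isLocallyDeterministic_prog : (M.prog a₀).IsLocallyDeterministic := by
  intro ρ hρ w tt b b' h h'
  obtain ⟨i, hi, rfl⟩ := mem_rules.1 hρ
  exact PRule.bot_unique _ _ univ_prog (not_mutRec_aux i) (mutRec_tgt hi) (M.bot_data a₀ i) h h'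

end MemAut

namespace MemAut

variable {A : Type*} {n k : ℕ} {M : MemAut A n k}

open PVar PRule

/-! ### Determinism -/

/-- The conditions on the first arguments under which the equations of a rule can be satisfied. -/
def Cond (M : MemAut A n k) (w S E T F : List A) : Idx A n k → Prop
  | .ans => True
  | .wbase _ => S = []
  | .wstep _ a => S.head? = some a
  | .read _ _ a => E = [] ∧ S.head? = some a ∧ T = E
  | .dead _ _ => False
  | .loop _ a => E = [] ∧ S.head? = some a ∧ T.head? = some a
  | .accept _ a => E = [] ∧ S = E ∧ F = w ∧ w.getLast? = some a
  | .drain _ a => E = [] ∧ S = E ∧ F = w ∧ T.head? = some a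
  | .check _ a => E = [] ∧ T = E ∧ F = w ∧ S.head? = some a ∧ w ≠ []
  | .halt _ => S = E ∧ T = E ∧ F = E
  | .call p _ => T = E ∧ (M.IsRec p ∧ M.Star p → F = E)

/-- The relation symbol in the head of a rule. -/
def Idx.head : Idx A n k → Sym n k
  | .ans => none
  | .wbase i => symW i
  | .wstep i _ => symW i
  | .read p _ _ => symR p
  | .dead p _ => symR p
  | .loop q _ => symR q.succ
  | .accept q _ => symR q.succ
  | .drain q _ => symR q.succ
  | .check q _ => symR q.succ
  | .halt p => symR p
  | .call p _ => symR p

theorem sym_data (a₀ : A) (i : Idx A n k) : (M.data a₀ i).sym = i.head := by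
  cases i with
  | halt p => simp only [data]; split_ifs <;> rfl
  | _ => rfl

/-- The delicate rival is `call`. It excludes `read` by determinism of the automaton and `halt` by
validity. Against `accept` and `check`, the state must be in `Star`, where `call` needs an empty
flag, whereas theirs is `w ≠ []`. Against `loop` and `drain`, the word `t` decides. -/
theorem eq_of_cond {w S E T F : List A} {i i' : Idx A n k} (hi : M.Valid i) (hi' : M.Valid i')
    (h : i.head = i'.head) (hc : M.Cond w S E T F i) (hc' : M.Cond w S E T F i') : i = i' := by
  cases i with
  | ans => cases i' <;> simp_all [Idx.head]
  | wbase i => cases i' <;> simp_all [Idx.head, Cond]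
  | wstep i a => cases i' <;> simp_all [Idx.head, Cond]
  | dead p p' => exact hc.elim
  | read p q a =>
    cases i' with
    | read p' q' a' =>
      simp only [Idx.head, Option.some.injEq, Sum.inl.injEq] at h
      subst h
      obtain rfl : a = a' := by simpa using hc.2.1.symm.trans hc'.2.1
      rw [read_unique hi.1 hi.2 hi'.1 hi'.2]
    | check q' a' =>
      simp only [Idx.head, Option.some.injEq, Sum.inl.injEq] at h
      subst h
      exact (hi'.2.2.2.not_read hi.1 hi.2).elim
    | call p' q' =>
      simp only [Idx.head, Option.some.injEq, Sum.inl.injEq] at h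
      subst h
      exact (Calls.not_read ⟨q', hi'.2.choose, hi'.1, hi'.2.choose_spec⟩ hi.1 hi.2).elim
    | _ => simp_all [Idx.head, Cond]
  | loop q a => cases i' <;> simp_all [Idx.head, Cond]
  | accept q a =>
    cases i' with
    | call p' q' =>
      simp only [Idx.head, Option.some.injEq, Sum.inl.injEq] at h
      subst h
      have h1 : M.Calls q.succ := ⟨q', hi'.2.choose, hi'.1, hi'.2.choose_spec⟩
      have h2 := hc'.2 ⟨hi.1.isRec, hi.2.2.resolve_right (not_not.2 h1)⟩
      simp only [Cond] at hc hc'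
      grind
    | _ => simp_all [Idx.head, Cond, Valid]
  | drain q a => cases i' <;> simp_all [Idx.head, Cond, Valid]
  | check q a =>
    cases i' with
    | read p' q' a' =>
      simp only [Idx.head, Option.some.injEq, Sum.inl.injEq] at h
      subst h
      exact (hi.2.2.2.not_read hi'.1 hi'.2).elim
    | call p' q' =>
      simp only [Idx.head, Option.some.injEq, Sum.inl.injEq] at h
      subst h
      have h2 := hc'.2 ⟨hi.1.isRec, hi.2.2.1⟩
      simp only [Cond] at hc hc'
      grind
    | _ => simp_all [Idx.head, Cond, Valid]
  | halt p =>
    cases i' with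
    | call p' q' =>
      simp only [Idx.head, Option.some.injEq, Sum.inl.injEq] at h
      subst h
      exact (hi.1 ⟨q', hi'.2.choose, hi'.1, hi'.2.choose_spec⟩).elim
    | _ => simp_all [Idx.head, Cond, Valid] <;> grind
  | call p q =>
    have h1 : M.Calls p := ⟨q, hi.2.choose, hi.1, hi.2.choose_spec⟩
    cases i' with
    | read p' q' a' =>
      simp only [Idx.head, Option.some.injEq, Sum.inl.injEq] at h
      subst h
      exact (h1.not_read hi'.1 hi'.2).elim
    | accept q' a' =>
      simp only [Idx.head, Option.some.injEq, Sum.inl.injEq] at h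
      subst h
      have h2 := hc.2 ⟨hi'.1.isRec, hi'.2.2.resolve_right (not_not.2 h1)⟩
      simp only [Cond] at hc hc'
      grind
    | check q' a' =>
      simp only [Idx.head, Option.some.injEq, Sum.inl.injEq] at h
      subst h
      have h2 := hc.2 ⟨hi'.1.isRec, hi'.2.2.1⟩
      simp only [Cond] at hc hc'
      grind
    | halt p' =>
      simp only [Idx.head, Option.some.injEq, Sum.inl.injEq] at h
      subst h
      exact (hi'.1 h1).elim
    | call p' q' =>
      simp only [Idx.head, Option.some.injEq, Sum.inl.injEq] at h
      subst h
      rw [Calls.unique hi.1 hi.2.choose_spec hi'.1]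
    | _ => simp_all [Idx.head, Cond, Valid] <;> grind

/-- The conditions refer to entries of the top tuple rather than to variables, so that they transfer
to another rule with the same top tuple. Entries that shorter tuples lack are not used by their
conditions. -/
theorem cond_of_holds {a₀ : A} {i : Idx A n k} {w : List A} {f : PVar k → List A} (hu : f u = w)
    (hf : ∀ v ∈ (M.data a₀ i).hd, f v <:+: w) (hE : ∀ E ∈ (M.data a₀ i).eqs, Holds f E) :
    M.Cond w ((((M.data a₀ i).hd.map f) ++ [w]).getD 0 []) ((((M.data a₀ i).hd.map f) ++ [w]).getD 1 [])
      ((((M.data a₀ i).hd.map f) ++ [w]).getD 2 []) ((((M.data a₀ i).hd.map f) ++ [w]).getD 3 []) i := by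
  cases i with
  | ans => trivial
  | wbase i => simp_all [data, Cond]
  | wstep i a => simp_all [data, Cond]
  | read p q a =>
    simp only [data, List.forall_mem_cons, holds_emptyEq, holds_popEq] at hE
    simp [data, Cond, args, hE]
  | dead p p' =>
    simp only [data, List.forall_mem_cons, holds_emptyEq, holds_popEq] at hE
    simp [hE.2.1] at hE
  | loop q a =>
    simp only [data, List.forall_mem_cons, holds_emptyEq, holds_popEq] at hE
    simp [data, Cond, args, hE]
  | accept q a =>
    simp only [data, List.forall_mem_cons, holds_emptyEq, holds_peekEq_some] at hE
    have : w = f z ++ [a] := by simp [← hu, hE]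
    simp [data, Cond, args, hE]
    simp [this]
  | drain q a =>
    simp only [data, List.forall_mem_cons, holds_emptyEq, holds_popEq] at hE
    simp [data, Cond, args, hE, hu]
  | check q a =>
    simp only [data, List.forall_mem_cons, holds_emptyEq, holds_popEq] at hE
    have := hf s (by simp [data, mem_args])
    simp [data, Cond, args, hE]
    refine ⟨hu, ?_⟩
    rintro rfl
    simp [hE] at this
  | halt p =>
    simp only [data]
    split_ifs <;> simp [Cond, args]
  | call p q =>
    simp only [data, Cond, args, cvar]
    refine ⟨rfl, fun h => ?_⟩
    simp [h]

variable [Fintype A] {a₀ : A}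

theorem isGloballyDeterministic_prog : (M.prog a₀).IsGloballyDeterministic := by
  intro ρ hρ χ hχ hs hne w tt b b' h h'
  obtain ⟨i, hi, rfl⟩ := mem_rules.1 hρ
  obtain ⟨i', hi', rfl⟩ := mem_rules.1 hχ
  obtain ⟨θ, hθ, hE, rfl, -⟩ :=
    PRule.topBottom_rule _ _ univ_prog (not_mutRec_aux i) (mutRec_tgt hi) h
  obtain ⟨θ', hθ', hE', ht, -⟩ :=
    PRule.topBottom_rule _ _ univ_prog (not_mutRec_aux i') (mutRec_tgt hi') h'
  have hc := cond_of_holds (f := fun v => θ v.vr) (w := w) (a₀ := a₀) (M := M) hθ.1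
    (fun v hv => hθ.2 _ (List.mem_append_left _ (List.mem_map_of_mem hv))) hE
  have hc' := cond_of_holds (f := fun v => θ' v.vr) (w := w) (a₀ := a₀) (M := M) hθ'.1
    (fun v hv => hθ'.2 _ (List.mem_append_left _ (List.mem_map_of_mem hv))) hE'
  rw [← ht] at hc'
  have hs : i.head = i'.head := by rw [← sym_data (M := M) a₀, ← sym_data (M := M) a₀]; exact hs
  exact hne (by rw [eq_of_cond hi hi' hs hc hc'])

/-! ### Strict decrease -/

/-- The top variable that a rule shortens. -/
def Idx.src : Idx A n k → PVar k
  | .drain _ _ => t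
  | _ => s

/-- The bottom variable that holds the shortened value. -/
def Idx.dst : Idx A n k → PVar k
  | .drain _ _ => t'
  | _ => s'

/-- The letter that a rule consumes. -/
def Idx.letter (a₀ : A) : Idx A n k → A
  | .wstep _ a => a
  | .read _ _ a => a
  | .loop _ a => a
  | .drain _ a => a
  | .check _ a => a
  | _ => a₀

theorem decreases_prog {i : Idx A n k} (hi : M.Valid i)
    (hc : (M.data a₀ i).tgt ≠ none ∧ (M.data a₀ i).eqs ≠ []) :
    (M.prog a₀).Decreases (M.data a₀ i).rule i.src.vr i.dst.vr := by
  have key : i.src ∈ (M.data a₀ i).hd ∧ i.dst ∈ (M.data a₀ i).bot ∧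
      popEq i.src (i.letter a₀) i.dst ∈ (M.data a₀ i).eqs := by
    cases i with
    | halt p =>
      simp only [data] at hc
      split_ifs at hc <;> simp at hc
    | ans => simp [data] at hc
    | wbase => simp [data] at hc
    | accept => simp [data] at hc
    | call => simp [data] at hc
    | _ => simp [data, Idx.src, Idx.dst, Idx.letter, bot, mem_args]
  exact PRule.decreases _ _ univ_prog (not_mutRec_aux i) (mutRec_tgt hi) key.1 key.2.1 key.2.2

-- After `read` and `loop` the flag is empty, so `drain` would require `w = []`, contradicting that
-- its nonempty `t` is a factor of `w`. After `check` both `t` and the flag are empty, and no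
-- critical rule fits: `loop` needs a nonempty `t`, another `check` a nonempty flag, and `read` a
-- state that is not left by a recall. After `drain` the input is used up, so only `drain` can
-- follow.
omit [Fintype A] in
theorem eq_of_applied {a₀ : A} {i i' : Idx A n k} {w : List A} {f f' : PVar k → List A}
    (hi : M.Valid i) (hi' : M.Valid i') {c : Sym n k × List (PVar k)} (hc : c ∈ (M.data a₀ i).tgt)
    (he : (M.data a₀ i).eqs ≠ []) (hc' : (M.data a₀ i').tgt ≠ none) (he' : (M.data a₀ i').eqs ≠ [])
    (hs : i'.head = c.1) (hu : f' u = w)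
    (hf : ∀ v ∈ (M.data a₀ i').hd, f' v <:+: w)
    (hE : ∀ E ∈ (M.data a₀ i).eqs, Holds f E) (hE' : ∀ E ∈ (M.data a₀ i').eqs, Holds f' E)
    (ht : (M.data a₀ i').hd.map f' = c.2.map f) : f i.dst = f' i'.src := by
  cases i with
  | ans => simp [data] at hc
  | wbase => simp [data] at hc
  | accept => simp [data] at hc
  | call => simp [data] at he
  | halt p =>
    simp only [data] at hc he
    split_ifs at hc he <;> simp at hc he
  | dead p p' =>
    simp only [data, List.forall_mem_cons, holds_emptyEq, holds_popEq] at hE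
    simp [hE.2.1] at hE
  | wstep i a =>
    simp only [data, Option.mem_def, Option.some.injEq] at hc
    subst hc
    cases i' with
    | wstep i' a' =>
      simp only [data, List.map_cons, List.cons.injEq] at ht
      exact ht.1.symm
    | _ => simp_all [Idx.head, data]
  | read p q a =>
    simp only [data, Option.mem_def, Option.some.injEq] at hc
    subst hc
    simp only [data, List.forall_mem_cons, holds_emptyEq, holds_popEq] at hE
    cases i' with
    | ans => simp [data] at hc'
    | wbase => simp [data] at hc'
    | wstep => simp [Idx.head] at hs
    | accept => simp [data] at hc'
    | call => simp [data] at he'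
    | halt p =>
      simp only [data] at hc' he'
      split_ifs at hc' he' <;> simp at hc' he'
    | drain q' a' =>
      have h1 := hf t (by simp [data, mem_args])
      simp only [data, List.forall_mem_cons, holds_emptyEq, holds_popEq] at hE'
      simp only [data, args, List.map_append, List.map_cons, List.cons_append, List.cons.injEq] at ht
      grind
    | _ =>
      simp only [data, args, List.map_append, List.map_cons, List.cons_append, List.cons.injEq] at ht
      exact ht.1.symm
  | loop q a =>
    simp only [data, Option.mem_def, Option.some.injEq] at hc
    subst hc
    simp only [data, List.forall_mem_cons, holds_emptyEq, holds_popEq] at hE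
    cases i' with
    | ans => simp [data] at hc'
    | wbase => simp [data] at hc'
    | wstep => simp [Idx.head] at hs
    | accept => simp [data] at hc'
    | call => simp [data] at he'
    | halt p =>
      simp only [data] at hc' he'
      split_ifs at hc' he' <;> simp at hc' he'
    | drain q' a' =>
      have h1 := hf t (by simp [data, mem_args])
      simp only [data, List.forall_mem_cons, holds_emptyEq, holds_popEq] at hE'
      simp only [data, args, List.map_append, List.map_cons, List.cons_append, List.cons.injEq] at ht
      grind
    | _ =>
      simp only [data, args, List.map_append, List.map_cons, List.cons_append, List.cons.injEq] at ht
      exact ht.1.symm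
  | check q a =>
    simp only [data, Option.mem_def, Option.some.injEq] at hc
    subst hc
    simp only [data, List.forall_mem_cons, holds_emptyEq, holds_popEq] at hE
    cases i' with
    | ans => simp [data] at hc'
    | wbase => simp [data] at hc'
    | wstep => simp [Idx.head] at hs
    | accept => simp [data] at hc'
    | call => simp [data] at he'
    | halt p =>
      simp only [data] at hc' he'
      split_ifs at hc' he' <;> simp at hc' he'
    | read p' q' a' =>
      obtain rfl : p' = q.succ := by simpa [Idx.head] using hs
      exact (hi.2.2.2.not_read hi'.1 hi'.2).elim
    | dead p p' =>
      simp only [data, List.forall_mem_cons, holds_emptyEq, holds_popEq] at hE'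
      simp [hE'.2.1] at hE'
    | loop q' a' =>
      simp only [data, List.forall_mem_cons, holds_emptyEq, holds_popEq] at hE'
      simp only [data, args, List.map_append, List.map_cons, List.cons_append, List.cons.injEq] at ht
      grind
    | drain q' a' =>
      obtain rfl : q' = q := by simpa [Idx.head] using hs
      exact (hi'.2.2.1 hi.2.2.1).elim
    | check q' a' =>
      have h1 := hf s (by simp [data, mem_args])
      simp only [data, List.forall_mem_cons, holds_emptyEq, holds_popEq] at hE'
      simp only [data, args, List.map_append, List.map_cons, List.cons_append, List.cons.injEq] at ht
      grind
  | drain q a =>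
    simp only [data, Option.mem_def, Option.some.injEq] at hc
    subst hc
    simp only [data, List.forall_mem_cons, holds_emptyEq, holds_popEq] at hE
    cases i' with
    | ans => simp [data] at hc'
    | wbase => simp [data] at hc'
    | wstep => simp [Idx.head] at hs
    | accept => simp [data] at hc'
    | call => simp [data] at he'
    | halt p =>
      simp only [data] at hc' he'
      split_ifs at hc' he' <;> simp at hc' he'
    | read p' q' a' =>
      obtain rfl : p' = q.succ := by simpa [Idx.head] using hs
      exact (hi.2.2.2.not_read hi'.1 hi'.2).elim
    | dead p p' =>
      simp only [data, List.forall_mem_cons, holds_emptyEq, holds_popEq] at hE'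
      simp [hE'.2.1] at hE'
    | loop q' a' =>
      simp only [data, List.forall_mem_cons, holds_emptyEq, holds_popEq] at hE'
      simp only [data, args, List.map_append, List.map_cons, List.cons_append, List.cons.injEq] at ht
      grind
    | drain q' a' =>
      simp only [data, args, List.map_append, List.map_cons, List.cons_append, List.cons.injEq] at ht
      exact ht.2.2.1.symm
    | check q' a' =>
      obtain rfl : q' = q := by simpa [Idx.head] using hs
      exact (hi.2.2.1 hi'.2.2.1).elim

theorem isStrictlyDecreasing_prog : (M.prog a₀).IsStrictlyDecreasing := by
  intro ρ hρ hc
  obtain ⟨i, hi, rfl⟩ := mem_rules.1 hρ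
  have hc := (PRule.isCritical_iff _ _ (not_mutRec_aux i) (mutRec_tgt hi)).1 hc
  refine ⟨_, _, decreases_prog hi hc, ?_⟩
  intro R' ys hR χ hχ hc' hs
  obtain ⟨i', hi', rfl⟩ := mem_rules.1 hχ
  have hc' := (PRule.isCritical_iff _ _ (not_mutRec_aux i') (mutRec_tgt hi')).1 hc'
  refine ⟨_, _, decreases_prog hi' hc', ?_⟩
  intro w θ θ' hm hm' ht
  rw [PRule.recAtoms_rule _ _ (not_mutRec_aux i) (mutRec_tgt hi)] at hR
  simp only [List.mem_map, Option.mem_toList, Prod.mk.injEq] at hR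
  obtain ⟨c, hct, hR, rfl⟩ := hR
  refine eq_of_applied (f := fun v => θ v.vr) (f' := fun v => θ' v.vr) hi hi' hct hc.2 hc'.1 hc'.2
    ?_ hm'.1.1
    (fun v hv => hm'.1.2 _ (List.mem_append_left _ (List.mem_map_of_mem hv)))
    ((PRule.satEqns_rule _).1 hm.2.1) ((PRule.satEqns_rule _).1 hm'.2.1) ?_
  · rw [hR, ← hs, ← sym_data (M := M) a₀]
    rfl
  · simpa [PRule.rule, Function.comp_def] using ht

theorem isSDDOLLA_prog : (M.prog a₀).IsSDDOLLA :=
  ⟨⟨isOLLA_prog, isLocallyDeterministic_prog, isGloballyDeterministic_prog⟩,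
    isStrictlyDecreasing_prog⟩

end MemAut

namespace MemAut

variable {A : Type*} {n k : ℕ} {M : MemAut A n k}

open PVar PRule

/-! ### Tuples -/

/-- The tuples of the relations for the states. -/
def tup (s e t m j : List A) (μ : Fin k → List A) : List (List A) :=
  [s, e, t, m, j] ++ (List.finRange k).map μ

theorem map_args (f : PVar k → List A) (s₀ t₀ m₀ j₀ : PVar k) (c : Fin k → PVar k) :
    (args s₀ t₀ m₀ j₀ c).map f = tup (f s₀) (f e) (f t₀) (f m₀) (f j₀) fun i => f (c i) := by
  simp [args, tup, Function.comp_def]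

theorem tup_inj {s e t m j s' e' t' m' j' : List A} {μ μ' : Fin k → List A} :
    tup s e t m j μ = tup s' e' t' m' j' μ' ↔
      s = s' ∧ e = e' ∧ t = t' ∧ m = m' ∧ j = j' ∧ μ = μ' := by
  simp [tup, funext_iff]

theorem app_nil (p : Fin (n + 1)) (μ : Fin k → List A) : M.app p [] μ = μ := by
  funext i; simp [app]

theorem app_app (p : Fin (n + 1)) (u v : List A) (μ : Fin k → List A) :
    M.app p v (M.app p u μ) = M.app p (u ++ v) μ := by
  funext i; simp only [app]; split_ifs <;> simp

theorem map_base {f : PVar k → List A} (he : f e = []) (p : Fin (n + 1)) (q : Fin n) (i : Fin k) :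
    f (M.base p q i) = M.exec p q (fun i => f (x i)) i := by
  rw [base, MemInstr.map_eff f, he, exec]

theorem map_out {f : PVar k → List A} {p : Fin (n + 1)} {b : Fin k → PVar k} {a : A}
    (h : ∀ E ∈ M.appEqs p b a, Holds f E) (i : Fin k) :
    f (M.out p b i) = M.app p [a] (fun i => f (b i)) i := by
  simp only [out, app]
  split_ifs with hi
  · exact (holds_pushEq _ _ _ _).1 (h _ (mem_appEqs.2 ⟨i, hi, rfl⟩))
  · rfl

variable [Fintype A] {a₀ : A} {w : List A}

/-- The auxiliary atoms are forgotten: soundness needs only the equations and the recursive atom.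
The output rule, whose atom is auxiliary, is treated in `language_subset`. -/
theorem derives_induction {C : Sym n k → List (List A) → Prop}
    (step : ∀ i f, M.Valid i → f u = w → (∀ v ∈ (M.data a₀ i).hd, f v <:+: w) →
      (∀ E ∈ (M.data a₀ i).eqs, Holds f E) →
      (∀ c ∈ (M.data a₀ i).tgt, C c.1 (c.2.map f)) → C (M.data a₀ i).sym ((M.data a₀ i).hd.map f))
    {R : Sym n k} {tt : List (List A)} (h : (M.prog a₀).Derives w R tt) : C R tt := by
  induction h with
  | step ρ hρ θ hθ heq hrel ih =>
    obtain ⟨i, hi, rfl⟩ := mem_rules.1 hρ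
    have := step i (fun v => θ v.vr) hi hθ.1
      (fun v hv => hθ.2 _ (List.mem_append_left _ (List.mem_map_of_mem hv)))
      ((PRule.satEqns_rule _).1 heq) fun c hc => by
        have := ih c.1 (c.2.map vr) ((PRule.rel_mem_rule _).2 (Or.inr ⟨c, hc, rfl, rfl⟩))
        simpa [Function.comp_def] using this
    simpa [PRule.rule, Function.comp_def] using this

/-! ### Soundness -/

/-- What a tuple in the relation of a state says about the automaton. -/
def Sound (M : MemAut A n k) (w : List A) (p : Fin (n + 1)) (s t m : List A)
    (μ : Fin k → List A) : Prop :=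
  (∃ s', s = t ++ s' ∧ M.Run p (M.app p t μ) s') ∨ (m = w ∧ s = [] ∧ w ≠ []) ∨
    (w = [] ∧ M.Run 0 (fun _ => []) [])

omit [Fintype A] in
theorem Sound.of_run {p : Fin (n + 1)} {s m : List A} {μ : Fin k → List A} (h : M.Run p μ s) :
    M.Sound w p s [] m μ :=
  Or.inl ⟨s, rfl, by rwa [app_nil]⟩

omit [Fintype A] in
theorem Sound.run {p : Fin (n + 1)} {s : List A} {μ : Fin k → List A}
    (h : M.Sound w p s [] [] μ) : M.Run p μ s ∨ (w = [] ∧ M.Run 0 (fun _ => []) []) := by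
  rcases h with ⟨s', rfl, h⟩ | ⟨h, -, h'⟩ | h
  · rw [app_nil] at h; exact Or.inl h
  · exact (h' h.symm).elim
  · exact Or.inr h

/-- A flagged tuple with no unread input asserts nothing about runs from its own state. It is
harmless, because a `call` that raises the flag starts in a final state, where the empty rest is
accepted anyway. -/
theorem sound {p : Fin (n + 1)} {s e t m j : List A} {μ : Fin k → List A}
    (hd : (M.prog a₀).Derives w (symR p) (tup s e t m j μ)) : e = [] ∧ M.Sound w p s t m μ := by
  have key : ∀ {R tt}, (M.prog a₀).Derives w R tt → ∀ p s e t m j μ, R = symR p →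
      tt = tup s e t m j μ → e = [] ∧ M.Sound w p s t m μ := by
    intro R tt h
    refine derives_induction (C := fun R tt => ∀ p s e t m j μ, R = symR p →
      tt = tup s e t m j μ → e = [] ∧ M.Sound w p s t m μ) ?_ h
    clear h hd s e t m j
    intro i f hi hu hf hE ih p₀ S₀ E₀ T₀ F₀ J₀ μ hR htt
    cases i with
    | ans => simp [data] at hR
    | wbase => simp [data] at hR
    | wstep => simp [data] at hR
    | read p q a =>
      obtain rfl : p = p₀ := by simpa [data] using hR
      simp only [data, map_args, tup_inj] at htt
      obtain ⟨rfl, rfl, rfl, rfl, rfl, rfl⟩ := htt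
      simp only [data, List.forall_mem_cons, holds_emptyEq, holds_popEq] at hE
      have ih := ih _ rfl _ _ _ _ _ _ _ rfl (map_args _ _ _ _ _ _)
      have hm : (fun i => f (M.out q.succ (M.base p q) i)) =
          M.app q.succ [a] (M.exec p q fun i => f (x i)) := by
        funext i
        rw [map_out hE.2.2]
        simp only [app, map_base hE.1]
      refine ⟨hE.1, ?_⟩
      rw [hm, hE.1] at ih
      rw [hE.1, hE.2.1]
      rcases ih.2.run with h | h
      · exact .of_run (.char hi.1 hi.2 h)
      · exact Or.inr (Or.inr h)
    | dead p p' =>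
      simp only [data, List.forall_mem_cons, holds_emptyEq, holds_popEq] at hE
      simp [hE.2.1] at hE
    | loop q a =>
      obtain rfl : q.succ = p₀ := by simpa [data] using hR
      simp only [data, map_args, tup_inj] at htt
      obtain ⟨rfl, rfl, rfl, rfl, rfl, rfl⟩ := htt
      simp only [data, List.forall_mem_cons, holds_emptyEq, holds_popEq] at hE
      have ih := ih _ rfl _ _ _ _ _ _ _ rfl (map_args _ _ _ _ _ _)
      refine ⟨hE.1, ?_⟩
      have hm : (fun i => f (M.out q.succ x i)) = M.app q.succ [a] fun i => f (x i) := by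
        funext i
        rw [map_out hE.2.2.2]
      rw [hm] at ih
      rw [hE.2.1, hE.2.2.1]
      rcases ih.2 with ⟨s', h, hr⟩ | ⟨h, -, h'⟩ | h
      · rw [app_app] at hr
        exact Or.inl ⟨s', by rw [h]; rfl, hr⟩
      · rw [hE.1] at h; exact (h' h.symm).elim
      · exact Or.inr (Or.inr h)
    | accept q a =>
      simp only [data, map_args, tup_inj] at htt
      obtain ⟨rfl, rfl, rfl, rfl, rfl, rfl⟩ := htt
      simp only [data, List.forall_mem_cons, holds_emptyEq, holds_peekEq_some] at hE
      exact ⟨hE.1, Or.inr (Or.inl ⟨hu, hE.1, by simp [← hu, hE.2.1]⟩)⟩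
    | drain q a =>
      have hw := hf t (by simp [data, mem_args])
      simp only [data, map_args, tup_inj] at htt
      obtain ⟨rfl, rfl, rfl, rfl, rfl, rfl⟩ := htt
      simp only [data, List.forall_mem_cons, holds_emptyEq, holds_popEq] at hE
      refine ⟨hE.1, Or.inr (Or.inl ⟨hu, hE.1, ?_⟩)⟩
      rintro rfl
      rw [hE.2.1] at hw
      simp at hw
    | check q a =>
      obtain rfl : q.succ = p₀ := by simpa [data] using hR
      simp only [data, map_args, tup_inj] at htt
      obtain ⟨rfl, rfl, rfl, rfl, rfl, rfl⟩ := htt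
      simp only [data, List.forall_mem_cons, holds_emptyEq, holds_popEq] at hE
      have ih := ih _ rfl _ _ _ _ _ _ _ rfl (map_args _ _ _ _ _ _)
      refine ⟨hE.1, ?_⟩
      rw [hE.1] at *
      rcases ih.2.run with h | h
      · exact .of_run h
      · exact Or.inr (Or.inr h)
    | halt p =>
      simp only [data] at *
      split_ifs at * with h1 h2
      · obtain rfl : p = p₀ := by simpa using hR
        simp only [map_args, tup_inj] at htt
        obtain ⟨rfl, rfl, rfl, rfl, rfl, rfl⟩ := htt
        have ih := ih _ rfl _ _ _ _ _ _ _ rfl (map_args _ _ _ _ _ _)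
        refine ⟨ih.1, ?_⟩
        rw [ih.1]
        exact .of_run (.halt (by rw [h1.2]; exact h1.1.2.2))
      · obtain rfl : p = p₀ := by simpa using hR
        simp only [map_args, tup_inj] at htt
        obtain ⟨rfl, rfl, rfl, rfl, rfl, rfl⟩ := htt
        simp only [List.forall_mem_cons, holds_emptyEq] at hE
        refine ⟨hE.1, ?_⟩
        rw [hE.1]
        exact .of_run (.halt h2)
      · obtain rfl : p = p₀ := by simpa using hR
        simp only [map_args, tup_inj] at htt
        obtain ⟨rfl, rfl, rfl, rfl, rfl, rfl⟩ := htt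
        simp only [List.forall_mem_cons, holds_emptyEq] at hE
        exact ⟨hE.1, Or.inr (Or.inr ⟨hu.symm.trans hE.2.1, (hi.2.resolve_left h2).2⟩)⟩
    | call p q =>
      obtain rfl : p = p₀ := by simpa [data] using hR
      simp only [data, map_args, tup_inj] at htt
      obtain ⟨rfl, rfl, rfl, rfl, rfl, rfl⟩ := htt
      obtain ⟨htr, i, hlab⟩ := hi
      have ih := ih _ rfl _ _ _ _ _ _ _ rfl (map_args _ _ _ _ _ _)
      refine ⟨ih.1, ?_⟩
      have he := ih.1
      have hm : (fun i => f (M.base p q i)) = M.exec p q fun i => f (x i) := by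
        funext i
        rw [map_base he]
      have hr : f (M.recalled p q) = M.exec p q (fun i => f (x i)) i := by
        rw [recalled, hlab]
        exact map_base he _ _ _
      rw [hm, hr] at ih
      rw [he]
      rcases ih.2 with ⟨s', h, hrun⟩ | ⟨h, h', hw⟩ | h
      · rw [h]
        exact .of_run (.ref htr hlab hrun)
      -- Either this call raised the flag, at a final state, or the head was already flagged.
      · split_ifs at h with hfin
        · rw [h']
          exact .of_run (.halt hfin)
        · exact Or.inr (Or.inl ⟨h, h', hw⟩)
      · exact Or.inr (Or.inr h)
  exact key hd _ _ _ _ _ _ _ rfl rfl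

theorem language_subset (h : (M.prog a₀).Derives w none []) : M.Run 0 (fun _ => []) w := by
  obtain ⟨ρ, hρ, θ, hθ, heq, hrel⟩ : ∃ ρ ∈ (M.prog a₀).rules, ∃ θ, (M.prog a₀).IsSubst w ρ θ ∧
      ρ.headSym = none ∧ ∀ R ys, Atom.rel R ys ∈ ρ.body → (M.prog a₀).Derives w R (ys.map θ) := by
    generalize hR : (none : Sym n k) = R at h
    generalize ([] : List (List A)) = tt at h
    obtain ⟨ρ, hρ, θ, hθ, -, hrel⟩ := h
    exact ⟨ρ, hρ, θ, hθ, rfl, hrel⟩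
  obtain ⟨i, hi, rfl⟩ := mem_rules.1 hρ
  obtain rfl : i = .ans := by
    have : i.head = none := by rw [← sym_data (M := M) a₀]; exact heq
    cases i <;> simp [Idx.head] at this ⊢
  have := hrel (symR 0) _ ((PRule.rel_mem_rule _).2 (Or.inl (List.mem_singleton.2 rfl)))
  rw [List.map_map, map_args] at this
  have := sound this
  have hu : (θ ∘ vr) (u : PVar k) = w := hθ.1
  obtain ⟨he, h⟩ := this
  rw [hu, he] at h
  rcases h.run with h' | ⟨h', h''⟩
  · exact h'
  · rwa [h']

end MemAut

namespace MemAut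

variable {A : Type*} {n k : ℕ} {M : MemAut A n k}

open PVar PRule

/-! ### Completeness -/

/-- The values of the named variables. -/
def val (w s t m j s₁ t₁ z₁ : List A) (μ ν : Fin k → List A) : PVar k → List A
  | .u => w
  | .s => s
  | .e => []
  | .t => t
  | .m => m
  | .j => j
  | .s' => s₁
  | .t' => t₁
  | .z => z₁
  | .x i => μ i
  | .y i => ν i

theorem infix_val {w s t m j s₁ t₁ z₁ : List A} {μ ν : Fin k → List A} (hs : s <:+: w)
    (ht : t <:+: w) (hm : m <:+: w) (hj : j <:+: w) (hs₁ : s₁ <:+: w) (ht₁ : t₁ <:+: w)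
    (hz₁ : z₁ <:+: w) (hμ : ∀ i, μ i <:+: w) (hν : ∀ i, ν i <:+: w) (v : PVar k) :
    val w s t m j s₁ t₁ z₁ μ ν v <:+: w := by
  cases v <;> simp only [val] <;> first | assumption | apply hμ | apply hν | exact List.infix_rfl |
    exact List.nil_infix

variable [Fintype A] {a₀ : A} {w : List A}

theorem derives_of_holds {i : Idx A n k} (hi : M.Valid i) (f : PVar k → List A)
    (g : List A → List A) (hg : ∀ v, v <:+: w → g v <:+: w) (hu : f u = w) (hf : ∀ v, f v <:+: w)
    (hE : ∀ E ∈ (M.data a₀ i).eqs, Holds f E)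
    (haux : ∀ c ∈ (M.data a₀ i).aux, (M.prog a₀).Derives w c.1 (c.2.map (asg f g)))
    (htgt : ∀ c ∈ (M.data a₀ i).tgt, (M.prog a₀).Derives w c.1 (c.2.map f)) :
    (M.prog a₀).Derives w (M.data a₀ i).sym ((M.data a₀ i).hd.map f) := by
  have := Program.Derives.step (P := M.prog a₀) (w := w) _ (mem_rules.2 ⟨i, hi, rfl⟩) (asg f g)
    ⟨by rw [univ_prog, asg_vr, hu], fun v _ => asg_infix f g hf hg v⟩
    ((PRule.satEqns_rule _).2 (by simpa using hE)) (by
      intro R ys h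
      rcases (PRule.rel_mem_rule _).1 h with h | ⟨c, hc, rfl, rfl⟩
      · exact haux _ h
      · simpa [Function.comp_def] using htgt c hc)
  simpa [PRule.rule, Function.comp_def] using this

theorem derives_symW (i : Fin k) {v v' v'' : List A} (hw : w = v ++ v' ++ v'') :
    (M.prog a₀).Derives w (symW i) [v', v' ++ v''] := by
  induction v' generalizing v with
  | nil =>
    have h1 : v <:+: w := ⟨[], v'', by simp [hw]⟩
    have h2 : v'' <:+: w := ⟨v, [], by simp [hw]⟩
    exact derives_of_holds (i := .wbase i) trivial
      (val w [] v'' [] [] [] [] v (fun _ => []) fun _ => []) (fun _ => []) (by simp) rfl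
      (infix_val (by simp) h2 (by simp) (by simp) (by simp) (by simp) h1 (by simp) (by simp))
      (by simp [data, val, hw]) (by simp [data]) (by simp [data])
  | cons a v' ih =>
    have ih := ih (v := v ++ [a]) (by simp [hw])
    have h1 : a :: v' <:+: w := ⟨v, v'', by simp [hw]⟩
    have h2 : a :: (v' ++ v'') <:+: w := ⟨v, [], by simp [hw]⟩
    have h3 : v' <:+: w := ⟨v ++ [a], v'', by simp [hw]⟩
    have h4 : v' ++ v'' <:+: w := ⟨v ++ [a], [], by simp [hw]⟩
    exact derives_of_holds (i := .wstep i a) trivial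
      (val w (a :: v') (a :: (v' ++ v'')) [] [] v' (v' ++ v'') [] (fun _ => []) fun _ => [])
      (fun _ => []) (by simp) rfl
      (infix_val h1 h2 (by simp) (by simp) h3 h4 (by simp) (by simp) (by simp))
      (by simp [data, val]) (by simp [data])
      (by simpa [data, val] using ih)

/-- The companion is chosen as a function of the word alone, so one substitution `asg f g` satisfies
all guards of a rule. -/
theorem exists_suffix (w : List A) : ∃ g : List A → List A, (∀ v, v <:+: w → g v <:+: w) ∧
    ∀ v, v <:+: w → ∀ i, (M.prog a₀).Derives w (symW i) [v, g v] := by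
  have h : ∀ v : List A, ∃ v' : List A, v <:+: w → v' <:+: w ∧
      ∀ i, (M.prog a₀).Derives w (symW i) [v, v'] := by
    intro v
    by_cases hv : v <:+: w
    · obtain ⟨v₁, v₂, rfl⟩ := hv
      exact ⟨v ++ v₂, fun _ => ⟨⟨v₁, [], by simp⟩, fun i => derives_symW i rfl⟩⟩
    · exact ⟨[], fun h => (hv h).elim⟩
  choose g hg using h
  exact ⟨g, fun v hv => (hg v hv).1, fun v hv => (hg v hv).2⟩

theorem derives_of_guards {i : Idx A n k} (hi : M.Valid i) (f : PVar k → List A) (hu : f u = w)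
    (hf : ∀ v, f v <:+: w) (hE : ∀ E ∈ (M.data a₀ i).eqs, Holds f E)
    (haux : (M.data a₀ i).aux = guards (M.data a₀ i).hd)
    (htgt : ∀ c ∈ (M.data a₀ i).tgt, (M.prog a₀).Derives w c.1 (c.2.map f)) :
    (M.prog a₀).Derives w (M.data a₀ i).sym ((M.data a₀ i).hd.map f) := by
  obtain ⟨g, hg, hd⟩ := exists_suffix (M := M) (a₀ := a₀) w
  refine derives_of_holds hi f g hg hu hf hE ?_ htgt
  intro c hc
  rw [haux] at hc
  obtain ⟨v, -, i, rfl⟩ := mem_guards.1 hc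
  simpa using hd _ (hf v) i

/-- The tuple belongs to the relation of the state. -/
def Der (M : MemAut A n k) (a₀ : A) (w : List A) (p : Fin (n + 1)) (s t m j : List A)
    (μ : Fin k → List A) : Prop :=
  (M.prog a₀).Derives w (symR p) (tup s [] t m j μ)

variable {s t m j : List A} {μ : Fin k → List A} {p : Fin (n + 1)} {q : Fin n} {a : A}

omit [Fintype A] in
theorem val_mvar {z₁ s₁ t₁ : List A} {ν : Fin k → List A} (h : M.IsRec p ∨ m = []) :
    val w s t m j s₁ t₁ z₁ μ ν (M.mvar p) = m := by
  unfold mvar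
  split_ifs with hp
  · rfl
  · exact (h.resolve_left hp).symm

omit [Fintype A] in
theorem val_jvar {z₁ s₁ t₁ : List A} {ν : Fin k → List A} (h : M.IsRec p ∨ j = []) :
    val w s t m j s₁ t₁ z₁ μ ν (M.jvar p) = j := by
  unfold jvar
  split_ifs with hp
  · rfl
  · exact (h.resolve_left hp).symm

theorem Der.read (h : M.tr p q) (hq : M.lab q = Sum.inl a) (hs : a :: s <:+: w) (hm : m <:+: w)
    (hj : j <:+: w) (hμ : ∀ i, μ i <:+: w) (hν : ∀ i, M.app q.succ [a] (M.exec p q μ) i <:+: w)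
    (hm' : M.IsRec p ∨ m = []) (hj' : M.IsRec p ∨ j = [])
    (hd : M.Der a₀ w q.succ s [] [] [] (M.app q.succ [a] (M.exec p q μ))) :
    M.Der a₀ w p (a :: s) [] m j μ := by
  set f := val w (a :: s) [] m j s [] [] μ (M.app q.succ [a] (M.exec p q μ)) with hf
  have hb : ∀ i, f (M.base p q i) = M.exec p q μ i := fun i => map_base (f := f) rfl p q i
  have := derives_of_guards (M := M) (a₀ := a₀) (i := .read p q a) ⟨h, hq⟩ f rfl
    (infix_val hs (by simp) hm hj ((List.suffix_cons a s).isInfix.trans hs) (by simp) (by simp)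
      hμ hν) ?_ rfl ?_
  · simp only [data, map_args] at this
    rwa [hf, val_mvar hm', val_jvar hj'] at this
  · simp only [data, List.forall_mem_cons, holds_emptyEq, holds_popEq]
    refine ⟨rfl, rfl, ?_⟩
    intro E hE
    obtain ⟨i, hi, rfl⟩ := mem_appEqs.1 hE
    rw [holds_pushEq, hb]
    simp [hf, val, app, hi]
  · simp only [data, Option.mem_def, Option.some.injEq, forall_eq', map_args]
    have hout : (fun i => f (M.out q.succ (M.base p q) i)) = M.app q.succ [a] (M.exec p q μ) := by
      funext i
      simp only [out]
      split_ifs with hi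
      · rfl
      · rw [hb]; simp [app, hi]
    rw [hout]
    exact hd

theorem Der.loop (hq : M.Target q) (ha : M.IsLetter a) (hs : a :: s <:+: w) (ht : a :: t <:+: w)
    (hm : m <:+: w) (hj : j <:+: w) (hμ : ∀ i, μ i <:+: w) (hν : ∀ i, M.app q.succ [a] μ i <:+: w)
    (hd : M.Der a₀ w q.succ s t [] [] (M.app q.succ [a] μ)) :
    M.Der a₀ w q.succ (a :: s) (a :: t) m j μ := by
  set f := val w (a :: s) (a :: t) m j s t [] μ (M.app q.succ [a] μ) with hf
  have := derives_of_guards (M := M) (a₀ := a₀) (i := .loop q a) ⟨hq, ha⟩ f rfl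
    (infix_val hs ht hm hj ((List.suffix_cons a s).isInfix.trans hs)
      ((List.suffix_cons a t).isInfix.trans ht) (by simp) hμ hν) ?_ rfl ?_
  · simp only [data, map_args] at this
    exact this
  · simp only [data, List.forall_mem_cons, holds_emptyEq, holds_popEq]
    refine ⟨rfl, rfl, rfl, ?_⟩
    intro E hE
    obtain ⟨i, hi, rfl⟩ := mem_appEqs.1 hE
    rw [holds_pushEq]
    simp [hf, val, app, hi]
  · simp only [data, Option.mem_def, Option.some.injEq, forall_eq', map_args]
    have hout : (fun i => f (M.out q.succ x i)) = M.app q.succ [a] μ := by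
      funext i
      simp only [out]
      split_ifs with hi
      · rfl
      · simp [app, hi, hf, val]
    rw [hout]
    exact hd

theorem Der.accept (hq : M.Target q) (ha : M.IsLetter a) (h : M.Star q.succ ∨ ¬ M.Calls q.succ)
    {v : List A} (hw : w = v ++ [a]) (ht : t <:+: w) (hj : j <:+: w) (hμ : ∀ i, μ i <:+: w) :
    M.Der a₀ w q.succ [] t w j μ := by
  have := derives_of_guards (M := M) (a₀ := a₀) (i := .accept q a) ⟨hq, ha, h⟩
    (val w [] t [] j [] [] v μ μ) rfl
    (infix_val (by simp) ht (by simp) hj (by simp) (by simp) ⟨[], [a], by simp [hw]⟩ hμ hμ)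
    (by simp [data, val, hw]) rfl (by simp [data])
  simp only [data, map_args] at this
  exact this

theorem Der.drain (hq : M.Target q) (ha : M.IsLetter a) (h : ¬ M.Star q.succ) (hc : M.Calls q.succ)
    (ht : a :: t <:+: w) (hj : j <:+: w) (hμ : ∀ i, μ i <:+: w)
    (hd : M.Der a₀ w q.succ [] t w j μ) : M.Der a₀ w q.succ [] (a :: t) w j μ := by
  have := derives_of_guards (M := M) (a₀ := a₀) (i := .drain q a) ⟨hq, ha, h, hc⟩
    (val w [] (a :: t) [] j [] t [] μ μ) rfl
    (infix_val (by simp) ht (by simp) hj (by simp) ((List.suffix_cons a t).isInfix.trans ht)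
      (by simp) hμ hμ)
    (by simp [data, val]) rfl ?_
  · simp only [data, map_args] at this
    exact this
  · simp only [data, Option.mem_def, Option.some.injEq, forall_eq', map_args]
    exact hd

theorem Der.check (hq : M.Target q) (ha : M.IsLetter a) (h : M.Star q.succ) (hc : M.Calls q.succ)
    (hs : a :: s <:+: w) (hj : j <:+: w) (hμ : ∀ i, μ i <:+: w)
    (hd : M.Der a₀ w q.succ (a :: s) [] [] s μ) : M.Der a₀ w q.succ (a :: s) [] w j μ := by
  have := derives_of_guards (M := M) (a₀ := a₀) (i := .check q a) ⟨hq, ha, h, hc⟩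
    (val w (a :: s) [] [] j s [] [] μ μ) rfl
    (infix_val hs (by simp) (by simp) hj ((List.suffix_cons a s).isInfix.trans hs) (by simp)
      (by simp) hμ hμ)
    (by simp [data, val]) rfl ?_
  · simp only [data, map_args] at this
    exact this
  · simp only [data, Option.mem_def, Option.some.injEq, forall_eq', map_args]
    exact hd

theorem Der.halt (hn : n ≠ 0) (h : ¬ M.Calls p)
    (hfin : M.fin p ∨ (w = [] ∧ M.Calls 0 ∧ M.Run 0 (fun _ => []) [])) (hj : j <:+: w)
    (hj' : M.IsRec p ∨ j = []) (hμ : ∀ i, μ i <:+: w) : M.Der a₀ w p [] [] [] j μ := by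
  have hv : M.Valid (.halt p : Idx A n k) := ⟨h, hfin.imp_right And.right⟩
  have key : ∀ {p : Fin (n + 1)} {j : List A}, j <:+: w → (M.IsRec p ∨ j = []) →
      M.Valid (.halt p : Idx A n k) → ¬ (M.Hub ∧ p = Fin.last n) → (M.fin p ∨ w = []) →
      M.Der a₀ w p [] [] [] j μ := by
    intro p j hj hj' hv hub hfin
    have := derives_of_guards (M := M) (a₀ := a₀) (i := .halt p) hv
      (val w [] [] [] j [] [] [] μ μ) rfl
      (infix_val (by simp) (by simp) (by simp) hj (by simp) (by simp) (by simp) hμ hμ) ?_ ?_ ?_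
    · simp only [data, hub, if_false, map_args, val_jvar hj'] at this
      exact this
    · by_cases hp : M.fin p
      · simp [data, hub, hp, val]
      · simp [data, hub, hp, val, hfin.resolve_left hp]
    · simp [data, hub]
    · simp [data, hub]
  -- For a hub the tuple is obtained from the state `0`, whose halting rule is the plain one because
  -- `n ≠ 0` separates it from the last state.
  by_cases hub : M.Hub ∧ p = Fin.last n
  · have h0 : M.Der a₀ w 0 [] [] [] [] μ := by
      refine key (by simp) (Or.inr rfl) ⟨hub.1.not_calls 0, Or.inl hub.1.2.1⟩ ?_ (Or.inl hub.1.2.1)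
      rintro ⟨-, h⟩
      exact hn (by simpa using (congrArg Fin.val h).symm)
    have := derives_of_guards (M := M) (a₀ := a₀) (i := .halt p) hv
      (val w [] [] [] j [] [] [] μ μ) rfl
      (infix_val (by simp) (by simp) (by simp) hj (by simp) (by simp) (by simp) hμ hμ) ?_ ?_ ?_
    · rw [data, if_pos hub] at this
      simp only [map_args, val_jvar hj'] at this
      exact this
    · rw [data, if_pos hub]; simp
    · rw [data, if_pos hub]
    · rw [data, if_pos hub]
      simp only [Option.mem_def, Option.some.injEq, forall_eq', map_args]
      exact h0
  · exact key hj hj' hv hub (hfin.imp_right And.left)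

theorem Der.call {i : Fin k} (h : M.tr p q) (hq : M.lab q = Sum.inr i) (hs : s <:+: w)
    (hm : m <:+: w) (hj : j <:+: w) (hμ : ∀ i, μ i <:+: w)
    (hm' : (M.IsRec p ∧ ¬ M.Star p) ∨ m = []) (hj' : M.IsRec p ∨ j = [])
    (hd : M.Der a₀ w q.succ s (M.exec p q μ i) (open Classical in if M.fin p then w else m) []
      (M.exec p q μ)) :
    M.Der a₀ w p s [] m j μ := by
  set f := val w s [] m j [] [] [] μ μ with hf
  have hb : ∀ i, f (M.base p q i) = M.exec p q μ i := fun i => map_base (f := f) rfl p q i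
  have hc : f (M.cvar p) = m := by
    unfold cvar
    split_ifs with hp
    · rfl
    · exact (hm'.resolve_left hp).symm
  have := derives_of_guards (M := M) (a₀ := a₀) (i := .call p q) ⟨h, i, hq⟩ f rfl
    (infix_val hs (by simp) hm hj (by simp) (by simp) (by simp) hμ hμ) (by simp [data]) rfl ?_
  · simp only [data, map_args, hc] at this
    rwa [hf, val_jvar hj'] at this
  · simp only [data, Option.mem_def, Option.some.injEq, forall_eq', map_args]
    have h1 : f (M.recalled p q) = M.exec p q μ i := by
      rw [recalled, hq]; exact hb i
    rw [h1]
    simp only [hb, apply_ite f, hc]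
    exact hd

end MemAut

-- From accepting runs to derivations

namespace MemAut

variable {A : Type*} {n k : ℕ} {M : MemAut A n k}

/-- The state is initial or the target of a transition. -/
def Entered (M : MemAut A n k) (p : Fin (n + 1)) : Prop := ∀ q : Fin n, p = q.succ → ∃ p', M.tr p' q

theorem entered_zero : M.Entered 0 := fun q h => (Fin.succ_ne_zero q h.symm).elim

theorem entered_succ {p : Fin (n + 1)} {q : Fin n} (h : M.tr p q) : M.Entered q.succ := by
  intro q' hq
  rw [← Fin.succ_injective n hq]
  exact ⟨p, h⟩

theorem IsRec.exists_target {p : Fin (n + 1)} (h : M.IsRec p) (hp : M.Entered p) :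
    ∃ q, p = q.succ ∧ M.Target q := by
  obtain ⟨q, i, rfl, hi⟩ := h
  exact ⟨q, rfl, ⟨i, hi⟩, hp q rfl⟩

/-- The memory contents are factors of `w`, and those of open memories are suffixes of `v`. -/
structure Inv (M : MemAut A n k) (w v : List A) (p : Fin (n + 1)) (μ : Fin k → List A) : Prop where
  infix_of : ∀ i, μ i <:+: w
  suffix_of : ∀ i, M.op p i = true → μ i <:+ v

variable {w v : List A} {p : Fin (n + 1)} {μ : Fin k → List A}

/-- A factor need not remain a factor when it is extended. An open memory does, because it is a
suffix of the part of the input already read. -/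
theorem Inv.app {v' s : List A} (h : M.Inv w v p μ) (hw : w = v ++ v' ++ s) :
    M.Inv w (v ++ v') p (M.app p v' μ) := by
  have key : ∀ i, M.op p i = true → M.app p v' μ i <:+ v ++ v' := by
    intro i hi
    obtain ⟨v'', hv⟩ := h.suffix_of i hi
    exact ⟨v'', by simp [MemAut.app, hi, ← hv]⟩
  refine ⟨fun i => ?_, key⟩
  by_cases hi : M.op p i
  · exact (key i hi).isInfix.trans ⟨[], s, by simp [hw]⟩
  · simpa [MemAut.app, hi] using h.infix_of i

theorem Inv.exec {q : Fin n} (h : M.Inv w v p μ) (ht : M.tr p q) :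
    M.Inv w v q.succ (M.exec p q μ) := by
  refine ⟨fun i => ?_, fun i hi => ?_⟩
  · have := h.infix_of i
    simp only [MemAut.exec]
    cases M.ins p q i <;> simp [MemInstr.eff, this]
  · have := h.suffix_of i
    rw [M.op_succ ht] at hi
    simp only [MemAut.exec]
    cases hq : M.ins p q i <;> simp_all [MemInstr.eff, MemInstr.status]

/-- Memories receive only letters that were read. So `loop`, `accept`, `drain` and `check` are
needed only for letters that label an occurrence, which keeps their number independent of the
alphabet. -/
theorem Run.isLetter {s : List A} (h : M.Run p μ s) (hμ : ∀ i, ∀ a ∈ μ i, M.IsLetter a) :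
    ∀ a ∈ s, M.IsLetter a := by
  have hexec : ∀ {p q} {μ : Fin k → List A}, (∀ i, ∀ a ∈ μ i, M.IsLetter a) →
      ∀ i, ∀ a ∈ M.exec p q μ i, M.IsLetter a := by
    intro p q μ hμ i a ha
    simp only [MemAut.exec] at ha
    cases hq : M.ins p q i <;> rw [hq] at ha <;> simp only [MemInstr.eff, List.not_mem_nil] at ha <;>
      exact hμ i a ha
  have happ : ∀ {p v} {μ : Fin k → List A}, (∀ i, ∀ a ∈ μ i, M.IsLetter a) →
      (∀ a ∈ v, M.IsLetter a) → ∀ i, ∀ a ∈ M.app p v μ i, M.IsLetter a := by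
    intro p v μ hμ hv i a ha
    simp only [MemAut.app] at ha
    split_ifs at ha
    · rcases List.mem_append.1 ha with ha | ha
      · exact hμ i a ha
      · exact hv a ha
    · exact hμ i a ha
  induction h with
  | halt => simp
  | char ht hq hr ih =>
    have ha : M.IsLetter _ := ⟨_, hq⟩
    simp only [List.mem_cons, forall_eq_or_imp]
    exact ⟨ha, ih (happ (hexec hμ) (by simpa using ha))⟩
  | ref ht hq hr ih =>
    simp only [List.mem_append]
    rintro a (ha | ha)
    · exact hexec hμ _ a ha
    · exact ih (happ (hexec hμ) (hexec hμ _)) a ha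

variable [Fintype A] {a₀ : A}

/-- The flag and the auxiliary word are arbitrary on entry, but empty after the first letter; both
are therefore quantified in the hypothesis and in the conclusion. -/
theorem der_loop {q : Fin n} (hq : M.Target q) (hL : ∀ a ∈ w, M.IsLetter a) {s : List A}
    (t : List A) : ∀ {v : List A} {μ : Fin k → List A}, M.Inv w v q.succ μ → w = v ++ t ++ s →
    (∀ m j, m = [] ∨ m = w → j <:+: w → M.Der a₀ w q.succ s [] m j (M.app q.succ t μ)) →
    ∀ m j, m = [] ∨ m = w → j <:+: w → M.Der a₀ w q.succ (t ++ s) t m j μ := by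
  induction t with
  | nil => intro v μ _ _ h; simpa [app_nil] using h
  | cons a t ih =>
    intro v μ hinv hw h m j hm hj
    have hinv' := hinv.app (v' := [a]) (s := t ++ s) (by simp [hw])
    refine Der.loop hq (hL a (by simp [hw])) ⟨v, [], by simp [hw]⟩ ⟨v, s, by simp [hw]⟩ ?_ hj
      hinv.infix_of hinv'.infix_of ?_
    · rcases hm with rfl | rfl
      · exact List.nil_infix
      · exact List.infix_rfl
    · refine ih hinv' (by simp [hw]) ?_ _ _ (Or.inl rfl) List.nil_infix
      rw [app_app]
      exact h

/-- With raised flag and no input left, the contents of `t` and of the memories are irrelevant. A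
state in `Star`, or one that is not left by a recall, accepts. Any other state drains `t` and hands
the flag to its successor; if this is not in `Star`, it is farther from the initial state, and the
induction on the remaining distance applies. -/
theorem der_coast (hw : w ≠ []) (hL : ∀ a ∈ w, M.IsLetter a) (hrec : M.IsRec p)
    (hp : M.Entered p) {t j : List A} (ht : t <:+: w) (hj : j <:+: w) (hμ : ∀ i, μ i <:+: w) :
    M.Der a₀ w p [] t w j μ := by
  generalize hd : Finset.univ.sup M.depth - M.depth p = d
  induction d using Nat.strong_induction_on generalizing p t j μ with
  | _ d ih =>
    obtain ⟨q, rfl, hq⟩ := hrec.exists_target hp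
    by_cases h : M.Star q.succ ∨ ¬ M.Calls q.succ
    · have hl : w = w.dropLast ++ [w.getLast hw] := (List.dropLast_append_getLast hw).symm
      exact Der.accept hq (hL _ (List.getLast_mem hw)) h hl ht hj hμ
    · push Not at h
      obtain ⟨hs, hc⟩ := h
      induction t with
      | cons a t iht =>
        exact Der.drain hq (hL a (ht.subset (by simp))) hs hc ht hj hμ
          (iht ((List.suffix_cons a t).isInfix.trans ht))
      | nil =>
        obtain ⟨q', i, htr, hi⟩ := hc
        have hexec : ∀ i, M.exec q.succ q' μ i <:+: w := by
          intro i
          simp only [exec]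
          cases M.ins q.succ q' i <;> simp [MemInstr.eff, hμ i]
        refine Der.call htr hi List.nil_infix List.infix_rfl hj hμ (Or.inl ⟨hrec, hs⟩)
          (Or.inl hrec) ?_
        rw [ite_self]
        have hrec' : M.IsRec q'.succ := ⟨q', i, rfl, hi⟩
        by_cases hs' : M.Star q'.succ
        · have hl : w = w.dropLast ++ [w.getLast hw] := (List.dropLast_append_getLast hw).symm
          exact Der.accept ⟨⟨i, hi⟩, _, htr⟩ (hL _ (List.getLast_mem hw)) (Or.inl hs') hl
            (hexec i) List.nil_infix hexec
        · have hlt : M.depth q.succ < M.depth q'.succ := by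
            by_contra hle
            exact hs' ⟨q', _, rfl, htr, not_lt.1 hle⟩
          have hle : M.depth q'.succ ≤ Finset.univ.sup M.depth :=
            Finset.le_sup (f := M.depth) (Finset.mem_univ _)
          exact ih _ (by omega) hrec' (entered_succ htr) (hexec i) List.nil_infix hexec rfl

theorem der_of_run (hw : w ≠ []) (hn : n ≠ 0) (hL : ∀ a ∈ w, M.IsLetter a) {s : List A}
    (h : M.Run p μ s) : ∀ {v}, M.Inv w v p μ → w = v ++ s → M.Entered p → ∀ m j,
      m = [] ∨ m = w → j <:+: w → (M.IsRec p ∨ m = []) → (M.IsRec p ∨ j = []) →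
      M.Der a₀ w p s [] m j μ := by
  have hinf : ∀ {m : List A}, m = [] ∨ m = w → m <:+: w := by
    rintro m (rfl | rfl)
    · exact List.nil_infix
    · exact List.infix_rfl
  induction h with
  | @halt p μ hfin =>
    intro v hinv hv hp m j hm hj hm' hj'
    by_cases hmw : m = w
    · subst hmw
      exact der_coast hw hL (hm'.resolve_right hw) hp List.nil_infix hj hinv.infix_of
    · obtain rfl := hm.resolve_right hmw
      -- A final state that is left by a recall has no halting rule: the recall raises the flag, and
      -- the rest is coasting.
      by_cases hc : M.Calls p
      · obtain ⟨q, i, htr, hi⟩ := hc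
        have he := hinv.exec htr
        refine Der.call htr hi List.nil_infix List.nil_infix hj hinv.infix_of (Or.inr rfl) hj' ?_
        rw [if_pos hfin]
        exact der_coast hw hL ⟨q, i, rfl, hi⟩ (entered_succ htr) (he.infix_of i) List.nil_infix
          he.infix_of
      · exact Der.halt hn hc (Or.inl hfin) hj hj' hinv.infix_of
  | @char p μ q a s htr hq hr ih =>
    intro v hinv hv hp m j hm hj hm' hj'
    have he := (hinv.exec htr).app (v' := [a]) (s := s) (by simp [hv])
    exact Der.read htr hq ⟨v, [], by simp [hv]⟩ (hinf hm) hj hinv.infix_of he.infix_of hm' hj'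
      (ih he (by simp [hv]) (entered_succ htr) _ _ (Or.inl rfl) List.nil_infix (Or.inr rfl)
        (Or.inr rfl))
  | @ref p μ q i s htr hq hr ih =>
    intro v hinv hv hp
    have he := hinv.exec htr
    have ha := he.app (v' := M.exec p q μ i) (s := s) (by simp [hv])
    have hrec : M.IsRec q.succ := ⟨q, i, rfl, hq⟩
    have hcalls : M.Calls p := ⟨q, i, htr, hq⟩
    have hs : M.exec p q μ i ++ s <:+: w := ⟨v, [], by simp [hv]⟩
    have main : ∀ m j, m = [] ∨ m = w → j <:+: w → (M.IsRec p ∧ ¬ M.Star p) ∨ m = [] →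
        (M.IsRec p ∨ j = []) → M.Der a₀ w p (M.exec p q μ i ++ s) [] m j μ := by
      intro m j hm hj hm' hj'
      refine Der.call htr hq hs (hinf hm) hj hinv.infix_of hm' hj' ?_
      refine der_loop ⟨⟨i, hq⟩, _, htr⟩ hL _ he (by simp [hv]) ?_ _ _ ?_ List.nil_infix
      · intro m j hm hj
        exact ih ha (by simp [hv]) (entered_succ htr) m j hm hj (Or.inl hrec) (Or.inl hrec)
      · split_ifs
        · exact Or.inr rfl
        · exact hm
    intro m j hm hj hm' hj'
    by_cases hm0 : m = []
    · exact main m j hm hj (Or.inr hm0) hj'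
    · have hrp := hm'.resolve_right hm0
      -- In `Star`, a raised flag blocks `call`. If input is left, `check` lowers the flag first;
      -- otherwise the tuple coasts.
      by_cases hst : M.Star p
      · obtain rfl := hm.resolve_left hm0
        rcases hws : M.exec p q μ i ++ s with _ | ⟨a, s'⟩
        · exact der_coast hw hL hrp hp List.nil_infix hj hinv.infix_of
        · obtain ⟨q₀, rfl, hq₀⟩ := hrp.exists_target hp
          rw [hws] at hs
          refine Der.check hq₀ (hL a (hs.subset (by simp))) hst hcalls hs hj hinv.infix_of ?_
          rw [← hws]
          exact main [] s' (Or.inl rfl) ((List.suffix_cons a s').isInfix.trans hs) (Or.inr rfl)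
            (Or.inl ⟨q₀, hq₀.1.choose, rfl, hq₀.1.choose_spec⟩)
      · exact main m j hm hj (Or.inl ⟨hrp, hst⟩) hj'

/-- On the empty input all memories stay empty, so the derivation can follow a run on some nonempty
word up to its first letter. The state reached there is not left by a recall and has a halting rule.
Without such a run, the chain of recalls might be an endless cycle. -/
theorem der_nil (hn : n ≠ 0) (h0 : M.Calls 0) (hr0 : M.Run 0 (fun _ => []) []) {s : List A}
    (h : M.Run p μ s) (hs : s ≠ []) (hμ : μ = fun _ => []) :
    M.Der a₀ [] p [] [] [] [] μ := by
  have hexec : ∀ {p q}, M.exec p q (fun _ => []) = fun _ => [] := by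
    intro p q
    funext i
    simp only [exec]
    cases M.ins p q i <;> rfl
  induction h with
  | halt => exact (hs rfl).elim
  | char htr hq hr ih =>
    subst hμ
    exact Der.halt hn (fun hc => hc.not_read htr hq) (Or.inr ⟨rfl, h0, hr0⟩) List.nil_infix
      (Or.inr rfl) (by simp)
  | ref htr hq hr ih =>
    subst hμ
    refine Der.call htr hq List.nil_infix List.nil_infix List.nil_infix (by simp) (Or.inr rfl)
      (Or.inr rfl) ?_
    rw [ite_self, hexec]
    simp only [hexec, app_nil, List.nil_append] at ih hs
    exact ih hs trivial

theorem derives_none (h : M.Der a₀ w 0 w [] [] [] fun _ => []) : (M.prog a₀).Derives w none [] := by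
  refine derives_of_holds (i := .ans) trivial
    (val w [] [] [] [] [] [] [] (fun _ => []) fun _ => []) (fun _ => []) (by simp) rfl
    (infix_val (by simp) (by simp) (by simp) (by simp) (by simp) (by simp) (by simp) (by simp)
      (by simp)) (by simp [data]) ?_ (by simp [data])
  simp only [data, List.mem_singleton, forall_eq, List.map_map]
  rw [map_args]
  simpa [val, Der] using h

omit [Fintype A] in
theorem ne_zero_of_run (hw : w ≠ []) (h : M.Run p μ w) : n ≠ 0 := by
  rintro rfl
  cases h with
  | halt => exact hw rfl
  | @char _ _ q => exact q.elim0
  | @ref _ _ q => exact q.elim0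

theorem language_prog {w₀ : List A} (hw₀ : w₀ ≠ []) (h₀ : M.Run 0 (fun _ => []) w₀) :
    (M.prog a₀).language = M.language := by
  have hn : n ≠ 0 := ne_zero_of_run hw₀ h₀
  ext w
  refine ⟨language_subset, fun h => derives_none ?_⟩
  have h : M.Run 0 (fun _ => []) w := h
  by_cases hw : w = []
  · subst hw
    by_cases hc : M.Calls 0
    · exact der_nil hn hc h h₀ hw₀ rfl
    · have hfin : M.fin 0 := by
        have key : ∀ {μ s}, M.Run 0 μ s → s = [] → M.fin 0 := by
          intro μ s h hs
          cases h with
          | halt hfin => exact hfin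
          | char => simp at hs
          | ref htr hq => exact (hc ⟨_, _, htr, hq⟩).elim
        exact key h rfl
      exact Der.halt hn hc (Or.inl hfin) List.nil_infix (Or.inr rfl) (by simp)
  · exact der_of_run hw hn (h.isLetter (by simp)) h (v := []) ⟨by simp, by simp⟩ rfl entered_zero
      _ _ (Or.inl rfl) List.nil_infix (Or.inr rfl) (Or.inr rfl)

end MemAut

namespace MemAut

variable {A : Type*} {n k : ℕ} {M : MemAut A n k}

/-! ### The number of rules -/

/-- The last step of a shortest path to `q.succ`; such a path exists because `p` is reachable. -/
theorem exists_depth_lt {p : Fin (n + 1)} {q : Fin n} (h : M.tr p q) :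
    ∃ p', M.tr p' q ∧ M.depth p' < M.depth q.succ := by
  have hne : {l | MemPath M.tr l q.succ}.Nonempty := by
    obtain ⟨l, hl⟩ := M.reach h
    exact ⟨l + 1, hl.succ h⟩
  have key : ∀ {l p}, MemPath M.tr l p → p = q.succ → ∃ p', M.tr p' q ∧ M.depth p' < l := by
    intro l p hp heq
    cases hp with
    | zero => exact (Fin.succ_ne_zero q heq.symm).elim
    | succ hp ht =>
      rw [Fin.succ_injective n heq] at ht
      exact ⟨_, ht, Nat.lt_succ_of_le (Nat.sInf_le hp)⟩
  exact key (Nat.sInf_mem hne) rfl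

open Classical in
/-- The transitions that are recalls. -/
noncomputable def callSet (M : MemAut A n k) : Finset (Fin (n + 1) × Fin n) :=
  {x | M.tr x.1 x.2 ∧ ∃ i, M.lab x.2 = Sum.inr i}

open Classical in
/-- The targets of the transitions that are recalls. -/
noncomputable def targetSet (M : MemAut A n k) : Finset (Fin n) := {q | M.Target q}

-- A recall is the only transition that leaves its source, so the projection to the source is
-- injective.
open Classical in
theorem card_callSet_le : M.callSet.card ≤ (Finset.univ.filter fun p => M.Calls p).card := by
  refine Finset.card_le_card_of_injOn Prod.fst ?_ ?_
  · rintro ⟨p, q⟩ h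
    obtain ⟨h, i, hi⟩ : M.tr p q ∧ ∃ i, M.lab q = Sum.inr i := by simpa [callSet] using h
    simpa using ⟨q, i, h, hi⟩
  · rintro ⟨p, q⟩ h ⟨p', q'⟩ h' (rfl : p = p')
    obtain ⟨h, i, hi⟩ : M.tr p q ∧ ∃ i, M.lab q = Sum.inr i := by simpa [callSet] using h
    obtain ⟨h', -⟩ : M.tr p q' ∧ ∃ i, M.lab q' = Sum.inr i := by simpa [callSet] using h'
    rw [Calls.unique h hi h']

-- Every target is entered from a state closer to the initial state. If it is in `Star`, it is also
-- entered from one at least as far away as itself, so its fibre has two elements.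
open Classical in
theorem card_targetSet_add_le : M.targetSet.card +
    (M.targetSet.filter fun q => M.Star q.succ).card ≤ M.callSet.card := by
  rw [Finset.card_eq_sum_card_fiberwise (f := Prod.snd) (s := M.callSet) (t := M.targetSet),
    Finset.card_filter, Finset.card_eq_sum_ones, ← Finset.sum_add_distrib]
  · refine Finset.sum_le_sum fun q hq => ?_
    obtain ⟨hi, p, hp⟩ : M.Target q := by simpa [targetSet] using hq
    obtain ⟨p', hp', hlt⟩ := exists_depth_lt hp
    have hmem : ∀ {p}, M.tr p q → (p, q) ∈ M.callSet.filter fun x => x.2 = q := by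
      intro p hp
      simp [callSet, hp, hi]
    split_ifs with hs
    · obtain ⟨q', p'', hq', hp'', hle⟩ := hs
      obtain rfl := Fin.succ_injective n hq'
      refine Finset.one_lt_card.2 ⟨_, hmem hp', _, hmem hp'', fun h => ?_⟩
      obtain rfl : p' = p'' := congrArg Prod.fst h
      omega
    · exact Finset.card_pos.2 ⟨_, hmem hp⟩
  · rintro ⟨p, q⟩ h
    obtain ⟨h, hi⟩ : M.tr p q ∧ ∃ i, M.lab q = Sum.inr i := by simpa [callSet] using h
    simpa [targetSet] using ⟨hi, p, h⟩

/-- A bound for the number of rules for states, in terms of the numbers `c` of terminals, `r` of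
recalls, `N` of states that recall no memory, `E` of states that recall a memory, `d` of such
transitions, `ρ` of their targets and `σ` of targets that need to check for the end of the input. -/
theorem count_aux {c r n N E d ρ σ l : ℕ} (hn : c + r = n) (hN : N + E = n + 1) (hE : d ≤ E)
    (hd : ρ + σ ≤ d) (hl : l ≤ c) (hρ : ρ ≤ r) (hr : r ≠ 0) :
    N * c + (n + 1) + ρ * l + ρ * l + σ * l + N + d ≤ n * (n + 3) := by
  have h1 : ρ * l ≤ ρ * c := Nat.mul_le_mul_left _ hl
  have h2 : σ * l ≤ σ * c := Nat.mul_le_mul_left _ hl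
  have h3 : (ρ + σ) * c ≤ E * c := Nat.mul_le_mul_right _ (hd.trans hE)
  have h4 : ρ * c ≤ r * c := Nat.mul_le_mul_right _ hρ
  have h5 : (N + E) * c = (n + 1) * c := by rw [hN]
  have h6 : 1 ≤ r * r := Nat.one_le_iff_ne_zero.2 (by simp [hr])
  have h7 : 1 ≤ r := Nat.one_le_iff_ne_zero.2 hr
  subst hn
  -- The left side is at most `(n + 1) * c + r * c + 2 * (n + 1)`. With `c = n - r` this equals `n *
  -- (n + 3) + 2 - r - r * r`, so one recall suffices.
  nlinarith

variable [Fintype A] {a₀ : A}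

-- With recalls, the bound is `count_aux`. Without recalls, there are `n * (n + 1)` slots for pairs
-- of a state and an occurrence, shared by `read` and `dead`, and `n + 1` slots for halting; the
-- edge from the last state to `0` has to fit into these.
open Classical in
theorem card_validSet_le (hn : n ≠ 0) (a₀ : A) :
    M.validSet.card ≤ k * (Fintype.card A + 1) + n * (n + 3) + 1 := by
  set W : Finset (Idx A n k) := insert .ans (Finset.univ.image fun x : Fin k × Option A =>
    x.2.elim (.wbase x.1) fun a => .wstep x.1 a) with hW
  have hWc : W.card ≤ k * (Fintype.card A + 1) + 1 := by
    refine (Finset.card_insert_le _ _).trans (Nat.succ_le_succ (Finset.card_image_le.trans ?_))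
    simp
  have hW0 : Idx.ans ∈ W := Finset.mem_insert_self _ _
  have hW1 : ∀ i, Idx.wbase i ∈ W := fun i =>
    Finset.mem_insert_of_mem (Finset.mem_image.2 ⟨(i, none), Finset.mem_univ _, rfl⟩)
  have hW2 : ∀ i a, Idx.wstep i a ∈ W := fun i a =>
    Finset.mem_insert_of_mem (Finset.mem_image.2 ⟨(i, some a), Finset.mem_univ _, rfl⟩)
  suffices h : ∃ S : Finset (Idx A n k), S.card ≤ n * (n + 3) ∧ M.validSet ⊆ W ∪ S by
    obtain ⟨S, hS, hsub⟩ := h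
    have := (Finset.card_le_card hsub).trans (Finset.card_union_le _ _)
    omega
  have hvalid : ∀ {i}, i ∈ M.validSet ↔ M.Valid i := by simp [validSet]
  set lt : Fin n → A := fun q => Sum.elim id (fun _ => a₀) (M.lab q) with hlt
  have hlab : ∀ {q a}, M.lab q = Sum.inl a → lt q = a := by
    intro q a h
    simp [hlt, h]
  by_cases hr : ∃ q i, M.lab q = Sum.inr i
  · set C : Finset (Fin n) := Finset.univ.filter fun q => ∃ a, M.lab q = Sum.inl a
    set R : Finset (Fin n) := Finset.univ.filter fun q => ¬ ∃ a, M.lab q = Sum.inl a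
    set E : Finset (Fin (n + 1)) := Finset.univ.filter fun p => M.Calls p
    set N : Finset (Fin (n + 1)) := Finset.univ.filter fun p => ¬ M.Calls p
    set L : Finset A := Finset.univ.filter fun a => M.IsLetter a
    set T := M.targetSet
    set U := T.filter fun q => M.Star q.succ
    have hRi : ∀ {q}, (¬ ∃ a, M.lab q = Sum.inl a) ↔ ∃ i, M.lab q = Sum.inr i := by
      intro q
      rcases M.lab q with a | i <;> simp
    have hCR : C.card + R.card = n := by
      simpa only [Finset.card_univ, Fintype.card_fin] using
        Finset.card_filter_add_card_filter_not (s := (Finset.univ : Finset (Fin n)))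
          (fun q => ∃ a, M.lab q = Sum.inl a)
    have hNE : N.card + E.card = n + 1 := by
      rw [add_comm]
      simpa using Finset.card_filter_add_card_filter_not (s := (Finset.univ : Finset (Fin (n + 1))))
        (fun p => M.Calls p)
    have hL : L.card ≤ C.card := by
      have : L ⊆ C.image lt := by
        intro a ha
        obtain ⟨q, hq⟩ : M.IsLetter a := by simpa [L] using ha
        exact Finset.mem_image.2 ⟨q, by simp [C, hq], hlab hq⟩
      exact (Finset.card_le_card this).trans Finset.card_image_le
    have hTR : T.card ≤ R.card := by
      refine Finset.card_le_card fun q hq => ?_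
      obtain ⟨hi, -⟩ : M.Target q := by simpa [T, targetSet] using hq
      simpa only [R, Finset.mem_filter, Finset.mem_univ, true_and, hRi] using hi
    have hR : R.card ≠ 0 := by
      obtain ⟨q, hq⟩ := hr
      refine Finset.card_ne_zero.2 ⟨q, ?_⟩
      simpa only [R, Finset.mem_filter, Finset.mem_univ, true_and, hRi] using hq
    have hcount := count_aux hCR hNE card_callSet_le card_targetSet_add_le hL hTR hR
    refine ⟨(N ×ˢ C).image (fun x => .read x.1 x.2 (lt x.2)) ∪
      insert (.dead (Fin.last n) 0) (Finset.univ.image fun q : Fin n => .dead q.castSucc q.succ) ∪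
      (T ×ˢ L).image (fun x => .loop x.1 x.2) ∪
      -- `accept` and `drain` have complementary conditions, so each pair accounts for only one
      -- rule.
      (T ×ˢ L).image (fun x => if M.Star x.1.succ ∨ ¬ M.Calls x.1.succ then .accept x.1 x.2
        else .drain x.1 x.2) ∪
      (U ×ˢ L).image (fun x => .check x.1 x.2) ∪ N.image .halt ∪
      M.callSet.image (fun x => .call x.1 x.2), le_trans ?_ hcount, ?_⟩
    · have hc : ∀ (X Y : Finset (Idx A n k)) (a b : ℕ), X.card ≤ a → Y.card ≤ b →
          (X ∪ Y).card ≤ a + b := fun X Y a b h h' =>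
        (Finset.card_union_le _ _).trans (Nat.add_le_add h h')
      refine hc _ _ _ _ (hc _ _ _ _ (hc _ _ _ _ (hc _ _ _ _ (hc _ _ _ _ (hc _ _ _ _ ?_ ?_) ?_) ?_)
        ?_) ?_) ?_
      · exact Finset.card_image_le.trans (Finset.card_product _ _).le
      · refine (Finset.card_insert_le _ _).trans (Nat.succ_le_succ (Finset.card_image_le.trans ?_))
        simp
      · exact Finset.card_image_le.trans (Finset.card_product _ _).le
      · exact Finset.card_image_le.trans (Finset.card_product _ _).le
      · exact Finset.card_image_le.trans (Finset.card_product _ _).le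
      · exact Finset.card_image_le
      · exact Finset.card_image_le
    · intro i hi
      rw [hvalid] at hi
      have hT : ∀ {q}, M.Target q → q ∈ T := by intro q hq; simpa [T, targetSet] using hq
      have hL' : ∀ {a}, M.IsLetter a → a ∈ L := by intro a ha; simpa [L] using ha
      simp only [Finset.mem_union, Finset.mem_image, Finset.mem_product, Finset.mem_insert]
      cases i with
      | ans => exact Or.inl hW0
      | wbase i => exact Or.inl (hW1 i)
      | wstep i a => exact Or.inl (hW2 i a)
      | read p q a =>
        have hp : p ∈ N := by
          simpa [N] using fun h : M.Calls p => h.not_read hi.1 hi.2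
        have hq : q ∈ C := by simpa [C] using ⟨a, hi.2⟩
        exact Or.inr (Or.inl (Or.inl (Or.inl (Or.inl (Or.inl (Or.inl
          ⟨(p, q), ⟨hp, hq⟩, by simp [hlab hi.2]⟩))))))
      | dead p p' =>
        refine Or.inr (Or.inl (Or.inl (Or.inl (Or.inl (Or.inl (Or.inr ?_))))))
        rcases hi with ⟨q, rfl, rfl, -⟩ | ⟨rfl, rfl, -⟩
        · exact Or.inr ⟨q, Finset.mem_univ _, rfl⟩
        · exact Or.inl rfl
      | loop q a =>
        exact Or.inr (Or.inl (Or.inl (Or.inl (Or.inl (Or.inr ⟨(q, a), ⟨hT hi.1, hL' hi.2⟩, rfl⟩)))))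
      | accept q a =>
        exact Or.inr (Or.inl (Or.inl (Or.inl (Or.inr
          ⟨(q, a), ⟨hT hi.1, hL' hi.2.1⟩, if_pos hi.2.2⟩))))
      | drain q a =>
        exact Or.inr (Or.inl (Or.inl (Or.inl (Or.inr
          ⟨(q, a), ⟨hT hi.1, hL' hi.2.1⟩, if_neg fun h => h.elim hi.2.2.1 fun h => h hi.2.2.2⟩))))
      | check q a =>
        exact Or.inr (Or.inl (Or.inl (Or.inr ⟨(q, a),
          ⟨Finset.mem_filter.2 ⟨hT hi.1, hi.2.2.1⟩, hL' hi.2.1⟩, rfl⟩)))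
      | halt p => exact Or.inr (Or.inl (Or.inr ⟨p, by simpa [N] using hi.1, rfl⟩))
      | call p q => exact Or.inr (Or.inr ⟨(p, q), by simpa [callSet, Valid] using hi, rfl⟩)
  · have hch : ∀ q, ∃ a, M.lab q = Sum.inl a := by
      intro q
      rcases hq : M.lab q with a | i
      · exact ⟨a, rfl⟩
      · exact (hr ⟨q, i, hq⟩).elim
    have hT : ∀ q, ¬ M.Target q := fun q h => hr ⟨q, h.1⟩
    -- Without recalls and without a hub, `p₀` is not final, so it has no halting rule; its slot
    -- goes to the `dead` rule from the last state to `0`.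
    set p₀ : Fin (n + 1) := if M.fin 0 then Fin.last n else 0 with hp₀
    refine ⟨Finset.univ.image (fun x : Fin (n + 1) × Fin n =>
      if M.tr x.1 x.2 then .read x.1 x.2 (lt x.2) else .dead x.1 x.2.succ) ∪
      Finset.univ.image (fun p => if ¬ M.Hub ∧ p = p₀ then .dead (Fin.last n) 0 else .halt p),
      ?_, ?_⟩
    · have h1 := (Finset.card_image_le (s := (Finset.univ : Finset (Fin (n + 1) × Fin n)))
        (f := fun x => if M.tr x.1 x.2 then (.read x.1 x.2 (lt x.2) : Idx A n k)
          else .dead x.1 x.2.succ))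
      have h2 := (Finset.card_image_le (s := (Finset.univ : Finset (Fin (n + 1))))
        (f := fun p => if ¬ M.Hub ∧ p = p₀ then (.dead (Fin.last n) 0 : Idx A n k) else .halt p))
      refine (Finset.card_union_le _ _).trans ((Nat.add_le_add h1 h2).trans ?_)
      have : 1 ≤ n := Nat.one_le_iff_ne_zero.2 hn
      simp only [Finset.card_univ, Fintype.card_prod, Fintype.card_fin]
      nlinarith
    · intro i hi
      rw [hvalid] at hi
      simp only [Finset.mem_union, Finset.mem_image, Finset.mem_univ, true_and]
      cases i with
      | ans => exact Or.inl hW0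
      | wbase i => exact Or.inl (hW1 i)
      | wstep i a => exact Or.inl (hW2 i a)
      | read p q a => exact Or.inr (Or.inl ⟨(p, q), by simp [hi.1, hlab hi.2]⟩)
      | dead p p' =>
        rcases hi with ⟨q, rfl, rfl, h⟩ | ⟨rfl, rfl, h⟩
        · exact Or.inr (Or.inl ⟨(q.castSucc, q), if_neg h⟩)
        · exact Or.inr (Or.inr ⟨p₀, if_pos ⟨h, rfl⟩⟩)
      | loop q a => exact (hT q hi.1).elim
      | accept q a => exact (hT q hi.1).elim
      | drain q a => exact (hT q hi.1).elim
      | check q a => exact (hT q hi.1).elim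
      | halt p =>
        have hfin : M.fin p := by
          refine hi.2.resolve_right ?_
          rintro ⟨⟨q, i, -, h⟩, -⟩
          exact hr ⟨q, i, h⟩
        refine Or.inr (Or.inr ⟨p, if_neg ?_⟩)
        rintro ⟨hub, rfl⟩
        refine hub ⟨hch, ?_⟩
        by_cases h0 : M.fin 0
        · refine ⟨h0, ?_⟩
          rwa [hp₀, if_pos h0] at hfin
        · rw [hp₀, if_neg h0] at hfin
          exact (h0 hfin).elim
      | call p q =>
        obtain ⟨-, i, h⟩ := hi
        exact (hr ⟨q, i, h⟩).elim

theorem card_rules_prog_le (hn : n ≠ 0) :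
    (M.prog a₀).rules.card ≤ k * (Fintype.card A + 1) + n * (n + 3) + 1 := by
  classical exact Finset.card_image_le.trans (card_validSet_le hn a₀)

end MemAut

/-! ## The main theorem -/

/-- A program without recursion whose language is empty or consists of the empty word. -/
theorem exists_program_of_subset {A : Type*} (L : Language A) (hL : ∀ w ∈ L, w = []) :
    ∃ P : Program A Unit, P.IsSDDOLLA ∧ P.IsBoolean ∧ P.language = L ∧ P.rules.card ≤ 1 := by
  classical
  set ρ : Rule A Unit := ⟨(), [], [Atom.eqn 0 []]⟩ with hρ
  let P : Program A Unit :=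
    { univ := 0
      ans := ()
      ar := fun _ => 0
      rules := if [] ∈ L then {ρ} else ∅
      wf := by
        intro χ hχ
        obtain rfl : χ = ρ := by
          split_ifs at hχ <;> simp at hχ; exact hχ
        refine ⟨rfl, by simp [hρ], ?_, by simp [hρ]⟩
        simp [hρ, Atom.WF] }
  have hmem : ∀ {χ}, χ ∈ P.rules ↔ [] ∈ L ∧ χ = ρ := by
    intro χ
    simp only [P]
    split_ifs with h <;> simp [h]
  have hrec : P.recAtoms ρ = [] := rfl
  refine ⟨P, ⟨⟨⟨?_, ?_⟩, ?_, ?_⟩, ?_⟩, rfl, ?_, ?_⟩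
  · intro χ hχ
    rw [(hmem.1 hχ).2, hrec]
    simp
  · intro χ hχ
    rw [(hmem.1 hχ).2]
    refine ⟨?_, ?_⟩
    · intro v α h
      obtain ⟨rfl, rfl⟩ : v = 0 ∧ α = [] := by simpa [hρ] using h
      exact Or.inl ⟨by simp [Program.top, P], Or.inl rfl⟩
    · rintro x - ⟨-, v, α, h, ⟨a, ha⟩, -⟩
      obtain ⟨rfl, rfl⟩ : v = 0 ∧ α = [] := by simpa [hρ] using h
      simp [Program.IsRightForm, Program.pvar, Program.letter] at ha
  · intro χ hχ w t b b' h h'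
    rw [(hmem.1 hχ).2] at h h'
    obtain ⟨θ, -, -, -, rfl⟩ := h
    obtain ⟨θ', -, -, -, rfl⟩ := h'
    simp [Program.bottom, hrec]
  · intro χ hχ χ' hχ' _ hne
    exact (hne ((hmem.1 hχ).2.trans (hmem.1 hχ').2.symm)).elim
  · intro χ hχ hc
    rw [(hmem.1 hχ).2] at hc
    exact (hc.1 hrec).elim
  · ext w
    constructor
    · intro h
      have h : P.Derives w () [] := h
      generalize ([] : List (List A)) = tt at h
      obtain ⟨χ, hχ, θ, hθ, heq, -⟩ := h
      obtain ⟨hL', rfl⟩ := hmem.1 hχ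
      have h1 : θ 0 = [] := heq 0 [] (by simp [hρ])
      have h2 : θ 0 = w := hθ.1
      rw [← h2, h1]
      exact hL'
    · intro h
      obtain rfl := hL w h
      exact Program.Derives.step (P := P) ρ (hmem.2 ⟨h, rfl⟩) (fun _ => [])
        ⟨rfl, fun _ _ => List.nil_infix⟩
        (by
          intro v α h
          obtain ⟨rfl, rfl⟩ : v = 0 ∧ α = [] := by simpa [hρ] using h
          rfl)
        (by simp [hρ])
  · simp only [P]
    split_ifs <;> simp

theorem mainTheorem10 {A : Type*} [Fintype A] (γ : Regex A) (hγ : γ.IsDRX) :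
    ∃ (S : Type) (_ : Fintype S) (P : Program A S),
      P.IsSDDOLLA ∧ P.IsBoolean ∧ P.language = γ.language ∧
      Fintype.card S ≤ γ.numMem + γ.numOcc + 2 ∧
      P.rules.card ≤
        γ.numMem * (Fintype.card A + 1) + γ.numOcc * (γ.numOcc + 3) + 1 := by
  by_cases h : ∀ w ∈ γ.language, w = []
  · obtain ⟨P, h1, h2, h3, h4⟩ := exists_program_of_subset γ.language h
    refine ⟨Unit, inferInstance, P, h1, h2, h3, ?_, ?_⟩
    · simp only [Fintype.card_unit]; omega
    · omega
  -- A nonempty word of the language serves three purposes: it yields the letter `a₀` for the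
  -- contradictory equations, it shows that there is an occurrence, and its run guides the
  -- derivation on the empty input.
  · push Not at h
    obtain ⟨w, hw, hne⟩ := h
    obtain ⟨a₀, -⟩ := List.exists_mem_of_ne_nil _ hne
    have hrun : (γ.memAut hγ).Run 0 (fun _ => []) w := by
      rw [← γ.language_memAut hγ] at hw
      exact hw
    have hn : γ.numOcc ≠ 0 := MemAut.ne_zero_of_run hne hrun
    refine ⟨MemAut.Sym γ.numOcc γ.numMem, inferInstance, (γ.memAut hγ).prog a₀,
      MemAut.isSDDOLLA_prog, rfl, ?_, ?_, MemAut.card_rules_prog_le hn⟩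
    · rw [MemAut.language_prog hne hrun, Regex.language_memAut]
    · simp only [MemAut.Sym, Fintype.card_option, Fintype.card_sum, Fintype.card_fin]
      omega
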